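/- Let $1<s<2$ and $D=-i\partial_x$, and write $|D|^s$ for the Fourier multiplier on $\mathbb R$ with symbol $|\xi|^s$. For $\beta\ge 0$ and $u\in H^{s/2}(\mathbb R)$ (complex valued) let $$\mathcal E_\beta(u)=\frac12\int_{\mathbb R}\bar u\,|D|^su-\beta\int_{\mathbb R}\bar u\,Du-\frac1{2s+2}\int_{\mathbb R}|u|^{2s+2},$$ and for $N>0$ let $\mathbf Q_{\beta,N}$ be the set of minimizers of $\mathcal E_\beta$ over all $u\in H^{s/2}(\mathbb R)$ with $\int_{\mathbb R}|u|^2=N$. Let $Q$ be the ground state, i.e. the positive solution $Q\in H^{s/2}(\mathbb R)$ of $|D|^sQ+Q=|Q|^{2s}Q$ which attains the best constant in the Gagliardo--Nirenberg inequality $\int|u|^{2s+2}\le C\left(\int\bar u|D|^su\right)\left(\int|u|^2\right)^s$, $u\in H^{s/2}(\mathbb R)$ (it is unique up to translation). Then there exists $N_0$ with $0<N_0<\|Q\|_{L^2}^2$, depending only on $s$, such that the following holds: for all $0<N<N_0$, all $\beta\ge0$ and all $Q_{\beta,N},\tilde Q_{\beta,N}\in\mathbf Q_{\beta,N}$ there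 exist $\phi,y\in\mathbb R$ such that $$\tilde Q_{\beta,N}(x)=e^{i\phi}\,Q_{\beta,N}(x-y)\qquad\text{for almost every }x\in\mathbb R.$$ -/

import Mathlib

open scoped FourierTransform SchwartzMap

namespace FracNLS

/-- Square integrable complex functions on the line (modulo a.e. equality). -/
abbrev L2 : Type := MeasureTheory.Lp ℂ 2 (MeasureTheory.volume : MeasureTheory.Measure ℝ)

/-- `u` belongs to the Sobolev space `H^r(ℝ)`. -/
def MemH (r : ℝ) (u : L2) : Prop :=
  TemperedDistribution.MemSobolev r 2 (u : 𝓢'(ℝ, ℂ))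

/-- The mass `∫ |u|²`. -/
noncomputable def mass (u : L2) : ℝ :=
  ∫ x : ℝ, ‖u x‖ ^ 2

/-- The quadratic form `∫ ū |D|^s u`, where `D = -i ∂ₓ`. Mathlib's Fourier transform has the kernel
`exp (-2 π i x ξ)`, so that `D` is the Fourier multiplier with symbol `2 π ξ`. -/
noncomputable def kinetic (s : ℝ) (u : L2) : ℝ :=
  ∫ ξ : ℝ, |2 * Real.pi * ξ| ^ s * ‖(𝓕 u : L2) ξ‖ ^ 2

/-- The quadratic form `∫ ū D u`. -/
noncomputable def momentum (u : L2) : ℝ :=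
  ∫ ξ : ℝ, (2 * Real.pi * ξ) * ‖(𝓕 u : L2) ξ‖ ^ 2

/-- The integral `∫ |u|^{2s+2}`. -/
noncomputable def potential (s : ℝ) (u : L2) : ℝ :=
  ∫ x : ℝ, ‖u x‖ ^ (2 * s + 2)

/-- The energy
`E_β(u) = 1/2 ∫ ū |D|^s u - β ∫ ū D u - 1/(2s+2) ∫ |u|^{2s+2}`. -/
noncomputable def energy (s β : ℝ) (u : L2) : ℝ :=
  1 / 2 * kinetic s u - β * momentum u - 1 / (2 * s + 2) * potential s u

/-- The set of minimizers of `E_β` among the functions of `H^{s/2}(ℝ)` of mass `N`. -/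
def minimizers (s β N : ℝ) : Set L2 :=
  {u | MemH (s / 2) u ∧ mass u = N ∧
    ∀ v : L2, MemH (s / 2) v → mass v = N → energy s β u ≤ energy s β v}

/-- `Q` solves `|D|^s Q + Q = |Q|^{2s} Q` weakly, with test functions in `H^{s/2}(ℝ)`. -/
def SolvesGroundStateEq (s : ℝ) (Q : L2) : Prop :=
  ∀ φ : L2, MemH (s / 2) φ →
    (∫ ξ : ℝ, ((|2 * Real.pi * ξ| ^ s : ℝ) : ℂ) * (𝓕 Q : L2) ξ * star ((𝓕 φ : L2) ξ))
        + ∫ x : ℝ, Q x * star (φ x)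
      = ∫ x : ℝ, ((‖Q x‖ ^ (2 * s) : ℝ) : ℂ) * Q x * star (φ x)

/-- `Q` attains the best constant in the Gagliardo-Nirenberg inequality
`∫ |u|^{2s+2} ≤ C (∫ ū |D|^s u) (∫ |u|²)^s`, `u ∈ H^{s/2}(ℝ)`
(both sides multiplied by `(∫ Q̄ |D|^s Q) (∫ |Q|²)^s`). -/
def IsGNOptimizer (s : ℝ) (Q : L2) : Prop :=
  ∀ u : L2, MemH (s / 2) u →
    potential s u * (kinetic s Q * mass Q ^ s) ≤ potential s Q * (kinetic s u * mass u ^ s)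

/-- `Q` is a ground state of `|D|^s Q + Q = |Q|^{2s} Q` : a positive solution in `H^{s/2}(ℝ)` which
optimizes the Gagliardo-Nirenberg inequality. -/
structure IsGroundState (s : ℝ) (Q : L2) : Prop where
  memH : MemH (s / 2) Q
  pos : ∀ᵐ x : ℝ, 0 < (Q x).re ∧ (Q x).im = 0
  eq : SolvesGroundStateEq s Q
  optimizer : IsGNOptimizer s Q

end FracNLS

namespace FracNLS

open MeasureTheory Filter Topology Set

/-! For β = 0 and small mass there are no minimizers: the Gagliardo–Nirenberg inequality makes the
energy positive on nonzero functions, and spreading out lowers it. For β > 0 the boosted symbol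
|p|^s/2 - βp has its minimum at the frequency k with (s/2) k^(s-1) = β, and a minimizer of small
mass concentrates there. Writing p = k(1 + 2πεη), subtracting the constant that the mass fixes, and
normalizing turns the problem into minimizing `en s ε` = `ten s ε` - `pot s` at the fixed mass `m0
s`. The mass alone determines ε, through ε^(2-s) ~ N^s, so smallness of N means smallness of ε
uniformly in β. As ε → 0 the symbol `sym s ε` tends to (2πη)², and the limit is the focusing
Schrödinger energy ∫|v'|² - ∫|v|^(2s+2). It is mass subcritical because s < 2, and its minimizer is
the explicit soliton w = cosh(sx)^(-1/s).

Minimizers for small ε are close to w up to symmetries. A bound on the homogeneous Sobolev form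
(`exists_hom_le`) permits truncation to low frequencies with small loss, and the truncation is
nearly optimal for the limit problem. Stability there (`exists_stable`) needs no compactness of
minimizing sequences. Completing the square with the first order equation of the profile writes the
energy as a function of the height max|v| plus the squared norm of a defect
(`CSob.integral_defect`). Near-optimality forces height near 1 and small defect, and an ODE barrier
then forces v to be close to w.

Two minimizers near w coincide after modulation (`exists_locally_unique`). Their common phase and
translation are fixed by orthogonality conditions, and they are written u + h and u - h. Comparison
with the midpoint u, renormalized to the right mass (`IsMin.midpoint`), bounds the linearized form
at h by a small multiple of ‖h‖². No Euler–Lagrange equation is needed. The form is coercive under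
the orthogonality conditions (`exists_coercive_complex`), which follows from Jacobi functions
tanh(sx) and 3 tanh²(sx) - 1 and from the scaling generator. Equality of the masses makes the
remaining component of h along w negligible, so h = 0. -/

/-! ### Fourier inversion and Plancherel for integrable L² functions -/

/-- Functions in `L²` that define the same tempered distribution agree almost everywhere. -/
theorem ae_eq_of_integral_schwartz_smul_eq {f g : ℝ → ℂ} (hf : LocallyIntegrable f)
    (hg : LocallyIntegrable g)
    (h : ∀ φ : 𝓢(ℝ, ℂ), ∫ x, φ x • f x = ∫ x, φ x • g x) : f =ᵐ[volume] g := by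
  apply ae_eq_of_integral_contDiff_smul_eq hf hg
  intro φ hφ hc
  have hg₁ : HasCompactSupport (Complex.ofRealCLM ∘ φ) := hc.comp_left rfl
  exact h (hg₁.toSchwartzMap (Complex.ofRealCLM.contDiff.comp hφ))

theorem continuous_neg_innerₗ : Continuous fun p : ℝ × ℝ => (-innerₗ ℝ) p.1 p.2 := by
  have : (fun p : ℝ × ℝ => (-innerₗ ℝ) p.1 p.2) = fun p => -(p.2 * p.1) := by
    ext p; simp
  rw [this]; fun_prop

/-- The abstract L² transform is known through its action on Schwartz functions, so both sides are
tested against these and the transform is moved to the test function. -/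
theorem fourierInv_L2_ae_eq {G : L2} (hG : Integrable (G : ℝ → ℂ)) :
    ((𝓕⁻ G : L2) : ℝ → ℂ) =ᵐ[volume] 𝓕⁻ (G : ℝ → ℂ) := by
  apply ae_eq_of_integral_schwartz_smul_eq
  · exact (Lp.memLp _).locallyIntegrable (by norm_num)
  · refine Continuous.locallyIntegrable ?_
    exact VectorFourier.fourierIntegral_continuous Real.continuous_fourierChar
      continuous_neg_innerₗ hG
  intro φ
  calc ∫ x, φ x • (𝓕⁻ G : L2) x = ((𝓕⁻ G : L2) : 𝓢'(ℝ, ℂ)) φ := by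
        rw [Lp.toTemperedDistribution_apply]
    _ = (𝓕⁻ (G : 𝓢'(ℝ, ℂ))) φ := by rw [Lp.fourierInv_toTemperedDistribution_eq]
    _ = ∫ x, (𝓕⁻ φ) x • G x := by
        rw [TemperedDistribution.fourierInv_apply, Lp.toTemperedDistribution_apply]
    _ = ∫ x, φ x • 𝓕⁻ (G : ℝ → ℂ) x := by
        rw [SchwartzMap.fourierInv_coe]
        have := VectorFourier.integral_fourierIntegral_smul_eq_flip (μ := volume) (ν := volume)
          (L := -innerₗ ℝ) (f := φ) (g := G)
          Real.continuous_fourierChar continuous_neg_innerₗ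
          φ.integrable hG
        have hfl : (-innerₗ ℝ).flip = -innerₗ ℝ := by ext; simp
        rw [hfl] at this
        exact this

theorem fourierInv_toLp_ae_eq {G : ℝ → ℂ} (hG : Integrable G) (h2 : MemLp G 2) :
    ((𝓕⁻ (h2.toLp G) : L2) : ℝ → ℂ) =ᵐ[volume] 𝓕⁻ G := by
  have h := fourierInv_L2_ae_eq (G := h2.toLp G) (hG.congr h2.coeFn_toLp.symm)
  refine h.trans (Eventually.of_forall fun x => ?_)
  rw [Real.fourierInv_eq_fourier_neg, Real.fourierInv_eq_fourier_neg,
    Real.fourier_congr_ae h2.coeFn_toLp]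

theorem memLp_fourierInv {G : ℝ → ℂ} (hG : Integrable G) (h2 : MemLp G 2) :
    MemLp (𝓕⁻ G) 2 :=
  (memLp_congr_ae (fourierInv_toLp_ae_eq hG h2)).1 (Lp.memLp _)

theorem integral_inner_fourierInv {G H : ℝ → ℂ} (hG : Integrable G) (h2G : MemLp G 2)
    (hH : Integrable H) (h2H : MemLp H 2) :
    ∫ x, inner ℂ (𝓕⁻ G x) (𝓕⁻ H x) = ∫ ξ, inner ℂ (G ξ) (H ξ) := by
  have h1 : inner ℂ (𝓕⁻ (h2G.toLp G) : L2) (𝓕⁻ (h2H.toLp H) : L2)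
      = inner ℂ (h2G.toLp G) (h2H.toLp H) :=
    (Lp.fourierTransformₗᵢ ℝ ℂ).symm.inner_map_map _ _
  rw [L2.inner_def, L2.inner_def] at h1
  refine Eq.trans (integral_congr_ae ?_) (h1.trans (integral_congr_ae ?_))
  · filter_upwards [fourierInv_toLp_ae_eq hG h2G, fourierInv_toLp_ae_eq hH h2H] with x h h'
    rw [h, h']
  · filter_upwards [h2G.coeFn_toLp, h2H.coeFn_toLp] with x h h'
    rw [h, h']

theorem integral_norm_sq_fourierInv {G : ℝ → ℂ} (hG : Integrable G) (h2G : MemLp G 2) :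
    ∫ x, ‖𝓕⁻ G x‖ ^ 2 = ∫ ξ, ‖G ξ‖ ^ 2 := by
  have h := integral_inner_fourierInv hG h2G hG h2G
  simp_rw [inner_self_eq_norm_sq_to_K] at h
  norm_cast at h

theorem continuous_fourierInv {G : ℝ → ℂ} (hG : Integrable G) : Continuous (𝓕⁻ G) :=
  VectorFourier.fourierIntegral_continuous Real.continuous_fourierChar
      continuous_neg_innerₗ hG

theorem norm_fourierInv_le (G : ℝ → ℂ) (x : ℝ) : ‖𝓕⁻ G x‖ ≤ ∫ ξ, ‖G ξ‖ :=
  VectorFourier.norm_fourierIntegral_le_integral_norm _ _ _ _ _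

theorem tendsto_fourierInv_cocompact (G : ℝ → ℂ) : Tendsto (𝓕⁻ G) (cocompact ℝ) (𝓝 0) := by
  rw [Real.fourierInv_eq_fourier_comp_neg]
  exact Real.zero_at_infty_fourier _

theorem fourierInv_eq_integral (G : ℝ → ℂ) (x : ℝ) :
    𝓕⁻ G x = ∫ ξ, Complex.exp ((2 * Real.pi * ξ * x : ℝ) * Complex.I) * G ξ := by
  rw [Real.fourierInv_eq']
  simp [mul_assoc, mul_comm, mul_left_comm]

theorem hasDerivAt_fourierInv {G : ℝ → ℂ} (hG : Integrable G)
    (hG' : Integrable fun ξ : ℝ => (ξ : ℂ) * G ξ) (x : ℝ) :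
    HasDerivAt (𝓕⁻ G) (𝓕⁻ (fun ξ : ℝ => (2 * Real.pi * Complex.I * ξ) * G ξ) x) x := by
  have h := Real.hasDerivAt_fourier hG (by simpa using hG') (-x)
  have h2 := h.scomp x (hasDerivAt_neg x)
  have e1 : (𝓕⁻ G) = (𝓕 G) ∘ Neg.neg := by
    ext y; simp [Real.fourierInv_eq_fourier_neg]
  rw [e1]
  have e2 : (𝓕⁻ (fun ξ : ℝ => (2 * Real.pi * Complex.I * ξ) * G ξ) x) =
      (-1 : ℝ) • 𝓕 (fun x : ℝ => (-2 * Real.pi * Complex.I * x) • G x) (-x) := by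
    rw [Real.fourierInv_eq_fourier_neg, Real.fourier_eq, Real.fourier_eq, ← integral_smul]
    congr 1; ext y
    simp [Circle.smul_def]
  rw [e2]
  exact h2

theorem fourierInv_add' {G H : ℝ → ℂ} (hG : Integrable G) (hH : Integrable H) (x : ℝ) :
    𝓕⁻ (fun ξ => G ξ + H ξ) x = 𝓕⁻ G x + 𝓕⁻ H x := by
  have := congrFun (VectorFourier.fourierIntegral_add (e := Real.fourierChar) (μ := volume) (L := -innerₗ ℝ)
    Real.continuous_fourierChar continuous_neg_innerₗ hG hH) x
  exact this

theorem fourierInv_const_mul (c : ℂ) (G : ℝ → ℂ) (x : ℝ) :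
    𝓕⁻ (fun ξ => c * G ξ) x = c * 𝓕⁻ G x := by
  rw [fourierInv_eq_integral, fourierInv_eq_integral, ← integral_const_mul]
  congr 1; ext; ring

theorem fourierInv_sub' {G H : ℝ → ℂ} (hG : Integrable G) (hH : Integrable H) (x : ℝ) :
    𝓕⁻ (fun ξ => G ξ - H ξ) x = 𝓕⁻ G x - 𝓕⁻ H x := by
  have := fourierInv_add' hG (hH.const_mul (-1)) x
  rw [fourierInv_const_mul] at this
  simpa [sub_eq_add_neg] using this

/-! ### The energy space on the Fourier side and the Gagliardo–Nirenberg inequality -/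

/-- `G` is (a representative of) the Fourier transform of a function in `H^{s/2}(ℝ)`. -/
structure Adm (s : ℝ) (G : ℝ → ℂ) : Prop where
  aesm : AEStronglyMeasurable G volume
  int : Integrable fun ξ : ℝ => (1 + |ξ| ^ s) * ‖G ξ‖ ^ 2

/-- The squared `L²` norm. -/
noncomputable def nsq (G : ℝ → ℂ) : ℝ := ∫ ξ, ‖G ξ‖ ^ 2

/-- The homogeneous Sobolev form on the Fourier side. -/
noncomputable def hom (s : ℝ) (G : ℝ → ℂ) : ℝ := ∫ ξ : ℝ, |ξ| ^ s * ‖G ξ‖ ^ 2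

/-- The potential energy of the inverse Fourier transform of `G`. -/
noncomputable def pot (s : ℝ) (G : ℝ → ℂ) : ℝ := ∫ x : ℝ, ‖𝓕⁻ G x‖ ^ (2 * s + 2)

theorem nsq_nonneg (G : ℝ → ℂ) : 0 ≤ nsq G := integral_nonneg fun _ => by positivity

theorem hom_nonneg (s : ℝ) (G : ℝ → ℂ) : 0 ≤ hom s G := integral_nonneg fun _ => by positivity

theorem pot_nonneg (s : ℝ) (G : ℝ → ℂ) : 0 ≤ pot s G := integral_nonneg fun _ => by positivity

theorem measurable_abs_rpow (s : ℝ) : Measurable fun ξ : ℝ => |ξ| ^ s := by fun_prop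

namespace Adm

variable {s : ℝ} {G H : ℝ → ℂ}

theorem of_le (hG : Adm s G) (hH : AEStronglyMeasurable H volume) {c : ℝ}
    (h : ∀ ξ, ‖H ξ‖ ^ 2 ≤ c * ‖G ξ‖ ^ 2) : Adm s H := by
  refine ⟨hH, (hG.int.const_mul c).mono' ?_ (Eventually.of_forall fun ξ => ?_)⟩
  · exact ((measurable_const.add (measurable_abs_rpow s)).aestronglyMeasurable).mul (hH.norm.pow 2)
  · rw [Real.norm_of_nonneg (by positivity)]
    have h1 : 0 ≤ 1 + |ξ| ^ s := by positivity
    nlinarith [mul_le_mul_of_nonneg_left (h ξ) h1]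

theorem int_sq (hG : Adm s G) : Integrable fun ξ => ‖G ξ‖ ^ 2 := by
  refine hG.int.mono' (hG.aesm.norm.pow 2) (Eventually.of_forall fun ξ => ?_)
  rw [Real.norm_of_nonneg (by positivity)]
  have h1 : 0 ≤ |ξ| ^ s := by positivity
  nlinarith [mul_nonneg h1 (sq_nonneg ‖G ξ‖)]

theorem int_hom (hG : Adm s G) : Integrable fun ξ => |ξ| ^ s * ‖G ξ‖ ^ 2 := by
  refine hG.int.mono' ((measurable_abs_rpow s).aestronglyMeasurable.mul (hG.aesm.norm.pow 2))
    (Eventually.of_forall fun ξ => ?_)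
  rw [Real.norm_of_nonneg (by positivity)]
  nlinarith [sq_nonneg ‖G ξ‖]

theorem memLp (hG : Adm s G) : MemLp G 2 :=
  (memLp_two_iff_integrable_sq_norm hG.aesm).2 hG.int_sq

theorem add (hG : Adm s G) (hH : Adm s H) : Adm s fun ξ => G ξ + H ξ := by
  refine ⟨hG.aesm.add hH.aesm, ((hG.int.const_mul 2).add (hH.int.const_mul 2)).mono' ?_
    (Eventually.of_forall fun ξ => ?_)⟩
  · exact ((measurable_const.add (measurable_abs_rpow s)).aestronglyMeasurable).mul
      ((hG.aesm.add hH.aesm).norm.pow 2)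
  · rw [Real.norm_of_nonneg (by positivity)]
    have h1 : 0 ≤ 1 + |ξ| ^ s := by positivity
    have h2 : ‖G ξ + H ξ‖ ^ 2 ≤ 2 * ‖G ξ‖ ^ 2 + 2 * ‖H ξ‖ ^ 2 := by
      have := norm_add_le (G ξ) (H ξ)
      nlinarith [norm_nonneg (G ξ + H ξ), sq_nonneg (‖G ξ‖ - ‖H ξ‖)]
    have := mul_le_mul_of_nonneg_left h2 h1
    simp only [Pi.add_apply]
    linarith

theorem const_mul (hG : Adm s G) (c : ℂ) : Adm s fun ξ => c * G ξ :=
  hG.of_le (hG.aesm.const_mul c) (c := ‖c‖ ^ 2) fun ξ => by rw [norm_mul, mul_pow]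

theorem sub (hG : Adm s G) (hH : Adm s H) : Adm s fun ξ => G ξ - H ξ := by
  simpa [sub_eq_add_neg] using hG.add (hH.const_mul (-1))

theorem congr (hG : Adm s G) (h : G =ᵐ[volume] H) : Adm s H :=
  ⟨hG.aesm.congr h, hG.int.congr (h.mono fun ξ hξ => by simp only [hξ])⟩

end Adm

theorem nsq_const_mul (c : ℂ) (G : ℝ → ℂ) : nsq (fun ξ => c * G ξ) = ‖c‖ ^ 2 * nsq G := by
  simp_rw [nsq, norm_mul, mul_pow]; rw [integral_const_mul]

theorem hom_const_mul (s : ℝ) (c : ℂ) (G : ℝ → ℂ) :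
    hom s (fun ξ => c * G ξ) = ‖c‖ ^ 2 * hom s G := by
  simp_rw [hom, norm_mul, mul_pow]; rw [← integral_const_mul]; congr 1; ext; ring

theorem pot_const_mul {s : ℝ} (c : ℂ) (G : ℝ → ℂ) :
    pot s (fun ξ => c * G ξ) = ‖c‖ ^ (2 * s + 2) * pot s G := by
  simp_rw [pot, fourierInv_const_mul, norm_mul]; rw [← integral_const_mul]; congr 1; ext
  rw [Real.mul_rpow (norm_nonneg _) (norm_nonneg _)]

theorem one_add_rpow_le {s x : ℝ} (hs : 0 ≤ s) (hx : 0 ≤ x) :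
    (1 + x) ^ s ≤ 2 ^ s * (1 + x ^ s) := by
  rcases le_total x 1 with h | h
  · calc (1 + x) ^ s ≤ 2 ^ s := Real.rpow_le_rpow (by positivity) (by linarith) hs
      _ ≤ _ := le_mul_of_one_le_right (by positivity) (by linarith [Real.rpow_nonneg hx s])
  · calc (1 + x) ^ s ≤ (2 * x) ^ s := Real.rpow_le_rpow (by positivity) (by linarith) hs
      _ = 2 ^ s * x ^ s := Real.mul_rpow (by norm_num) hx
      _ ≤ _ := by gcongr; linarith

theorem integrable_inv_one_add_rpow {s : ℝ} (hs : 1 < s) :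
    Integrable fun ξ : ℝ => (1 + |ξ| ^ s)⁻¹ := by
  have h := (integrable_one_add_norm (μ := (volume : Measure ℝ)) (E := ℝ) (r := s)
    (by simpa using hs)).const_mul (2 ^ s)
  refine h.mono' (Measurable.aestronglyMeasurable (by fun_prop)) (Eventually.of_forall fun ξ => ?_)
  rw [Real.norm_of_nonneg (by positivity), Real.rpow_neg (by positivity), ← div_eq_mul_inv,
    le_div_iff₀ (by positivity), inv_mul_le_iff₀ (by positivity), mul_comm, Real.norm_eq_abs]
  exact one_add_rpow_le (by linarith) (abs_nonneg ξ)

theorem scaled_weight_eq {s r : ℝ} (hr : 0 < r) (ξ : ℝ) :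
    (r ^ s + |ξ| ^ s)⁻¹ = (r ^ s)⁻¹ * (1 + |ξ / r| ^ s)⁻¹ := by
  rw [abs_div, abs_of_pos hr, Real.div_rpow (abs_nonneg _) hr.le, ← mul_inv]
  have : r ^ s ≠ 0 := (Real.rpow_pos_of_pos hr s).ne'
  congr 1; field_simp

theorem integrable_inv_add_rpow {s r : ℝ} (hs : 1 < s) (hr : 0 < r) :
    Integrable fun ξ : ℝ => (r ^ s + |ξ| ^ s)⁻¹ := by
  simp_rw [scaled_weight_eq hr]
  exact ((integrable_inv_one_add_rpow hs).comp_div hr.ne').const_mul _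

theorem integral_inv_add_rpow {s r : ℝ} (hr : 0 < r) :
    ∫ ξ : ℝ, (r ^ s + |ξ| ^ s)⁻¹ = r ^ (1 - s) * ∫ ξ : ℝ, (1 + |ξ| ^ s)⁻¹ := by
  simp_rw [scaled_weight_eq hr]
  rw [integral_const_mul, Measure.integral_comp_div (fun ξ : ℝ => (1 + |ξ| ^ s)⁻¹), abs_of_pos hr,
    smul_eq_mul, ← mul_assoc, Real.rpow_sub hr, Real.rpow_one]
  ring

/-- Young's inequality in the form (θA‖z‖ - 1)² ≥ 0, where A is the weight. The frequency scale r
and the factor θ are left free for later optimization. -/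
theorem norm_le_weighted {s r θ : ℝ} (hr : 0 < r) (hθ : 0 < θ) (z : ℂ) (ξ : ℝ) :
    ‖z‖ ≤ 2⁻¹ * (θ * ((r ^ s + |ξ| ^ s) * ‖z‖ ^ 2) + θ⁻¹ * (r ^ s + |ξ| ^ s)⁻¹) := by
  have hA : 0 < r ^ s + |ξ| ^ s := by positivity
  set A := r ^ s + |ξ| ^ s
  have h : 0 ≤ θ⁻¹ * A⁻¹ * (θ * A * ‖z‖ - 1) ^ 2 := by positivity
  have e : θ⁻¹ * A⁻¹ * (θ * A * ‖z‖ - 1) ^ 2 = θ * (A * ‖z‖ ^ 2) + θ⁻¹ * A⁻¹ - 2 * ‖z‖ := by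
    field_simp; ring
  linarith

theorem Adm.integrable_scaled {s r : ℝ} {G : ℝ → ℂ} (hG : Adm s G) :
    Integrable fun ξ => (r ^ s + |ξ| ^ s) * ‖G ξ‖ ^ 2 := by
  simp_rw [add_mul]
  exact (hG.int_sq.const_mul _).add hG.int_hom

theorem Adm.integrable {s : ℝ} (hs : 1 < s) {G : ℝ → ℂ} (hG : Adm s G) : Integrable G := by
  have h1 := ((hG.integrable_scaled (r := 1)).const_mul 1).add
    ((integrable_inv_add_rpow hs one_pos).const_mul (1:ℝ)⁻¹)
  exact (h1.const_mul 2⁻¹).mono' hG.aesm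
    (Eventually.of_forall fun ξ => norm_le_weighted one_pos one_pos _ _)

/-- The constant in `integral_norm_rpow_le`. -/
noncomputable def gnConst (s : ℝ) : ℝ := (1 + 2⁻¹ * ∫ ξ : ℝ, (1 + |ξ| ^ s)⁻¹) ^ (2 * s)

theorem gnConst_pos (s : ℝ) : 0 < gnConst s := by
  have : 0 ≤ ∫ ξ : ℝ, (1 + |ξ| ^ s)⁻¹ := integral_nonneg fun _ => by positivity
  unfold gnConst; positivity

theorem ae_zero_of_nsq_eq_zero {s : ℝ} {G : ℝ → ℂ} (hG : Adm s G) (h : nsq G = 0) :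
    G =ᵐ[volume] 0 := by
  have := (integral_eq_zero_iff_of_nonneg (fun _ => by positivity) hG.int_sq).1 h
  filter_upwards [this] with ξ hξ
  simpa using hξ

theorem ae_zero_of_hom_eq_zero {s : ℝ} {G : ℝ → ℂ} (hG : Adm s G) (h : hom s G = 0) :
    G =ᵐ[volume] 0 := by
  have := (integral_eq_zero_iff_of_nonneg (fun _ => by positivity) hG.int_hom).1 h
  filter_upwards [this, Measure.ae_ne volume (0 : ℝ)] with ξ hξ h0
  have h1 : |ξ| ^ s ≠ 0 := (Real.rpow_pos_of_pos (abs_pos.2 h0) s).ne'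
  simpa [h1] using hξ

/-- Integrating `norm_le_weighted` and optimizing both parameters gives a scale invariant bound. Its
left side dominates the supremum of the inverse transform, so this serves as the sup-norm estimate
throughout. -/
theorem integral_norm_rpow_le {s : ℝ} (hs : 1 < s) {G : ℝ → ℂ} (hG : Adm s G) :
    (∫ ξ, ‖G ξ‖) ^ (2 * s) ≤ gnConst s * (hom s G * nsq G ^ (s - 1)) := by
  have hz : G =ᵐ[volume] 0 → (∫ ξ, ‖G ξ‖) ^ (2 * s) ≤ gnConst s * (hom s G * nsq G ^ (s - 1)) := by
    intro h
    have : ∫ ξ, ‖G ξ‖ = 0 := by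
      rw [integral_congr_ae (h.mono fun ξ hξ => by rw [hξ])]; simp
    rw [this, Real.zero_rpow (by linarith)]
    have := gnConst_pos s; have := hom_nonneg s G; have := nsq_nonneg G
    positivity
  rcases (nsq_nonneg G).eq_or_lt with hm | hm
  · exact hz (ae_zero_of_nsq_eq_zero hG hm.symm)
  rcases (hom_nonneg s G).eq_or_lt with hK | hK
  · exact hz (ae_zero_of_hom_eq_zero hG hK.symm)
  set K := hom s G
  set m := nsq G
  set J := ∫ ξ : ℝ, (1 + |ξ| ^ s)⁻¹ with hJ
  have hJ0 : 0 ≤ J := integral_nonneg fun _ => by positivity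
  -- This scale balances the two parts of the weight: r^s m = K.
  set r := (K / m) ^ s⁻¹ with hr
  have hr0 : 0 < r := by positivity
  have hrs : r ^ s = K / m := by rw [hr, Real.rpow_inv_rpow (by positivity) (by linarith)]
  set B := K * r ^ (1 - s) with hB
  have hB0 : 0 < B := by positivity
  -- With this choice both halves of Young's inequality become multiples of √B.
  set θ := √B / K with hθ
  have hθ0 : 0 < θ := by positivity
  have hsq : √B * √B = B := Real.mul_self_sqrt hB0.le
  have h1 : ∫ ξ, ‖G ξ‖ ≤ 2⁻¹ * (θ * (r ^ s * m + K) + θ⁻¹ * (r ^ (1 - s) * J)) := by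
    have e1 : ∫ ξ, (r ^ s + |ξ| ^ s) * ‖G ξ‖ ^ 2 = r ^ s * m + K := by
      simp_rw [add_mul]
      rw [integral_add (hG.int_sq.const_mul _) hG.int_hom, integral_const_mul]; rfl
    rw [← e1, hJ, ← integral_inv_add_rpow hr0, ← integral_const_mul, ← integral_const_mul,
      ← integral_add (hG.integrable_scaled.const_mul _)
        ((integrable_inv_add_rpow hs hr0).const_mul _), ← integral_const_mul]
    refine integral_mono (hG.integrable hs).norm (((hG.integrable_scaled.const_mul _).add
      ((integrable_inv_add_rpow hs hr0).const_mul _)).const_mul _) fun ξ => ?_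
    exact norm_le_weighted hr0 hθ0 _ _
  have h2 : 2⁻¹ * (θ * (r ^ s * m + K) + θ⁻¹ * (r ^ (1 - s) * J)) = √B * (1 + 2⁻¹ * J) := by
    have hm' : r ^ s * m = K := by rw [hrs]; field_simp
    have h3 : r ^ (1 - s) = √B * √B / K := by rw [hsq, hB]; field_simp
    have : √B ≠ 0 := by positivity
    rw [hm', h3, hθ]; field_simp; ring
  rw [h2] at h1
  have h4 : (√B) ^ (2 * s) = K * m ^ (s - 1) := by
    rw [Real.rpow_mul (by positivity), Real.rpow_two, Real.sq_sqrt hB0.le, hB,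
      Real.mul_rpow hK.le (by positivity), ← Real.rpow_mul hr0.le, mul_comm (1 - s) s,
      Real.rpow_mul hr0.le, hrs, Real.div_rpow hK.le hm.le, ← neg_sub s 1, Real.rpow_neg hK.le,
      Real.rpow_neg hm.le]
    have : K ^ s = K * K ^ (s - 1) := by
      rw [← Real.rpow_one_add' hK.le (by linarith)]; congr 1; ring
    rw [this]
    have : K ^ (s - 1) ≠ 0 := by positivity
    field_simp
  calc (∫ ξ, ‖G ξ‖) ^ (2 * s) ≤ (√B * (1 + 2⁻¹ * J)) ^ (2 * s) :=
        Real.rpow_le_rpow (integral_nonneg fun _ => norm_nonneg _) h1 (by linarith)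
    _ = gnConst s * (K * m ^ (s - 1)) := by
        rw [Real.mul_rpow (by positivity) (by positivity), h4, gnConst]; ring

theorem rpow_two_mul_add_two {s x : ℝ} (hs : 0 ≤ s) (hx : 0 ≤ x) :
    x ^ (2 * s + 2) = x ^ (2 * s) * x ^ 2 := by
  rw [Real.rpow_add' hx (by linarith), Real.rpow_two]

theorem integrable_rpow_of_bounded {s Λ : ℝ} (hs : 0 ≤ s) {v : ℝ → ℂ} (hv : MemLp v 2)
    (hb : ∀ x, ‖v x‖ ≤ Λ) : Integrable fun x => ‖v x‖ ^ (2 * s + 2) := by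
  refine (((memLp_two_iff_integrable_sq_norm hv.1).1 hv).const_mul (Λ ^ (2 * s))).mono'
    ?_ (Eventually.of_forall fun x => ?_)
  · exact (hv.1.norm.aemeasurable.pow_const _).aestronglyMeasurable
  · rw [Real.norm_of_nonneg (by positivity), rpow_two_mul_add_two hs (norm_nonneg _)]
    have := Real.rpow_le_rpow (norm_nonneg (v x)) (hb x) (z := 2 * s) (by linarith)
    gcongr

theorem Adm.integrable_pot {s : ℝ} (hs : 1 < s) {G : ℝ → ℂ} (hG : Adm s G) :
    Integrable fun x => ‖𝓕⁻ G x‖ ^ (2 * s + 2) :=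
  integrable_rpow_of_bounded (by linarith) (memLp_fourierInv (hG.integrable hs) hG.memLp)
    (norm_fourierInv_le G)

/-- The factor |u|^(2s) is bounded by its supremum and the remaining |u|² integrates to the mass.
The constant is not sharp, and only smallness of the mass relative to it will matter. -/
theorem pot_le {s : ℝ} (hs : 1 < s) {G : ℝ → ℂ} (hG : Adm s G) :
    pot s G ≤ gnConst s * (hom s G * nsq G ^ s) := by
  have hL2 := memLp_fourierInv (hG.integrable hs) hG.memLp
  have hi := (memLp_two_iff_integrable_sq_norm hL2.1).1 hL2
  have h1 : pot s G ≤ (∫ ξ, ‖G ξ‖) ^ (2 * s) * nsq G := by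
    rw [nsq, ← integral_norm_sq_fourierInv (hG.integrable hs) hG.memLp, pot, ← integral_const_mul]
    refine integral_mono (hG.integrable_pot hs) (hi.const_mul _) fun x => ?_
    simp only
    rw [rpow_two_mul_add_two (by linarith) (norm_nonneg _)]
    have := Real.rpow_le_rpow (norm_nonneg _) (norm_fourierInv_le G x) (z := 2 * s) (by linarith)
    gcongr
  have h2 := mul_le_mul_of_nonneg_right (integral_norm_rpow_le hs hG) (nsq_nonneg G)
  have h3 : nsq G ^ s = nsq G ^ (s - 1) * nsq G := by
    rw [← Real.rpow_add_one' (nsq_nonneg G) (by linarith)]; congr 1; ring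
  rw [h3]; linarith

/-! ### The rescaled dispersion symbol -/

/-- The remainder of order two of `κ ↦ |κ|^s` at `κ = 1`. -/
noncomputable def om (s δ : ℝ) : ℝ := |1 + δ| ^ s - 1 - s * δ

theorem continuous_om {s : ℝ} (hs : 0 ≤ s) : Continuous (om s) := by
  unfold om; fun_prop (disch := exact fun _ => Or.inr hs)

theorem om_pos {s δ : ℝ} (hs : 1 < s) (hδ : δ ≠ 0) : 0 < om s δ := by
  unfold om
  rcases le_or_gt (-1) δ with h | h
  · have := one_add_mul_self_lt_rpow_one_add h hδ hs
    rw [abs_of_nonneg (by linarith)]; linarith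
  · have : 0 ≤ |1 + δ| ^ s := by positivity
    nlinarith

theorem tendsto_om_div_sq {s : ℝ} (hs : 1 < s) :
    Tendsto (fun δ => om s δ / δ ^ 2) (𝓝[≠] 0) (𝓝 (s * (s - 1) / 2)) := by
  have hev : ∀ᶠ δ : ℝ in 𝓝 0, -1 < δ := Ioi_mem_nhds (by norm_num)
  refine HasDerivAt.lhopital_zero_nhdsNE (f' := fun δ => s * ((1 + δ) ^ (s - 1) - 1))
    (g' := fun δ => 2 * δ) ?_ ?_ ?_ ?_ ?_ ?_
  · refine eventually_nhdsWithin_of_eventually_nhds ?_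
    filter_upwards [hev, hev.eventually_nhds] with δ hδ hδ2
    have h1 : HasDerivAt (fun δ : ℝ => (1 + δ) ^ s - 1 - s * δ) (1 * s * (1 + δ) ^ (s - 1) - s * 1) δ :=
      ((((hasDerivAt_id δ).const_add 1).rpow_const (Or.inr hs.le)).sub_const 1).sub
        ((hasDerivAt_id δ).const_mul s)
    have h2 : om s =ᶠ[𝓝 δ] fun δ : ℝ => (1 + δ) ^ s - 1 - s * δ := by
      filter_upwards [hδ2] with x hx
      rw [om, abs_of_pos (by linarith)]
    exact (h1.congr_of_eventuallyEq h2).congr_deriv (by ring)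
  · refine Eventually.of_forall fun δ => ?_
    simpa using hasDerivAt_pow 2 δ
  · filter_upwards [self_mem_nhdsWithin] with δ hδ
    simpa using hδ
  · have : Tendsto (om s) (𝓝 0) (𝓝 (om s 0)) := (continuous_om (by linarith)).tendsto 0
    simp only [om, add_zero, abs_one, Real.one_rpow, mul_zero, sub_self] at this
    exact this.mono_left nhdsWithin_le_nhds
  · have : Tendsto (fun δ : ℝ => δ ^ 2) (𝓝 0) (𝓝 (0 ^ 2)) := (continuous_pow 2).tendsto 0
    simp only [ne_eq, OfNat.ofNat_ne_zero, not_false_eq_true, zero_pow] at this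
    exact this.mono_left nhdsWithin_le_nhds
  · have hd : HasDerivAt (fun δ : ℝ => (1 + δ) ^ (s - 1)) (s - 1) 0 := by
      have := ((hasDerivAt_id (0:ℝ)).const_add 1).rpow_const (p := s - 1) (Or.inl (by simp))
      simpa using this
    have h1 := (hasDerivAt_iff_tendsto_slope.1 hd).const_mul (s / 2)
    refine (h1.congr' ?_).trans (le_of_eq (by congr 1; ring))
    filter_upwards [self_mem_nhdsWithin] with δ hδ
    have : δ ≠ 0 := hδ
    rw [slope_def_field]; simp; field_simp

theorem tendsto_om_cobounded {s : ℝ} (hs : 1 < s) :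
    Tendsto (fun δ => om s δ * (1 + |δ|) ^ (2 - s) / δ ^ 2) (cocompact ℝ) (𝓝 1) := by
  have hab : Tendsto (fun δ : ℝ => |δ|) (cocompact ℝ) atTop := tendsto_norm_cocompact_atTop
  have hinv : Tendsto (fun δ : ℝ => δ⁻¹) (cocompact ℝ) (𝓝 0) := by
    simpa using Filter.tendsto_inv₀_cobounded (α := ℝ)
  have hainv : Tendsto (fun δ : ℝ => |δ|⁻¹) (cocompact ℝ) (𝓝 0) := tendsto_inv_atTop_zero.comp hab
  have h1 : Tendsto (fun δ : ℝ => |1 + δ⁻¹| ^ s) (cocompact ℝ) (𝓝 1) := by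
    have := ((hinv.const_add 1).abs).rpow_const (p := s) (Or.inr (by linarith))
    simpa using this
  have h2 : Tendsto (fun δ : ℝ => (1 + |δ|⁻¹) ^ (2 - s)) (cocompact ℝ) (𝓝 1) := by
    have := (hainv.const_add 1).rpow_const (p := 2 - s) (Or.inl (by simp))
    simpa using this
  have h3 : Tendsto (fun δ : ℝ => |δ| ^ (-s)) (cocompact ℝ) (𝓝 0) :=
    (tendsto_rpow_neg_atTop (by linarith)).comp hab
  have h4 : Tendsto (fun δ : ℝ => s * (δ * |δ| ^ (-s))) (cocompact ℝ) (𝓝 0) := by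
    have : Tendsto (fun δ : ℝ => |δ| ^ (-(s - 1))) (cocompact ℝ) (𝓝 0) :=
      (tendsto_rpow_neg_atTop (by linarith)).comp hab
    have h5 : Tendsto (fun δ : ℝ => δ * |δ| ^ (-s)) (cocompact ℝ) (𝓝 0) := by
      refine squeeze_zero_norm' ?_ this
      filter_upwards [hab.eventually_gt_atTop 0] with δ hδ
      rw [norm_mul, Real.norm_eq_abs, Real.norm_of_nonneg (by positivity), neg_sub,
        Real.rpow_sub hδ, Real.rpow_one, Real.rpow_neg hδ.le]
      exact le_of_eq rfl
    simpa using h5.const_mul s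
  have h6 := ((h1.sub h3).sub h4).mul h2
  simp only [sub_zero, mul_one] at h6
  refine h6.congr' ?_
  filter_upwards [hab.eventually_gt_atTop 0] with δ hδ
  have h0 : δ ≠ 0 := abs_pos.1 hδ
  have e1 : |1 + δ⁻¹| ^ s = |1 + δ| ^ s * |δ| ^ (-s) := by
    rw [Real.rpow_neg hδ.le, ← div_eq_mul_inv, ← Real.div_rpow (abs_nonneg _) hδ.le, ← abs_div]
    congr 2; field_simp; ring
  have e2 : (1 + |δ|⁻¹) ^ (2 - s) = (1 + |δ|) ^ (2 - s) * |δ| ^ (-(2 - s)) := by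
    rw [Real.rpow_neg hδ.le, ← div_eq_mul_inv, ← Real.div_rpow (by positivity) hδ.le]
    congr 1; field_simp; ring
  have e3 : |δ| ^ (-s) * |δ| ^ (-(2 - s)) = (δ ^ 2)⁻¹ := by
    rw [← Real.rpow_add hδ, ← sq_abs, ← Real.rpow_two, ← Real.rpow_neg hδ.le]; congr 1; ring
  rw [e1, e2, om, div_eq_mul_inv, ← e3]
  ring

/-- The quotient of the two sides, extended to 0 by its limit s(s-1)/2, is continuous and positive
and tends to 1 at infinity. Hence it lies between positive constants. -/
theorem exists_om_bounds {s : ℝ} (hs : 1 < s) :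
    ∃ c C : ℝ, 0 < c ∧ 0 < C ∧ ∀ δ, c * (δ ^ 2 * (1 + |δ|) ^ (s - 2)) ≤ om s δ ∧
      om s δ ≤ C * (δ ^ 2 * (1 + |δ|) ^ (s - 2)) := by
  set q := Function.update (fun δ => om s δ * (1 + |δ|) ^ (2 - s) / δ ^ 2) 0 (s * (s - 1) / 2) with hq
  have hq0 : ∀ δ ≠ 0, q δ = om s δ * (1 + |δ|) ^ (2 - s) / δ ^ 2 := fun δ hδ => by
    rw [hq, Function.update_of_ne hδ]
  have hqpos : ∀ δ, 0 < q δ := by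
    intro δ
    rcases eq_or_ne δ 0 with rfl | h
    · rw [hq, Function.update_self]; nlinarith
    · rw [hq0 δ h]
      have := om_pos hs h
      positivity
  have hcw : Continuous fun δ : ℝ => (1 + |δ|) ^ (2 - s) :=
    Continuous.rpow_const (by fun_prop) fun x => Or.inl (by positivity)
  have hcont : Continuous q := by
    rw [continuous_iff_continuousAt]
    intro δ
    rcases eq_or_ne δ 0 with rfl | h
    · rw [hq, continuousAt_update_same]
      have h1 := (tendsto_om_div_sq hs).mul ((hcw.tendsto 0).mono_left nhdsWithin_le_nhds)
      simp only [abs_zero, add_zero, Real.one_rpow, mul_one] at h1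
      exact h1.congr fun δ => by ring
    · rw [hq, continuousAt_update_of_ne h]
      exact (((continuous_om (by linarith)).mul hcw).continuousAt).div
        (continuous_pow 2).continuousAt (by positivity)
  have hlim : Tendsto q (cocompact ℝ) (𝓝 1) := by
    refine (tendsto_om_cobounded hs).congr' ?_
    have : ∀ᶠ δ : ℝ in cocompact ℝ, δ ≠ 0 := by
      have := (isCompact_singleton (x := (0:ℝ))).compl_mem_cocompact
      filter_upwards [this] with δ hδ using hδ
    filter_upwards [this] with δ hδ
    rw [hq0 δ hδ]
  obtain ⟨t, ht, hts⟩ := mem_cocompact.1 (hlim (Ioo_mem_nhds (a := 1/2) (b := 2) (by norm_num) (by norm_num)))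
  obtain ⟨x, -, hx⟩ := (ht.insert 0).exists_isMinOn ⟨0, by simp⟩ hcont.continuousOn
  obtain ⟨y, -, hy⟩ := (ht.insert 0).exists_isMaxOn ⟨0, by simp⟩ hcont.continuousOn
  have hb : ∀ δ, min (q x) (1/2) ≤ q δ ∧ q δ ≤ max (q y) 2 := by
    intro δ
    by_cases hδ : δ ∈ t
    · exact ⟨(min_le_left _ _).trans (hx (mem_insert_of_mem _ hδ)),
        (hy (mem_insert_of_mem _ hδ)).trans (le_max_left _ _)⟩
    · have := hts hδ
      exact ⟨(min_le_right _ _).trans this.1.le, this.2.le.trans (le_max_right _ _)⟩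
  refine ⟨min (q x) (1/2), max (q y) 2, lt_min (hqpos x) (by norm_num),
    lt_max_of_lt_right (by norm_num), fun δ => ?_⟩
  rcases eq_or_ne δ 0 with rfl | h
  · simp [om]
  · have hw : 0 < (1 + |δ|) ^ (2 - s) := by positivity
    have e : om s δ = q δ * (δ ^ 2 * (1 + |δ|) ^ (s - 2)) := by
      rw [hq0 δ h, ← neg_sub 2 s, Real.rpow_neg (by positivity)]; field_simp
    rw [e]
    have hn : 0 ≤ δ ^ 2 * (1 + |δ|) ^ (s - 2) := by positivity
    exact ⟨mul_le_mul_of_nonneg_right (hb δ).1 hn, mul_le_mul_of_nonneg_right (hb δ).2 hn⟩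

/-- The rescaled dispersion symbol, which tends to `(2πη)²` as `ε → 0`. -/
noncomputable def sym (s ε η : ℝ) : ℝ := 2 / (s * (s - 1)) * (ε ^ 2)⁻¹ * om s (2 * Real.pi * ε * η)

theorem sym_nonneg {s : ℝ} (hs : 1 < s) (ε η : ℝ) : 0 ≤ sym s ε η := by
  have h0 : 0 ≤ om s (2 * Real.pi * ε * η) := by
    rcases eq_or_ne (2 * Real.pi * ε * η) 0 with h | h
    · rw [h]; simp [om]
    · exact (om_pos hs h).le
  have : 0 < s * (s - 1) := by nlinarith
  unfold sym; positivity

theorem continuous_sym {s : ℝ} (hs : 1 < s) (ε : ℝ) : Continuous (sym s ε) := by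
  have := continuous_om (s := s) (by linarith)
  unfold sym; fun_prop

theorem exists_sym_le_sq {s : ℝ} (hs : 1 < s) (hs2 : s < 2) :
    ∃ C : ℝ, 0 < C ∧ ∀ ε η, 0 < ε → sym s ε η ≤ C * η ^ 2 := by
  obtain ⟨c, C, hc, hC, h⟩ := exists_om_bounds hs
  have h1 : 0 < s * (s - 1) := by nlinarith
  refine ⟨2 / (s * (s - 1)) * C * (2 * Real.pi) ^ 2, by positivity, fun ε η hε => ?_⟩
  set δ := 2 * Real.pi * ε * η with hδ
  have h2 : om s δ ≤ C * δ ^ 2 := by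
    refine (h δ).2.trans ?_
    have : (1 + |δ|) ^ (s - 2) ≤ 1 :=
      Real.rpow_le_one_of_one_le_of_nonpos (by linarith [abs_nonneg δ]) (by linarith)
    have := mul_le_mul_of_nonneg_left this (sq_nonneg δ)
    exact mul_le_mul_of_nonneg_left (by linarith) hC.le
  calc sym s ε η ≤ 2 / (s * (s - 1)) * (ε ^ 2)⁻¹ * (C * δ ^ 2) := by unfold sym; gcongr
    _ = _ := by rw [hδ]; field_simp

/-- The constant depends on ε. The bound only serves to make the rescaled kinetic form finite on the
energy space. -/
theorem exists_sym_le_rpow {s : ℝ} (hs : 1 < s) (hs2 : s < 2) (ε : ℝ) :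
    ∃ C : ℝ, 0 < C ∧ ∀ η, sym s ε η ≤ C * |η| ^ s := by
  obtain ⟨c, C, hc, hC, h⟩ := exists_om_bounds hs
  have h1 : 0 < s * (s - 1) := by nlinarith
  refine ⟨2 / (s * (s - 1)) * (ε ^ 2)⁻¹ * C * |2 * Real.pi * ε| ^ s + 1, by positivity, fun η => ?_⟩
  set δ := 2 * Real.pi * ε * η with hδ
  have h2 : om s δ ≤ C * |δ| ^ s := by
    rcases eq_or_ne δ 0 with h0 | h0
    · rw [h0]; simp [om]; positivity
    refine (h δ).2.trans (mul_le_mul_of_nonneg_left ?_ hC.le)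
    have hp : 0 < |δ| := abs_pos.2 h0
    have e : δ ^ 2 = |δ| ^ s * |δ| ^ (2 - s) := by
      rw [← Real.rpow_add hp, ← sq_abs, ← Real.rpow_two]; congr 1; ring
    rw [e, mul_assoc]
    refine mul_le_of_le_one_right (by positivity) ?_
    rw [← neg_sub 2 s, Real.rpow_neg (by positivity), ← div_eq_mul_inv, div_le_one (by positivity)]
    exact Real.rpow_le_rpow hp.le (by linarith) (by linarith)
  calc sym s ε η ≤ 2 / (s * (s - 1)) * (ε ^ 2)⁻¹ * (C * |δ| ^ s) := by unfold sym; gcongr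
    _ = 2 / (s * (s - 1)) * (ε ^ 2)⁻¹ * C * |2 * Real.pi * ε| ^ s * |η| ^ s := by
      rw [hδ, abs_mul _ η, Real.mul_rpow (abs_nonneg _) (abs_nonneg _)]; ring
    _ ≤ _ := by
      have : 0 ≤ |η| ^ s := by positivity
      linarith

theorem exists_sym_near {s : ℝ} (hs : 1 < s) {R κ : ℝ} (hR : 0 < R) (hκ : 0 < κ) :
    ∃ ε₀ : ℝ, 0 < ε₀ ∧ ∀ ε η, 0 < ε → ε ≤ ε₀ → |η| ≤ R →
      |sym s ε η - (2 * Real.pi * η) ^ 2| ≤ κ * η ^ 2 := by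
  have h1 : 0 < s * (s - 1) := by nlinarith
  set ρ := κ * (s * (s - 1)) / 2 / (2 * Real.pi) ^ 2 with hρ
  have hρ0 : 0 < ρ := by positivity
  have h := (tendsto_om_div_sq hs) (Metric.ball_mem_nhds _ hρ0)
  obtain ⟨d, hd, hball⟩ := Metric.mem_nhdsWithin_iff.1 (mem_map.1 h)
  refine ⟨d / (2 * Real.pi * R) / 2, by positivity, fun ε η hε hεd hη => ?_⟩
  rcases eq_or_ne η 0 with rfl | hη0
  · simp [sym, om]
  set δ := 2 * Real.pi * ε * η with hδ
  have hδ0 : δ ≠ 0 := by positivity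
  have hδd : |δ| < d := by
    rw [hδ, abs_mul, abs_of_pos (by positivity)]
    calc 2 * Real.pi * ε * |η| ≤ 2 * Real.pi * (d / (2 * Real.pi * R) / 2) * R := by gcongr
      _ = d / 2 := by field_simp
      _ < d := by linarith
  have h3 := hball ⟨by simpa using hδd, hδ0⟩
  rw [mem_preimage, Metric.mem_ball, Real.dist_eq] at h3
  have h4 : sym s ε η - (2 * Real.pi * η) ^ 2
      = 2 / (s * (s - 1)) * (2 * Real.pi) ^ 2 * (om s δ / δ ^ 2 - s * (s - 1) / 2) * η ^ 2 := by
    have hs1 : s - 1 ≠ 0 := by linarith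
    have hs0 : s ≠ 0 := by linarith
    unfold sym; rw [← hδ, hδ]; field_simp
  rw [h4, abs_mul, abs_mul, abs_of_pos (a := 2 / (s * (s - 1)) * (2 * Real.pi) ^ 2) (by positivity),
    abs_of_nonneg (sq_nonneg η)]
  have hs1 : s - 1 ≠ 0 := by linarith
  have : 2 / (s * (s - 1)) * (2 * Real.pi) ^ 2 * ρ = κ := by rw [hρ]; field_simp
  rw [← this]
  gcongr

/-- The symbol is comparable to η²(1 + 2πε|η|)^(s-2). For ε ≤ 1/A and |η| ≥ A the bracket is at most
(1 + 2π)|η|/A, which leaves a multiple of A^(2-s)|η|^s. Since s < 2, a large A beats any prescribed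
B. -/
theorem exists_sym_ge {s : ℝ} (hs : 1 < s) (hs2 : s < 2) {B : ℝ} (hB : 0 < B) :
    ∃ A : ℝ, 1 ≤ A ∧ ∀ ε η, 0 < ε → ε ≤ A⁻¹ → A ≤ |η| → B * |η| ^ s ≤ sym s ε η := by
  obtain ⟨c, C, hc, hC, h⟩ := exists_om_bounds hs
  have h1 : 0 < s * (s - 1) := by nlinarith
  set c' := 2 / (s * (s - 1)) * c * (2 * Real.pi) ^ 2 with hc'
  have hc'0 : 0 < c' := by positivity
  -- Chosen so that |η|^(s-2) B/c' = (|η|/b)^(s-2).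
  set b := (B / c') ^ (2 - s)⁻¹ with hb
  have hb0 : 0 < b := by positivity
  refine ⟨max 1 ((1 + 2 * Real.pi) * b), le_max_left _ _, fun ε η hε hεA hηA => ?_⟩
  set A := max 1 ((1 + 2 * Real.pi) * b)
  have hA0 : 0 < A := lt_of_lt_of_le one_pos (le_max_left _ _)
  have hη : 0 < |η| := hA0.trans_le hηA
  set δ := 2 * Real.pi * ε * η with hδ
  have hδa : |δ| = 2 * Real.pi * ε * |η| := by rw [hδ, abs_mul, abs_of_pos (by positivity)]
  have h2 : 1 + |δ| ≤ |η| / b := by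
    rw [le_div_iff₀ hb0, hδa]
    have e1 : (1 + 2 * Real.pi) * b ≤ A := le_max_right _ _
    have e2 : 1 + 2 * Real.pi * ε * |η| ≤ |η| / A * (1 + 2 * Real.pi) := by
      have : 1 ≤ |η| / A := by rwa [le_div_iff₀ hA0, one_mul]
      have h3 : ε * |η| ≤ |η| / A := by
        rw [div_eq_mul_inv, mul_comm]; gcongr
      have := Real.pi_pos
      nlinarith
    calc (1 + 2 * Real.pi * ε * |η|) * b ≤ |η| / A * (1 + 2 * Real.pi) * b := by gcongr
      _ = |η| / A * ((1 + 2 * Real.pi) * b) := by ring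
      _ ≤ |η| / A * A := by gcongr
      _ = |η| := by field_simp
  have h3 : |η| ^ (s - 2) * (B / c') ≤ (1 + |δ|) ^ (s - 2) := by
    have e : |η| ^ (s - 2) * (B / c') = (|η| / b) ^ (s - 2) := by
      rw [Real.div_rpow hη.le hb0.le, div_eq_mul_inv (|η| ^ (s - 2))]
      congr 1
      rw [← Real.rpow_neg hb0.le, neg_sub, hb, Real.rpow_inv_rpow (by positivity) (by linarith)]
    rw [e]
    exact Real.rpow_le_rpow_of_nonpos (by positivity) h2 (by linarith)
  have h4 : |η| ^ s = η ^ 2 * |η| ^ (s - 2) := by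
    rw [← sq_abs, ← Real.rpow_two, ← Real.rpow_add hη]; congr 1; ring
  calc B * |η| ^ s = c' * (η ^ 2 * (|η| ^ (s - 2) * (B / c'))) := by rw [h4]; field_simp
    _ ≤ c' * (η ^ 2 * (1 + |δ|) ^ (s - 2)) := by gcongr
    _ = 2 / (s * (s - 1)) * (ε ^ 2)⁻¹ * (c * (δ ^ 2 * (1 + |δ|) ^ (s - 2))) := by
      rw [hc', hδ]; field_simp
    _ ≤ sym s ε η := by
      unfold sym; gcongr; exact (h δ).1

/-- The rescaled kinetic form. -/
noncomputable def ten (s ε : ℝ) (G : ℝ → ℂ) : ℝ := ∫ η : ℝ, sym s ε η * ‖G η‖ ^ 2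

/-- The rescaled energy. -/
noncomputable def en (s ε : ℝ) (G : ℝ → ℂ) : ℝ := ten s ε G - pot s G

theorem Adm.integrable_ten {s ε : ℝ} (hs : 1 < s) (hs2 : s < 2) {G : ℝ → ℂ} (hG : Adm s G) :
    Integrable fun η : ℝ => sym s ε η * ‖G η‖ ^ 2 := by
  obtain ⟨C, hC, h⟩ := exists_sym_le_rpow hs hs2 ε
  refine (hG.int_hom.const_mul C).mono' ((continuous_sym hs ε).aestronglyMeasurable.mul
    (hG.aesm.norm.pow 2)) (Eventually.of_forall fun η => ?_)
  have := sym_nonneg hs ε η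
  rw [Real.norm_of_nonneg (by positivity), ← mul_assoc]
  exact mul_le_mul_of_nonneg_right (h η) (by positivity)

theorem ten_nonneg {s : ℝ} (hs : 1 < s) (ε : ℝ) (G : ℝ → ℂ) : 0 ≤ ten s ε G :=
  integral_nonneg fun η => mul_nonneg (sym_nonneg hs ε η) (by positivity)

/-! ### Decaying functions and the explicit soliton -/

/-- Functions that decay quadratically. -/
def Dec (f : ℝ → ℝ) : Prop := ∃ C, 0 ≤ C ∧ ∀ x, |f x| ≤ C * (1 + x ^ 2)⁻¹

namespace Dec

variable {f g : ℝ → ℝ}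

theorem add (hf : Dec f) (hg : Dec g) : Dec fun x => f x + g x := by
  obtain ⟨C, hC0, hC⟩ := hf
  obtain ⟨D, hD0, hD⟩ := hg
  exact ⟨C + D, by positivity, fun x => (abs_add_le _ _).trans (by linarith [hC x, hD x])⟩

theorem bdd_mul (hg : Dec g) {B : ℝ} (hf : ∀ x, |f x| ≤ B) : Dec fun x => f x * g x := by
  obtain ⟨C, hC0, hC⟩ := hg
  have hB : 0 ≤ B := (abs_nonneg _).trans (hf 0)
  refine ⟨B * C, by positivity, fun x => ?_⟩
  rw [abs_mul, mul_assoc]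
  exact mul_le_mul (hf x) (hC x) (abs_nonneg _) hB

theorem neg (hf : Dec f) : Dec fun x => -f x := by
  obtain ⟨C, hC0, hC⟩ := hf
  exact ⟨C, hC0, fun x => by rw [abs_neg]; exact hC x⟩

theorem sub (hf : Dec f) (hg : Dec g) : Dec fun x => f x - g x := by
  simpa [sub_eq_add_neg] using hf.add hg.neg

theorem const_mul (hf : Dec f) (c : ℝ) : Dec fun x => c * f x :=
  hf.bdd_mul (B := |c|) fun _ => le_rfl

theorem bdd (hf : Dec f) : ∃ B, ∀ x, |f x| ≤ B := by
  obtain ⟨C, hC0, hC⟩ := hf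
  refine ⟨C, fun x => (hC x).trans (mul_le_of_le_one_right hC0 (inv_le_one_of_one_le₀ ?_))⟩
  nlinarith [sq_nonneg x]

theorem mul (hf : Dec f) (hg : Dec g) : Dec fun x => f x * g x := by
  obtain ⟨B, hB⟩ := hf.bdd
  exact hg.bdd_mul hB

theorem integrable (hf : Dec f) (hc : Continuous f) : Integrable f := by
  obtain ⟨C, hC0, hC⟩ := hf
  exact (integrable_inv_one_add_sq.const_mul C).mono' hc.aestronglyMeasurable
    (Eventually.of_forall fun x => hC x)

theorem memLp (hf : Dec f) (hc : Continuous f) : MemLp f 2 := by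
  rw [memLp_two_iff_integrable_sq_norm hc.aestronglyMeasurable]
  simpa [sq_abs, pow_two] using (hf.mul hf).integrable (hc.mul hc)

theorem tendsto (hf : Dec f) : Tendsto f (cocompact ℝ) (𝓝 0) := by
  obtain ⟨C, hC0, hC⟩ := hf
  refine squeeze_zero_norm hC ?_
  have h : Tendsto (fun x : ℝ => 1 + x ^ 2) (cocompact ℝ) atTop := by
    refine tendsto_atTop_add_const_left _ _ ?_
    have := (tendsto_pow_atTop (α := ℝ) (n := 2) (by norm_num)).comp
      (tendsto_norm_cocompact_atTop (E := ℝ))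
    simpa [Function.comp_def] using this
  simpa using h.inv_tendsto_atTop.const_mul C

end Dec

theorem integral_deriv_eq_zero {f f' : ℝ → ℝ} (hd : ∀ x, HasDerivAt f (f' x) x)
    (hi : Integrable f') (h0 : Tendsto f (cocompact ℝ) (𝓝 0)) : ∫ x, f' x = 0 := by
  have := integral_of_hasDerivAt_of_tendsto hd hi
    (h0.mono_left atBot_le_cocompact) (h0.mono_left atTop_le_cocompact)
  simpa using this

/-- The function `tanh (s x)`. -/
noncomputable def st (s x : ℝ) : ℝ := Real.tanh (s * x)

/-- The soliton `(cosh (s x))^{-1/s}`, which solves `-w'' + w = (s + 1) w^{2s+1}`. -/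
noncomputable def sw (s x : ℝ) : ℝ := Real.cosh (s * x) ^ (-s⁻¹)

theorem st_sq_lt_one (s x : ℝ) : st s x ^ 2 < 1 := Real.tanh_sq_lt_one _

theorem abs_st_le (s x : ℝ) : |st s x| ≤ 1 := (Real.abs_tanh_lt_one _).le

theorem hasDerivAt_st (s x : ℝ) : HasDerivAt (st s) (s * (1 - st s x ^ 2)) x := by
  have hc : Real.cosh (s * x) ≠ 0 := (Real.cosh_pos _).ne'
  have hl : HasDerivAt (fun y => s * y) s x := by simpa using (hasDerivAt_id x).const_mul s
  have h := (hl.sinh).div hl.cosh hc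
  have e : st s = fun y => Real.sinh (s * y) / Real.cosh (s * y) := by
    ext y; rw [st, Real.tanh_eq_sinh_div_cosh]
  rw [e]
  refine h.congr_deriv ?_
  have := Real.cosh_sq (s * x)
  field_simp

theorem continuous_st (s : ℝ) : Continuous (st s) :=
  continuous_iff_continuousAt.2 fun x => (hasDerivAt_st s x).continuousAt

theorem st_neg (s x : ℝ) : st s (-x) = -st s x := by simp [st]

theorem sw_pos (s x : ℝ) : 0 < sw s x := Real.rpow_pos_of_pos (Real.cosh_pos _) _

theorem sw_zero (s : ℝ) : sw s 0 = 1 := by simp [sw]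

theorem sw_neg (s x : ℝ) : sw s (-x) = sw s x := by simp [sw]

theorem sw_le_one {s : ℝ} (hs : 0 < s) (x : ℝ) : sw s x ≤ 1 :=
  Real.rpow_le_one_of_one_le_of_nonpos (Real.one_le_cosh _) (by simp [hs.le])

theorem hasDerivAt_sw {s : ℝ} (hs : 0 < s) (x : ℝ) :
    HasDerivAt (sw s) (-st s x * sw s x) x := by
  have hc := Real.cosh_pos (s * x)
  have hl : HasDerivAt (fun y => s * y) s x := by simpa using (hasDerivAt_id x).const_mul s
  refine (hl.cosh.rpow_const (p := -s⁻¹) (Or.inl hc.ne')).congr_deriv ?_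
  rw [st, sw, Real.tanh_eq_sinh_div_cosh, Real.rpow_sub_one hc.ne']
  field_simp

theorem continuous_sw {s : ℝ} (hs : 0 < s) : Continuous (sw s) :=
  continuous_iff_continuousAt.2 fun x => (hasDerivAt_sw hs x).continuousAt

/-- The nonlinear power becomes 1 - tanh². Together with w' = -tanh · w this makes the later soliton
identities polynomial in tanh, up to a factor of w or w². -/
theorem sw_rpow {s : ℝ} (hs : 0 < s) (x : ℝ) : sw s x ^ (2 * s) = 1 - st s x ^ 2 := by
  have hc := Real.cosh_pos (s * x)
  rw [sw, ← Real.rpow_mul hc.le, st, Real.tanh_eq_sinh_div_cosh]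
  have : -s⁻¹ * (2 * s) = -(2 : ℕ) := by field_simp; norm_num
  rw [this, Real.rpow_neg hc.le, Real.rpow_natCast]
  have := Real.cosh_sq (s * x)
  field_simp
  linarith

theorem sw_le_exp {s : ℝ} (hs : 1 < s) (x : ℝ) : sw s x ≤ 2 * Real.exp (-|x|) := by
  have h1 : Real.exp (s * |x|) / 2 ≤ Real.cosh (s * x) := by
    rw [← Real.cosh_abs, abs_mul, abs_of_pos (by linarith : 0 < s), Real.cosh_eq]
    have := Real.exp_pos (-(s * |x|)); linarith
  calc sw s x ≤ (Real.exp (s * |x|) / 2) ^ (-s⁻¹) :=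
        Real.rpow_le_rpow_of_nonpos (by positivity) h1 (by simp; linarith)
    _ = 2 ^ s⁻¹ * Real.exp (-|x|) := by
        rw [Real.div_rpow (by positivity) (by norm_num), ← Real.exp_mul,
          Real.rpow_neg (x := 2) (by norm_num)]
        have : s * |x| * -s⁻¹ = -|x| := by field_simp
        rw [this]; field_simp
    _ ≤ _ := by
        gcongr
        calc (2:ℝ) ^ s⁻¹ ≤ 2 ^ (1:ℝ) := by
              apply Real.rpow_le_rpow_of_exponent_le (by norm_num)
              exact inv_le_one_of_one_le₀ hs.le
          _ = 2 := by simp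

theorem one_add_abs_mul_sw_le {s : ℝ} (hs : 1 < s) (x : ℝ) :
    (1 + |x|) * sw s x ≤ 12 * Real.exp 1 * (1 + x ^ 2)⁻¹ := by
  have h1 := Real.pow_div_factorial_le_exp (x := 1 + |x|) (by positivity) 3
  have h2 : (1 + |x|) * (1 + x ^ 2) ≤ (1 + |x|) ^ 3 := by
    rw [← sq_abs x]; nlinarith [abs_nonneg x, mul_nonneg (abs_nonneg x) (abs_nonneg x)]
  rw [← div_eq_mul_inv, le_div_iff₀ (by positivity)]
  have h3 := sw_le_exp hs x
  have h4 : Real.exp (1 + |x|) * Real.exp (-|x|) = Real.exp 1 := by rw [← Real.exp_add]; simp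
  have h5 : (1 + |x|) * (1 + x ^ 2) ≤ 6 * Real.exp (1 + |x|) := by
    norm_num [Nat.factorial] at h1; linarith
  calc (1 + |x|) * sw s x * (1 + x ^ 2) = (1 + |x|) * (1 + x ^ 2) * sw s x := by ring
    _ ≤ 6 * Real.exp (1 + |x|) * (2 * Real.exp (-|x|)) := by
        gcongr; exact (sw_pos s x).le
    _ = 12 * (Real.exp (1 + |x|) * Real.exp (-|x|)) := by ring
    _ = _ := by rw [h4]

theorem dec_sw {s : ℝ} (hs : 1 < s) : Dec (sw s) :=
  ⟨12 * Real.exp 1, by positivity, fun x => by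
    rw [abs_of_pos (sw_pos s x)]
    have := one_add_abs_mul_sw_le hs x
    have := mul_nonneg (abs_nonneg x) (sw_pos s x).le
    linarith⟩

theorem dec_id_mul_sw {s : ℝ} (hs : 1 < s) : Dec fun x => x * sw s x :=
  ⟨12 * Real.exp 1, by positivity, fun x => by
    rw [abs_mul, abs_of_pos (sw_pos s x)]
    have := one_add_abs_mul_sw_le hs x
    have := (sw_pos s x).le
    linarith⟩

/-- The derivative of the soliton. -/
noncomputable def dsw (s x : ℝ) : ℝ := -st s x * sw s x

/-- The second derivative of the soliton. -/
noncomputable def ddsw (s x : ℝ) : ℝ := sw s x - (s + 1) * (1 - st s x ^ 2) * sw s x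

theorem hasDerivAt_dsw {s : ℝ} (hs : 0 < s) (x : ℝ) : HasDerivAt (dsw s) (ddsw s x) x := by
  refine ((hasDerivAt_st s x).neg.mul (hasDerivAt_sw hs x)).congr_deriv ?_
  rw [ddsw]; simp only [Pi.neg_apply]; ring

theorem continuous_dsw {s : ℝ} (hs : 0 < s) : Continuous (dsw s) :=
  (continuous_st s).neg.mul (continuous_sw hs)

theorem continuous_ddsw {s : ℝ} (hs : 0 < s) : Continuous (ddsw s) := by
  have := continuous_st s; have := continuous_sw hs
  unfold ddsw; fun_prop

theorem dec_dsw {s : ℝ} (hs : 1 < s) : Dec (dsw s) :=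
  (dec_sw hs).bdd_mul (f := fun x => -st s x) (B := 1) fun x => by rw [abs_neg]; exact abs_st_le s x

theorem abs_one_sub_st_sq_le (s x : ℝ) : |1 - st s x ^ 2| ≤ 1 := by
  rw [abs_of_nonneg (by linarith [st_sq_lt_one s x])]; nlinarith [sq_nonneg (st s x)]

theorem dec_ddsw {s : ℝ} (hs : 1 < s) : Dec (ddsw s) := by
  refine (dec_sw hs).sub ((dec_sw hs).bdd_mul (f := fun x => (s + 1) * (1 - st s x ^ 2))
    (B := s + 1) fun x => ?_)
  rw [abs_mul, abs_of_pos (by linarith : 0 < s + 1)]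
  exact mul_le_of_le_one_right (by linarith) (abs_one_sub_st_sq_le s x)

/-- The mass of the soliton. -/
noncomputable def m0 (s : ℝ) : ℝ := ∫ x, sw s x ^ 2

/-- The kinetic energy of the soliton. -/
noncomputable def t0 (s : ℝ) : ℝ := ∫ x, dsw s x ^ 2

/-- The potential energy of the soliton. -/
noncomputable def p0 (s : ℝ) : ℝ := ∫ x, sw s x ^ (2 * s + 2)

theorem integrable_sw_sq {s : ℝ} (hs : 1 < s) : Integrable fun x => sw s x ^ 2 := by
  have := continuous_sw (s := s) (by linarith)
  simpa [pow_two] using ((dec_sw hs).mul (dec_sw hs)).integrable (by fun_prop)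

theorem integrable_dsw_sq {s : ℝ} (hs : 1 < s) : Integrable fun x => dsw s x ^ 2 := by
  have := continuous_dsw (s := s) (by linarith)
  simpa [pow_two] using ((dec_dsw hs).mul (dec_dsw hs)).integrable (by fun_prop)

theorem sw_rpow_add_two {s : ℝ} (hs : 0 < s) (x : ℝ) :
    sw s x ^ (2 * s + 2) = (1 - st s x ^ 2) * sw s x ^ 2 := by
  rw [rpow_two_mul_add_two hs.le (sw_pos s x).le, sw_rpow hs]

theorem integrable_sw_rpow {s : ℝ} (hs : 1 < s) : Integrable fun x => sw s x ^ (2 * s + 2) := by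
  simp_rw [sw_rpow_add_two (by linarith : 0 < s), sub_mul, one_mul]
  refine (integrable_sw_sq hs).sub ((integrable_dsw_sq hs).congr (Eventually.of_forall fun x => ?_))
  simp only [dsw]; ring

/-- The first integral (w')² = w² - w^(2s+2), integrated. -/
theorem t0_eq {s : ℝ} (hs : 1 < s) : t0 s = m0 s - p0 s := by
  rw [t0, m0, p0, ← integral_sub (integrable_sw_sq hs) (integrable_sw_rpow hs)]
  congr 1; ext x
  rw [sw_rpow_add_two (by linarith), dsw]; ring

/-- The integrand of the difference is the derivative of tanh(sx) w², which vanishes at infinity.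
Combined with `t0_eq`, this expresses all soliton integrals through `t0`. -/
theorem two_t0_eq {s : ℝ} (hs : 1 < s) : 2 * t0 s = s * p0 s := by
  have hs0 : 0 < s := by linarith
  have h : ∫ x, (s * sw s x ^ (2 * s + 2) - 2 * dsw s x ^ 2) = 0 := by
    refine integral_deriv_eq_zero (f := fun x => st s x * sw s x ^ 2) (fun x => ?_)
      (((integrable_sw_rpow hs).const_mul _).sub ((integrable_dsw_sq hs).const_mul _)) ?_
    · refine ((hasDerivAt_st s x).mul ((hasDerivAt_sw hs0 x).pow 2)).congr_deriv ?_
      rw [sw_rpow_add_two hs0, dsw]; simp only [Pi.pow_apply]; push_cast; ring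
    · have := ((dec_sw hs).mul (dec_sw hs)).bdd_mul (abs_st_le s)
      simpa [pow_two] using this.tendsto
  rw [integral_sub ((integrable_sw_rpow hs).const_mul _) ((integrable_dsw_sq hs).const_mul _),
    integral_const_mul, integral_const_mul] at h
  rw [t0, p0]; linarith

theorem m0_pos {s : ℝ} (hs : 1 < s) : 0 < m0 s := by
  rw [m0, integral_pos_iff_support_of_nonneg (fun x => by positivity) (integrable_sw_sq hs)]
  have : Function.support (fun x => sw s x ^ 2) = univ := by
    ext x; simp [(sw_pos s x).ne']
  rw [this]; simp

theorem t0_pos {s : ℝ} (hs : 1 < s) : 0 < t0 s := by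
  have h1 := t0_eq hs; have h2 := two_t0_eq hs; have h3 := m0_pos hs
  by_contra h
  push Not at h
  have : 0 ≤ t0 s := integral_nonneg fun _ => sq_nonneg _
  have h4 : t0 s = 0 := le_antisymm h this
  rw [h4] at h1 h2
  have : p0 s = 0 := by
    have : s * p0 s = 0 := by linarith
    rcases mul_eq_zero.1 this with h | h
    · linarith
    · exact h
  linarith

theorem p0_eq {s : ℝ} (hs : 1 < s) : p0 s = 2 / s * t0 s := by
  have := two_t0_eq hs; field_simp; linarith

theorem m0_eq {s : ℝ} (hs : 1 < s) : m0 s = (1 + 2 / s) * t0 s := by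
  have h1 := t0_eq hs; have h2 := p0_eq hs; linarith

/-- This is where subcriticality enters: the soliton has negative energy exactly because 2/s > 1. -/
theorem t0_lt_p0 {s : ℝ} (hs : 1 < s) (hs2 : s < 2) : t0 s < p0 s := by
  have := t0_pos hs
  have := two_t0_eq hs
  nlinarith

/-! ### The Fourier transform of the soliton -/

theorem integral_norm_sq_fourier' {f : ℝ → ℂ} (hf : Integrable f) (h2 : MemLp f 2) :
    ∫ ξ, ‖𝓕 f ξ‖ ^ 2 = ∫ x, ‖f x‖ ^ 2 := by
  rw [← integral_norm_sq_fourierInv hf h2, ← integral_neg_eq_self]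
  simp_rw [Real.fourierInv_eq_fourier_neg]

theorem integral_inner_fourier_left {f G : ℝ → ℂ} (hf : Integrable f) (hG : Integrable G) :
    ∫ ξ, inner ℂ (𝓕 f ξ) (G ξ) = ∫ x, inner ℂ (f x) (𝓕⁻ G x) := by
  have := VectorFourier.integral_sesq_fourierIntegral_eq_neg_flip (μ := volume) (ν := volume)
    (L := innerₗ ℝ) (f := f) (g := G) (innerSL ℂ) Real.continuous_fourierChar continuous_inner hf hG
  have hfl : (-(innerₗ ℝ).flip : ℝ →ₗ[ℝ] ℝ →ₗ[ℝ] ℝ) = -innerₗ ℝ := by ext; simp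
  rw [hfl] at this
  exact this

theorem Dec.integrable_ofReal {f : ℝ → ℝ} (hf : Dec f) (hc : Continuous f) :
    Integrable fun x => (f x : ℂ) := (hf.integrable hc).ofReal

theorem Dec.memLp_ofReal {f : ℝ → ℝ} (hf : Dec f) (hc : Continuous f) :
    MemLp (fun x => (f x : ℂ)) 2 := (hf.memLp hc).ofReal

/-- The Fourier transform of the soliton. -/
noncomputable def fsw (s : ℝ) : ℝ → ℂ := 𝓕 fun x => (sw s x : ℂ)

/-- The Fourier transform of the derivative of the soliton. -/
noncomputable def fdsw (s : ℝ) : ℝ → ℂ := 𝓕 fun x => (dsw s x : ℂ)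

theorem fourier_of_hasDerivAt {f f' : ℝ → ℝ} (hd : ∀ x, HasDerivAt f (f' x) x)
    (hi : Integrable f) (hi' : Integrable f') (ξ : ℝ) :
    𝓕 (fun x => (f' x : ℂ)) ξ = (2 * Real.pi * Complex.I * ξ) * 𝓕 (fun x => (f x : ℂ)) ξ := by
  have h1 : ∀ x, HasDerivAt (fun x => (f x : ℂ)) (f' x : ℂ) x := fun x => (hd x).ofReal_comp
  have h2 : deriv (fun x => (f x : ℂ)) = fun x => (f' x : ℂ) := by ext x; exact (h1 x).deriv
  have := Real.fourier_deriv (f := fun x => (f x : ℂ)) hi.ofReal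
    (fun x => (h1 x).differentiableAt) (by rw [h2]; exact hi'.ofReal)
  rw [h2] at this
  rw [this]; simp

section

variable {s : ℝ} (hs : 1 < s)
include hs

theorem fdsw_eq (ξ : ℝ) : fdsw s ξ = (2 * Real.pi * Complex.I * ξ) * fsw s ξ :=
  fourier_of_hasDerivAt (hasDerivAt_sw (by linarith))
    ((dec_sw hs).integrable (continuous_sw (by linarith)))
    ((dec_dsw hs).integrable (continuous_dsw (by linarith))) ξ

/-- Both w and w'' are integrable, so both their transforms are bounded, the second being that of w
times -(2πξ)². -/
theorem exists_norm_fsw_le : ∃ C : ℝ, 0 < C ∧ ∀ ξ, ‖fsw s ξ‖ ≤ C * (1 + ξ ^ 2)⁻¹ := by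
  have hs0 : 0 < s := by linarith
  have e : ∀ ξ : ℝ, 𝓕 (fun x => (ddsw s x : ℂ)) ξ = (2 * Real.pi * Complex.I * ξ) * fdsw s ξ :=
    fourier_of_hasDerivAt (hasDerivAt_dsw hs0)
      ((dec_dsw hs).integrable (continuous_dsw hs0)) ((dec_ddsw hs).integrable (continuous_ddsw hs0))
  have b1 : ∀ ξ, ‖fsw s ξ‖ ≤ ∫ x, ‖(sw s x : ℂ)‖ :=
    fun ξ => VectorFourier.norm_fourierIntegral_le_integral_norm _ _ _ _ _
  have b2 : ∀ ξ, ‖𝓕 (fun x => (ddsw s x : ℂ)) ξ‖ ≤ ∫ x, ‖(ddsw s x : ℂ)‖ :=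
    fun ξ => VectorFourier.norm_fourierIntegral_le_integral_norm _ _ _ _ _
  set A := ∫ x, ‖(sw s x : ℂ)‖
  set B := ∫ x, ‖(ddsw s x : ℂ)‖
  have hA : 0 ≤ A := integral_nonneg fun _ => norm_nonneg _
  have hB : 0 ≤ B := integral_nonneg fun _ => norm_nonneg _
  refine ⟨A + B + 1, by positivity, fun ξ => ?_⟩
  rw [← div_eq_mul_inv, le_div_iff₀ (by positivity)]
  have h3 := b2 ξ
  rw [e, fdsw_eq hs] at h3
  simp only [norm_mul, Complex.norm_real, Complex.norm_ofNat, Complex.norm_I, mul_one,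
    Real.norm_eq_abs, abs_of_pos Real.pi_pos] at h3
  have h4 : 2 * Real.pi * |ξ| * (2 * Real.pi * |ξ| * ‖fsw s ξ‖)
      = (2 * Real.pi) ^ 2 * (ξ ^ 2 * ‖fsw s ξ‖) := by rw [← sq_abs ξ]; ring
  rw [h4] at h3
  have h5 : 1 ≤ (2 * Real.pi) ^ 2 := by nlinarith [Real.pi_gt_three]
  have h6 : 0 ≤ ξ ^ 2 * ‖fsw s ξ‖ := by positivity
  nlinarith [b1 ξ]

theorem continuous_fsw : Continuous (fsw s) :=
  VectorFourier.fourierIntegral_continuous Real.continuous_fourierChar continuous_inner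
    ((dec_sw hs).integrable_ofReal (continuous_sw (by linarith)))

theorem integrable_fsw : Integrable (fsw s) := by
  obtain ⟨C, hC, h⟩ := exists_norm_fsw_le hs
  exact (integrable_inv_one_add_sq.const_mul C).mono' (continuous_fsw hs).aestronglyMeasurable
    (Eventually.of_forall h)

theorem fourierInv_fsw (x : ℝ) : 𝓕⁻ (fsw s) x = sw s x := by
  have hc : Continuous fun x => (sw s x : ℂ) :=
    Complex.continuous_ofReal.comp (continuous_sw (by linarith))
  exact congrFun (hc.fourierInv_fourier_eq
    ((dec_sw hs).integrable_ofReal (continuous_sw (by linarith))) (integrable_fsw hs)) x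

theorem integrable_sq_mul_fsw : Integrable fun ξ => (1 + ξ ^ 2) * ‖fsw s ξ‖ ^ 2 := by
  obtain ⟨C, hC, h⟩ := exists_norm_fsw_le hs
  have := (continuous_fsw hs)
  refine (integrable_inv_one_add_sq.const_mul (C ^ 2)).mono'
    (Continuous.aestronglyMeasurable (by fun_prop)) (Eventually.of_forall fun ξ => ?_)
  rw [Real.norm_of_nonneg (by positivity)]
  calc (1 + ξ ^ 2) * ‖fsw s ξ‖ ^ 2 ≤ (1 + ξ ^ 2) * (C * (1 + ξ ^ 2)⁻¹) ^ 2 := by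
        gcongr; exact h ξ
    _ = C ^ 2 * (1 + ξ ^ 2)⁻¹ := by field_simp

theorem adm_fsw (hs2 : s < 2) : Adm s (fsw s) := by
  refine ⟨(continuous_fsw hs).aestronglyMeasurable, ((integrable_sq_mul_fsw hs).const_mul 2).mono'
    ?_ (Eventually.of_forall fun ξ => ?_)⟩
  · exact ((measurable_const.add (measurable_abs_rpow s)).aestronglyMeasurable).mul
      ((continuous_fsw hs).aestronglyMeasurable.norm.pow 2)
  · rw [Real.norm_of_nonneg (by positivity), ← mul_assoc]
    gcongr
    have : |ξ| ^ s ≤ 1 + ξ ^ 2 := by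
      rcases le_total |ξ| 1 with h | h
      · have := Real.rpow_le_one (abs_nonneg ξ) h (by linarith : 0 ≤ s)
        nlinarith [sq_nonneg ξ]
      · have := Real.rpow_le_rpow_of_exponent_le h hs2.le
        rw [Real.rpow_two, sq_abs] at this
        linarith
    nlinarith [sq_nonneg ξ]

theorem nsq_fsw : nsq (fsw s) = m0 s := by
  rw [nsq, fsw, integral_norm_sq_fourier' ((dec_sw hs).integrable_ofReal (continuous_sw (by linarith)))
    ((dec_sw hs).memLp_ofReal (continuous_sw (by linarith))), m0]
  simp

theorem pot_fsw : pot s (fsw s) = p0 s := by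
  simp_rw [pot, fourierInv_fsw hs, Complex.norm_real, Real.norm_of_nonneg (sw_pos s _).le]; rfl

theorem integral_sq_mul_fsw : ∫ ξ, (2 * Real.pi * ξ) ^ 2 * ‖fsw s ξ‖ ^ 2 = t0 s := by
  have h := integral_norm_sq_fourier' ((dec_dsw hs).integrable_ofReal (continuous_dsw (by linarith)))
    ((dec_dsw hs).memLp_ofReal (continuous_dsw (by linarith)))
  have e : ∀ ξ, ‖𝓕 (fun x => (dsw s x : ℂ)) ξ‖ ^ 2 = (2 * Real.pi * ξ) ^ 2 * ‖fsw s ξ‖ ^ 2 := by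
    intro ξ
    have := fdsw_eq hs ξ
    rw [fdsw] at this
    rw [this, norm_mul, mul_pow]
    congr 1
    simp [mul_pow, sq_abs]
  simp_rw [e] at h
  rw [h, t0]; simp

/-- Dominated convergence, with the ε-independent quadratic bound on the symbol. The soliton is thus
a competitor whose rescaled energy is nearly the limiting minimum. -/
theorem tendsto_en_fsw (hs2 : s < 2) :
    Tendsto (fun ε => en s ε (fsw s)) (𝓝[>] 0) (𝓝 (t0 s - p0 s)) := by
  unfold en
  rw [pot_fsw hs]
  refine Tendsto.sub_const ?_ _
  rw [← integral_sq_mul_fsw hs]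
  obtain ⟨C, hC, h⟩ := exists_sym_le_sq hs hs2
  have hcf := continuous_fsw hs
  refine tendsto_integral_filter_of_dominated_convergence
    (fun ξ => C * ((1 + ξ ^ 2) * ‖fsw s ξ‖ ^ 2)) ?_ ?_ ((integrable_sq_mul_fsw hs).const_mul C) ?_
  · refine Eventually.of_forall fun ε => Continuous.aestronglyMeasurable ?_
    have := continuous_sym hs ε
    fun_prop
  · filter_upwards [self_mem_nhdsWithin] with ε hε
    refine Eventually.of_forall fun ξ => ?_
    have := sym_nonneg hs ε ξ
    rw [Real.norm_of_nonneg (by positivity), ← mul_assoc]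
    gcongr
    exact (h ε ξ hε).trans (by gcongr; linarith)
  · refine Eventually.of_forall fun ξ => Tendsto.mul_const _ ?_
    rw [Metric.tendsto_nhds]
    intro κ hκ
    obtain ⟨ε₀, hε₀, h1⟩ := exists_sym_near hs (R := |ξ| + 1) (κ := κ / (ξ ^ 2 + 1) / 2)
      (by positivity) (by positivity)
    filter_upwards [Ioc_mem_nhdsGT hε₀] with ε hε
    rw [Real.dist_eq]
    refine (h1 ε ξ hε.1 hε.2 (by linarith)).trans_lt ?_
    have : κ / (ξ ^ 2 + 1) / 2 * ξ ^ 2 ≤ κ / 2 := by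
      rw [div_div, div_mul_eq_mul_div, div_le_div_iff₀ (by positivity) (by positivity)]
      nlinarith
    linarith

end

/-! ### Coercivity of the linearized operators -/

theorem Dec.congr {f g : ℝ → ℝ} (hf : Dec f) (h : ∀ x, g x = f x) : Dec g :=
  (funext h : g = f) ▸ hf

/-- `a` is continuously differentiable with derivative `a'`, both are square integrable, and `a`
vanishes at infinity. -/
structure Sob (a a' : ℝ → ℝ) : Prop where
  deriv : ∀ x, HasDerivAt a (a' x) x
  memLp : MemLp a 2
  memLp' : MemLp a' 2
  tendsto : Tendsto a (cocompact ℝ) (𝓝 0)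

namespace Sob

variable {a a' b b' : ℝ → ℝ}

theorem sub_const_mul (ha : Sob a a') (hb : Sob b b') (c : ℝ) :
    Sob (fun x => a x - c * b x) (fun x => a' x - c * b' x) where
  deriv x := (ha.deriv x).sub ((hb.deriv x).const_mul c)
  memLp := ha.memLp.sub (hb.memLp.const_mul c)
  memLp' := ha.memLp'.sub (hb.memLp'.const_mul c)
  tendsto := by simpa using ha.tendsto.sub (hb.tendsto.const_mul c)

theorem of_dec (hd : ∀ x, HasDerivAt a (a' x) x) (h : Dec a) (h' : Dec a') (hc : Continuous a') :
    Sob a a' :=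
  ⟨hd, h.memLp (continuous_iff_continuousAt.2 fun x => (hd x).continuousAt), h'.memLp hc, h.tendsto⟩

end Sob

/-- Jacobi's argument: if ψ'' = -Wψ then (a²ψ'/ψ)' = a'² - W a² - (a' - aψ'/ψ)², and a²ψ'/ψ vanishes
at infinity. The zeros of ψ are harmless where a vanishes too. -/
theorem integral_weight_le_of_jacobi {ψ ψ' W a a' : ℝ → ℝ} (hψ : ∀ x, HasDerivAt ψ (ψ' x) x)
    (hψ' : ∀ x, HasDerivAt ψ' (-W x * ψ x) x) (hz : ∀ x, ψ x = 0 → ψ' x ≠ 0) (ha : Sob a a')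
    (haz : ∀ x, ψ x = 0 → a x = 0) (hW : Integrable fun x => W x * a x ^ 2) {B : ℝ}
    (hB : ∀ᶠ x in cocompact ℝ, |ψ' x / ψ x| ≤ B) :
    ∫ x, W x * a x ^ 2 ≤ ∫ x, a' x ^ 2 := by
  have ia' : Integrable fun x => a' x ^ 2 := by
    simpa using (memLp_two_iff_integrable_sq_norm ha.memLp'.1).1 ha.memLp'
  set F : ℝ → ℝ := fun x => a x ^ 2 * (ψ' x / ψ x) with hF
  have hFd : ∀ x, ∃ f', HasDerivAt F f' x ∧ f' ≤ a' x ^ 2 - W x * a x ^ 2 := by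
    intro x
    by_cases hx : ψ x = 0
    -- At a zero of ψ the value of F is 0, since a vanishes there and a quotient by zero is 0. Its
    -- difference quotient is the square of that of a, times ψ', divided by that of ψ, hence tends
    -- to a'².
    · refine ⟨a' x ^ 2, ?_, by rw [haz x hx]; simp⟩
      rw [hasDerivAt_iff_tendsto_slope]
      have h1 := hasDerivAt_iff_tendsto_slope.1 (ha.deriv x)
      have h2 := hasDerivAt_iff_tendsto_slope.1 (hψ x)
      have h3 : Tendsto ψ' (𝓝[≠] x) (𝓝 (ψ' x)) :=
        (hψ' x).continuousAt.tendsto.mono_left nhdsWithin_le_nhds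
      have h4 := (h1.pow 2).mul (h3.div h2 (hz x hx))
      rw [div_self (hz x hx), mul_one] at h4
      refine h4.congr' ?_
      filter_upwards [self_mem_nhdsWithin] with y hy
      have hy' : y - x ≠ 0 := sub_ne_zero.2 hy
      simp only [slope_def_field, hF, hx, haz x hx, Pi.div_apply]
      by_cases hψy : ψ y = 0
      · simp [hψy]
      · field_simp; simp; ring
    · refine ⟨_, ((ha.deriv x).pow 2).mul ((hψ' x).div (hψ x) hx), ?_⟩
      have : 0 ≤ (a' x - ψ' x / ψ x * a x) ^ 2 := sq_nonneg _
      simp only [Pi.pow_apply]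
      have e : (a' x - ψ' x / ψ x * a x) ^ 2 = (a' x ^ 2 - W x * a x ^ 2) -
          (((2 : ℕ) : ℝ) * a x ^ (2 - 1) * a' x * (ψ' x / ψ x) +
            a x ^ 2 * ((-W x * ψ x * ψ x - ψ' x * ψ' x) / ψ x ^ 2)) := by
        field_simp; push_cast; ring
      linarith
  choose F' hF' hF'le using hFd
  -- Integrability of F' is unknown, so the inequality form of the fundamental theorem is used, with
  -- only the integrable upper bound of F'.
  have hle : ∀ n : ℝ, 0 ≤ n → F n - F (-n) ≤ ∫ x in (-n)..n, (a' x ^ 2 - W x * a x ^ 2) := by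
    intro n hn
    refine intervalIntegral.sub_le_integral_of_hasDeriv_right_of_le (by linarith)
      (fun x _ => (hF' x).continuousAt.continuousWithinAt)
      (fun x _ => (hF' x).hasDerivWithinAt) (ia'.sub hW).integrableOn fun x _ => hF'le x
  have hF0 : Tendsto F (cocompact ℝ) (𝓝 0) := by
    have h1 : Tendsto (fun x => a x ^ 2 * B) (cocompact ℝ) (𝓝 0) := by
      simpa using (ha.tendsto.pow 2).mul_const B
    refine squeeze_zero_norm' ?_ h1
    filter_upwards [hB] with x hx
    rw [hF, norm_mul, Real.norm_of_nonneg (sq_nonneg _)]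
    exact mul_le_mul_of_nonneg_left hx (sq_nonneg _)
  have hlim1 : Tendsto (fun n => F n - F (-n)) atTop (𝓝 (0 - 0)) :=
    (hF0.mono_left atTop_le_cocompact).sub
      ((hF0.mono_left atBot_le_cocompact).comp tendsto_neg_atTop_atBot)
  have hlim2 := intervalIntegral_tendsto_integral (ia'.sub hW) tendsto_neg_atTop_atBot tendsto_id
  have := le_of_tendsto_of_tendsto hlim1 hlim2
    ((eventually_ge_atTop 0).mono fun n hn => hle n hn)
  simp only [Pi.sub_apply] at this
  rw [integral_sub ia' hW] at this
  linarith

theorem integral_linear_comb {f g h : ℝ → ℝ} (hf : Integrable f) (hg : Integrable g)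
    (hh : Integrable h) (a b c : ℝ) :
    ∫ x, (a * f x + b * g x + c * h x) = a * (∫ x, f x) + b * (∫ x, g x) + c * (∫ x, h x) := by
  rw [integral_add (f := fun x => a * f x + b * g x) ((hf.const_mul a).add (hg.const_mul b))
    (hh.const_mul c), integral_add (hf.const_mul a) (hg.const_mul b), integral_const_mul,
    integral_const_mul, integral_const_mul]

/-- The bilinear form of `-∂² + 1 - k (1 - tanh²(s x))`. -/
noncomputable def bl (s k : ℝ) (a a' b b' : ℝ → ℝ) : ℝ :=
  ∫ x, (a' x * b' x + a x * b x - k * (1 - st s x ^ 2) * (a x * b x))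

theorem integrable_bdd_mul {f g : ℝ → ℝ} {B : ℝ} (hg : Continuous g) (hB : ∀ x, |g x| ≤ B)
    (hf : Integrable f) : Integrable fun x => g x * f x :=
  hf.bdd_mul hg.aestronglyMeasurable (Eventually.of_forall hB)

theorem integrable_potential_term (s k : ℝ) {f : ℝ → ℝ} (hf : Integrable f) :
    Integrable fun x => k * (1 - st s x ^ 2) * f x := by
  have := continuous_st s
  refine integrable_bdd_mul (B := |k|) (by fun_prop) (fun x => ?_) hf
  rw [abs_mul]
  exact mul_le_of_le_one_right (abs_nonneg _) (abs_one_sub_st_sq_le s x)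

theorem integrable_bl (s k : ℝ) {a a' b b' : ℝ → ℝ} (ha : Sob a a') (hb : Sob b b') :
    Integrable fun x => a' x * b' x + a x * b x - k * (1 - st s x ^ 2) * (a x * b x) :=
  ((ha.memLp'.integrable_mul hb.memLp').add (ha.memLp.integrable_mul hb.memLp)).sub
    (integrable_potential_term s k (ha.memLp.integrable_mul hb.memLp))

theorem bl_sub_const_mul (s k : ℝ) {a a' b b' : ℝ → ℝ} (ha : Sob a a') (hb : Sob b b') (c : ℝ) :
    bl s k (fun x => a x - c * b x) (fun x => a' x - c * b' x) (fun x => a x - c * b x)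
      (fun x => a' x - c * b' x) = bl s k a a' a a' - 2 * c * bl s k a a' b b'
        + c ^ 2 * bl s k b b' b b' := by
  have h := integral_linear_comb (integrable_bl s k ha ha) (integrable_bl s k ha hb)
    (integrable_bl s k hb hb) 1 (-2 * c) (c ^ 2)
  unfold bl
  calc _ = _ := integral_congr_ae (Eventually.of_forall fun x => by ring)
    _ = _ := h
    _ = _ := by ring

theorem bl_eq_integral (s k : ℝ) {a a' r r' r'' f : ℝ → ℝ} (ha : Sob a a') (hr : Sob r r')
    (hr' : Sob r' r'') (hf : ∀ x, -r'' x + r x - k * (1 - st s x ^ 2) * r x = f x) :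
    bl s k a a' r r' = ∫ x, a x * f x := by
  have i1 : Integrable fun x => a' x * r' x + a x * r'' x :=
    (ha.memLp'.integrable_mul hr'.memLp).add (ha.memLp.integrable_mul hr'.memLp')
  have h0 : ∫ x, (a' x * r' x + a x * r'' x) = 0 := by
    refine integral_deriv_eq_zero (f := fun x => a x * r' x)
      (fun x => (ha.deriv x).mul (hr'.deriv x)) i1 ?_
    simpa using ha.tendsto.mul hr'.tendsto
  rw [bl, ← sub_zero (∫ x, _), ← h0, ← integral_sub (integrable_bl s k ha hr) i1]
  congr 1; ext x
  rw [← hf]; ring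

theorem Sob.integrable_sq {a a' : ℝ → ℝ} (ha : Sob a a') : Integrable fun x => a x ^ 2 := by
  simpa using (memLp_two_iff_integrable_sq_norm ha.memLp.1).1 ha.memLp

theorem Sob.integrable_deriv_sq {a a' : ℝ → ℝ} (ha : Sob a a') : Integrable fun x => a' x ^ 2 := by
  simpa using (memLp_two_iff_integrable_sq_norm ha.memLp'.1).1 ha.memLp'

theorem le_bl_of_integral_weight_le (s : ℝ) {k k' : ℝ} (hk : k ≤ k') {a a' : ℝ → ℝ} (ha : Sob a a')
    (h : ∫ x, k' * (1 - st s x ^ 2) * a x ^ 2 ≤ ∫ x, a' x ^ 2) :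
    ∫ x, a x ^ 2 ≤ bl s k a a' a a' := by
  have h1 : ∫ x, k * (1 - st s x ^ 2) * a x ^ 2 ≤ ∫ x, k' * (1 - st s x ^ 2) * a x ^ 2 := by
    refine integral_mono (integrable_potential_term s k ha.integrable_sq)
      (integrable_potential_term s k' ha.integrable_sq) fun x => ?_
    have := st_sq_lt_one s x
    have : 0 ≤ (1 - st s x ^ 2) * a x ^ 2 := mul_nonneg (by linarith) (sq_nonneg _)
    simp only [mul_assoc]
    exact mul_le_mul_of_nonneg_right hk this
  have h2 : bl s k a a' a a' = 1 * (∫ x, a' x ^ 2) + 1 * (∫ x, a x ^ 2)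
      + (-1) * ∫ x, k * (1 - st s x ^ 2) * a x ^ 2 := by
    rw [bl, ← integral_linear_comb ha.integrable_deriv_sq ha.integrable_sq
        (integrable_potential_term s k ha.integrable_sq)]
    congr 1; ext x; ring
  linarith

theorem tendsto_one_sub_st_sq {s : ℝ} (hs : 1 < s) :
    Tendsto (fun x => 1 - st s x ^ 2) (cocompact ℝ) (𝓝 0) := by
  have h := (dec_sw hs).tendsto.rpow_const (p := 2 * s) (Or.inr (by linarith))
  rw [Real.zero_rpow (by linarith)] at h
  exact h.congr fun x => sw_rpow (by linarith) x

section

variable {s : ℝ} (hs : 1 < s)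
include hs

theorem sob_sw : Sob (sw s) (dsw s) :=
  Sob.of_dec (hasDerivAt_sw (by linarith)) (dec_sw hs) (dec_dsw hs) (continuous_dsw (by linarith))

theorem sob_dsw : Sob (dsw s) (ddsw s) :=
  Sob.of_dec (hasDerivAt_dsw (by linarith)) (dec_dsw hs) (dec_ddsw hs) (continuous_ddsw (by linarith))

/-- The Jacobi function is tanh(sx), the Legendre polynomial of degree 1 in tanh, with weight 2s²(1
- tanh²). It dominates the potential of L₋ because s + 1 ≤ 2s² for s ≥ 1. -/
theorem le_bl_of_zero {b b' : ℝ → ℝ} (hb : Sob b b') (h0 : b 0 = 0) :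
    ∫ x, b x ^ 2 ≤ bl s (s + 1) b b' b b' := by
  have hk : s + 1 ≤ 2 * s ^ 2 := by nlinarith
  refine le_bl_of_integral_weight_le s hk hb ?_
  refine integral_weight_le_of_jacobi (ψ := st s) (ψ' := fun x => s * (1 - st s x ^ 2))
    (W := fun x => 2 * s ^ 2 * (1 - st s x ^ 2)) (B := 2 * s) (hasDerivAt_st s) (fun x => ?_)
    (fun x _ => ?_) hb (fun x hx => ?_) (integrable_potential_term s _ hb.integrable_sq) ?_
  · refine ((((hasDerivAt_st s x).pow 2).const_sub 1).const_mul s).congr_deriv ?_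
    push_cast; ring
  · have := st_sq_lt_one s x
    exact mul_ne_zero (by linarith) (by linarith)
  · have h1 : Real.tanh (s * x) = Real.tanh 0 := by rw [Real.tanh_zero]; exact hx
    have := Real.tanh_injective h1
    have : x = 0 := by rcases mul_eq_zero.1 this with h | h <;> linarith
    rw [this, h0]
  · filter_upwards [(tendsto_one_sub_st_sq hs).eventually (gt_mem_nhds (by norm_num : (0:ℝ) < 3/4))]
      with x hx
    have h1 : 1 / 2 ≤ |st s x| := by
      apply abs_le_of_sq_le_sq' _ (abs_nonneg _) |>.2
      rw [sq_abs]; nlinarith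
    rw [abs_div, div_le_iff₀ (by linarith), abs_mul, abs_of_pos (by linarith : 0 < s)]
    have := abs_one_sub_st_sq_le s x
    nlinarith

/-- Coercivity of `L₋` away from the soliton. -/
theorem sub_le_bl_minus {b b' : ℝ → ℝ} (hb : Sob b b') :
    (∫ x, b x ^ 2) - (∫ x, b x * sw s x) ^ 2 / m0 s ≤ bl s (s + 1) b b' b b' := by
  have hw := sob_sw hs
  have hwk : ∀ x, -ddsw s x + sw s x - (s + 1) * (1 - st s x ^ 2) * sw s x = 0 := fun x => by
    rw [ddsw]; ring
  -- Since w(0) = 1, the function b - b(0)w vanishes at 0. As w lies in the kernel of L₋, the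
  -- subtraction does not change the form.
  have h1 := le_bl_of_zero hs (hb.sub_const_mul hw (b 0)) (by simp [sw_zero])
  rw [bl_sub_const_mul s _ hb hw, bl_eq_integral s _ hb hw (sob_dsw hs) hwk,
    bl_eq_integral s _ hw hw (sob_dsw hs) hwk] at h1
  simp only [mul_zero, integral_zero, sub_zero, add_zero] at h1
  have i1 : Integrable fun x => b x * sw s x := hb.memLp.integrable_mul hw.memLp
  have e : ∫ x, (b x - b 0 * sw s x) ^ 2
      = 1 * (∫ x, b x ^ 2) + (-2 * b 0) * (∫ x, b x * sw s x) + b 0 ^ 2 * m0 s := by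
    rw [m0, ← integral_linear_comb hb.integrable_sq i1 hw.integrable_sq]
    congr 1; ext x; ring
  rw [e] at h1
  have hm := m0_pos hs
  set σ := ∫ x, b x * sw s x
  -- The value b(0) is not controlled, so the bound is weakened to the minimum over all multiples of
  -- w that may be subtracted.
  have : 0 ≤ m0 s * (b 0 - σ / m0 s) ^ 2 := by positivity
  have e2 : m0 s * (b 0 - σ / m0 s) ^ 2 = b 0 ^ 2 * m0 s - 2 * b 0 * σ + σ ^ 2 / m0 s := by
    field_simp; ring
  linarith

/-- The Jacobi function is 3 tanh² - 1, proportional to the Legendre polynomial of degree 2 in tanh,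
with weight 6s²(1 - tanh²). It dominates the potential of L₊ because (s+1)(2s+1) ≤ 6s² for s ≥ 1. -/
theorem le_bl_of_zeros {y : ℝ} (hy : 3 * Real.tanh (s * y) ^ 2 = 1) {a a' : ℝ → ℝ} (ha : Sob a a')
    (h1 : a y = 0) (h2 : a (-y) = 0) :
    ∫ x, a x ^ 2 ≤ bl s ((s + 1) * (2 * s + 1)) a a' a a' := by
  have hk : (s + 1) * (2 * s + 1) ≤ 6 * s ^ 2 := by nlinarith
  have hs0 : s ≠ 0 := by linarith
  have hz : ∀ x, 3 * st s x ^ 2 - 1 = 0 → x = y ∨ x = -y := by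
    intro x hx
    have : Real.tanh (s * x) ^ 2 = Real.tanh (s * y) ^ 2 := by
      have : st s x = Real.tanh (s * x) := rfl
      rw [this] at hx; linarith
    rcases sq_eq_sq_iff_eq_or_eq_neg.1 this with h | h
    · left; exact mul_left_cancel₀ hs0 (Real.tanh_injective h)
    · right
      rw [← Real.tanh_neg] at h
      have := Real.tanh_injective h
      exact mul_left_cancel₀ hs0 (by linarith)
  refine le_bl_of_integral_weight_le s hk ha ?_
  refine integral_weight_le_of_jacobi (ψ := fun x => 3 * st s x ^ 2 - 1)
    (ψ' := fun x => 6 * s * (st s x * (1 - st s x ^ 2)))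
    (W := fun x => 6 * s ^ 2 * (1 - st s x ^ 2)) (B := 12 * s) (fun x => ?_) (fun x => ?_)
    (fun x hx => ?_) ha (fun x hx => ?_) (integrable_potential_term s _ ha.integrable_sq) ?_
  · refine ((((hasDerivAt_st s x).pow 2).const_mul 3).sub_const 1).congr_deriv ?_
    push_cast; ring
  · refine (((hasDerivAt_st s x).mul (((hasDerivAt_st s x).pow 2).const_sub 1)).const_mul
      (6 * s)).congr_deriv ?_
    simp only [Pi.pow_apply]; push_cast; ring
  · have h3 := st_sq_lt_one s x
    have h4 : st s x ≠ 0 := by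
      intro h; simp only [h] at hx; norm_num at hx
    have h5 : 1 - st s x ^ 2 ≠ 0 := by linarith
    have : (6 : ℝ) * s ≠ 0 := by linarith
    exact mul_ne_zero this (mul_ne_zero h4 h5)
  · rcases hz x hx with rfl | rfl <;> assumption
  · filter_upwards [(tendsto_one_sub_st_sq hs).eventually (gt_mem_nhds (by norm_num : (0:ℝ) < 1/2))]
      with x hx
    have h1 : 1 / 2 ≤ |3 * st s x ^ 2 - 1| := (by linarith : 1/2 ≤ 3 * st s x ^ 2 - 1).trans (le_abs_self _)
    rw [abs_div, div_le_iff₀ (by linarith), abs_mul, abs_of_pos (by linarith : 0 < 6 * s), abs_mul]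
    have h3 : |st s x| * |1 - st s x ^ 2| ≤ 1 :=
      mul_le_one₀ (abs_st_le s x) (abs_nonneg _) (abs_one_sub_st_sq_le s x)
    nlinarith

omit hs in
/-- The third derivative of the soliton. -/
noncomputable def dddsw (s x : ℝ) : ℝ := dsw s x - (s + 1) * (2 * s + 1) * (1 - st s x ^ 2) * dsw s x

theorem hasDerivAt_ddsw (x : ℝ) : HasDerivAt (ddsw s) (dddsw s x) x := by
  have hw := hasDerivAt_sw (by linarith : 0 < s) x
  refine (hw.sub ((((((hasDerivAt_st s x).pow 2).const_sub 1).const_mul (s + 1))).mul hw)).congr_deriv ?_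
  simp only [Pi.pow_apply, dddsw, dsw]; push_cast; ring

theorem continuous_dddsw : Continuous (dddsw s) := by
  have := continuous_st s; have := continuous_dsw (s := s) (by linarith)
  unfold dddsw; fun_prop

omit hs in
theorem abs_potential_le (s k x : ℝ) : |k * (1 - st s x ^ 2)| ≤ |k| := by
  rw [abs_mul]
  exact mul_le_of_le_one_right (abs_nonneg _) (abs_one_sub_st_sq_le s x)

theorem dec_dddsw : Dec (dddsw s) :=
  (dec_dsw hs).sub ((dec_dsw hs).bdd_mul (abs_potential_le s _))

theorem sob_ddsw : Sob (ddsw s) (dddsw s) :=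
  Sob.of_dec (hasDerivAt_ddsw hs) (dec_ddsw hs) (dec_dddsw hs) (continuous_dddsw hs)

omit hs in
/-- The generator of the scaling, applied to the soliton. -/
noncomputable def rsw (s x : ℝ) : ℝ := s⁻¹ * sw s x + x * dsw s x

omit hs in
/-- The derivative of `rsw`. -/
noncomputable def drsw (s x : ℝ) : ℝ := (s⁻¹ + 1) * dsw s x + x * ddsw s x

omit hs in
/-- The second derivative of `rsw`. -/
noncomputable def ddrsw (s x : ℝ) : ℝ := (s⁻¹ + 2) * ddsw s x + x * dddsw s x

theorem dec_id_mul_dsw : Dec fun x => x * dsw s x := by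
  have := (dec_id_mul_sw hs).bdd_mul (f := fun x => -st s x) (B := 1)
    fun x => by rw [abs_neg]; exact abs_st_le s x
  exact this.congr fun x => by rw [dsw]; ring

theorem dec_id_mul_ddsw : Dec fun x => x * ddsw s x := by
  have := (dec_id_mul_sw hs).sub ((dec_id_mul_sw hs).bdd_mul (abs_potential_le s (s + 1)))
  exact this.congr fun x => by rw [ddsw]; ring

theorem dec_id_mul_dddsw : Dec fun x => x * dddsw s x := by
  have := (dec_id_mul_dsw hs).sub ((dec_id_mul_dsw hs).bdd_mul
    (abs_potential_le s ((s + 1) * (2 * s + 1))))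
  exact this.congr fun x => by rw [dddsw]; ring

theorem sob_rsw : Sob (rsw s) (drsw s) := by
  have hs0 : 0 < s := by linarith
  refine Sob.of_dec (fun x => ?_) (((dec_sw hs).const_mul _).add (dec_id_mul_dsw hs))
    (((dec_dsw hs).const_mul _).add (dec_id_mul_ddsw hs)) ?_
  · refine (((hasDerivAt_sw hs0 x).const_mul s⁻¹).add
      ((hasDerivAt_id x).mul (hasDerivAt_dsw hs0 x))).congr_deriv ?_
    simp only [drsw, dsw, id_eq]; ring
  · have := continuous_dsw hs0; have := continuous_ddsw hs0
    unfold drsw; fun_prop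

theorem sob_drsw : Sob (drsw s) (ddrsw s) := by
  have hs0 : 0 < s := by linarith
  refine Sob.of_dec (fun x => ?_) (((dec_dsw hs).const_mul _).add (dec_id_mul_ddsw hs))
    (((dec_ddsw hs).const_mul _).add (dec_id_mul_dddsw hs)) ?_
  · refine (((hasDerivAt_dsw hs0 x).const_mul (s⁻¹ + 1)).add
      ((hasDerivAt_id x).mul (hasDerivAt_ddsw hs x))).congr_deriv ?_
    simp only [ddrsw, id_eq]; ring
  · have := continuous_ddsw hs0; have := continuous_dddsw hs
    unfold ddrsw; fun_prop

/-- Differentiating in λ the equation satisfied by λ^(1/s) w(λx) gives L₊R = -2w for R = w/s + xw'.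
-/
theorem linearized_rsw (x : ℝ) :
    -ddrsw s x + rsw s x - (s + 1) * (2 * s + 1) * (1 - st s x ^ 2) * rsw s x = -2 * sw s x := by
  have : s ≠ 0 := by linarith
  simp only [ddrsw, rsw, dddsw, ddsw]
  field_simp
  ring

omit hs in
theorem linearized_dsw (s x : ℝ) :
    -dddsw s x + dsw s x - (s + 1) * (2 * s + 1) * (1 - st s x ^ 2) * dsw s x = 0 := by
  rw [dddsw]; ring

/-- Integration of (xw²)'. The factor 1/s - 1/2 is positive for s < 2, which is the slope condition:
L₊ is negative on R. -/
theorem integral_rsw_mul_sw : ∫ x, rsw s x * sw s x = (s⁻¹ - 2⁻¹) * m0 s := by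
  have hs0 : 0 < s := by linarith
  have hw := sob_sw hs
  have i2 : Integrable fun x => x * dsw s x * sw s x :=
    ((dec_id_mul_dsw hs).mul (dec_sw hs)).integrable (by
      have := continuous_sw hs0; have := continuous_dsw hs0; fun_prop)
  have h : ∫ x, (sw s x ^ 2 + 2 * (x * dsw s x * sw s x)) = 0 := by
    refine integral_deriv_eq_zero (f := fun x => x * sw s x ^ 2) (fun x => ?_)
      (hw.integrable_sq.add (i2.const_mul 2)) ?_
    · refine ((hasDerivAt_id x).mul ((hw.deriv x).pow 2)).congr_deriv ?_
      simp only [id_eq, Pi.pow_apply]; push_cast; ring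
    · have := ((dec_id_mul_sw hs).mul (dec_sw hs)).tendsto
      exact this.congr fun x => by ring
  rw [integral_add hw.integrable_sq (i2.const_mul 2), integral_const_mul] at h
  have e : ∫ x, rsw s x * sw s x = s⁻¹ * m0 s + ∫ x, x * dsw s x * sw s x := by
    rw [m0, ← integral_const_mul, ← integral_add (hw.integrable_sq.const_mul _) i2]
    congr 1; ext x; rw [rsw]; ring
  rw [e]
  have : ∫ x, sw s x ^ 2 = m0 s := rfl
  linarith

/-- The zero of 3 tanh² - 1 is z = arsinh(1/√2) < 1, so 1 - z tanh z > 0 and R does not vanish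
there. R and w' can thus correct the even and odd values at ±y. -/
theorem exists_tanh_zero : ∃ y : ℝ, 3 * Real.tanh (s * y) ^ 2 = 1 ∧ rsw s y ≠ 0 ∧ dsw s y ≠ 0 := by
  have hs0 : 0 < s := by linarith
  have h3 : (0:ℝ) < √3 := by positivity
  have h3' : (√3 : ℝ) ^ 2 = 3 := Real.sq_sqrt (by norm_num)
  set z := Real.arsinh (√(1/2)) with hz
  have hsz : Real.sinh z = √(1/2) := Real.sinh_arsinh _
  have hsz2 : Real.sinh z ^ 2 = 1/2 := by rw [hsz, Real.sq_sqrt (by norm_num)]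
  have hcz : Real.cosh z ^ 2 = 3/2 := by rw [Real.cosh_sq, hsz2]; norm_num
  have hz0 : 0 < z := by rw [hz, Real.arsinh_pos_iff]; positivity
  have htz : Real.tanh z ^ 2 = 1/3 := by
    rw [Real.tanh_eq_sinh_div_cosh, div_pow, hsz2, hcz]; norm_num
  have hz1 : z < 1 := by
    have h1 : z ≤ Real.sinh z := Real.self_le_sinh_iff.2 hz0.le
    have : Real.sinh z < 1 := by
      rw [hsz]
      calc √(1/2) < √1 := Real.sqrt_lt_sqrt (by norm_num) (by norm_num)
        _ = 1 := by simp
    linarith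
  have e : s * (z / s) = z := by field_simp
  have ht : st s (z / s) = Real.tanh z := by rw [st, e]
  have hw := sw_pos s (z / s)
  refine ⟨z / s, by rw [e, htz]; norm_num, ?_, ?_⟩
  · rw [rsw, dsw, ht]
    have h1 := Real.tanh_lt_one z
    have : s⁻¹ * sw s (z / s) + z / s * (-Real.tanh z * sw s (z / s))
        = s⁻¹ * sw s (z / s) * (1 - z * Real.tanh z) := by field_simp; ring
    rw [this]
    have h2 : 0 < 1 - z * Real.tanh z := by nlinarith
    positivity
  · rw [dsw, ht]
    have : Real.tanh z ≠ 0 := by intro h; rw [h] at htz; norm_num at htz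
    exact mul_ne_zero (neg_ne_zero.2 this) hw.ne'

omit hs in
theorem rsw_neg (s x : ℝ) : rsw s (-x) = rsw s x := by
  simp [rsw, dsw, sw_neg, st_neg]

omit hs in
theorem dsw_neg (s x : ℝ) : dsw s (-x) = -dsw s x := by
  simp [dsw, sw_neg, st_neg]

omit hs in
theorem Sob.integral_sub_const_mul_sq {a a' d d' : ℝ → ℝ} (ha : Sob a a') (hd : Sob d d') (γ : ℝ) :
    (∫ x, (a x - γ * d x) ^ 2)
      = (∫ x, a x ^ 2) - 2 * γ * (∫ x, a x * d x) + γ ^ 2 * ∫ x, d x ^ 2 := by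
  have h := integral_linear_comb ha.integrable_sq (ha.memLp.integrable_mul hd.memLp)
    hd.integrable_sq 1 (-2 * γ) (γ ^ 2)
  have e : ∀ x, (a x - γ * d x) ^ 2 = 1 * a x ^ 2 + (-2 * γ) * (a * d) x + γ ^ 2 * d x ^ 2 :=
    fun x => by simp only [Pi.mul_apply]; ring
  simp_rw [e]
  rw [h]
  simp only [Pi.mul_apply]
  ring

-- Bookkeeping for `exists_le_bl_plus`. The term -Nα², from the negative direction R, bounds α
-- through σ; the choice of γ is handled by completing the square with τ. In this way the
-- uncontrolled coefficients disappear from the estimate.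
omit hs in
theorem coercivity_arith {A A0 Q X α γ σ τ N M ρ T : ℝ} (hN0 : 0 < N) (hT : 0 < T) (hρ : 0 ≤ ρ)
    (hM0 : 0 < M) (hM : M = 2 + 4 * ρ / N) (hA0 : 0 ≤ A0) (h1 : A0 ≤ Q + 4 * α * σ - N * α ^ 2)
    (h3 : X ≤ 2 * A0 + 2 * α ^ 2 * ρ) (h4 : X = A - 2 * γ * τ + γ ^ 2 * T) :
    M⁻¹ * A ≤ Q + (8 / N + (M * T)⁻¹) * (σ ^ 2 + τ ^ 2) := by
  have h2 : A0 + N / 2 * α ^ 2 ≤ Q + 8 / N * σ ^ 2 := by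
    have : 0 ≤ N / 2 * (α - 4 * σ / N) ^ 2 := by positivity
    have e : N / 2 * (α - 4 * σ / N) ^ 2 = N / 2 * α ^ 2 - 4 * α * σ + 8 / N * σ ^ 2 := by
      field_simp; ring
    linarith
  have h5 : 0 ≤ T * (γ - τ / T) ^ 2 := by positivity
  have e5 : T * (γ - τ / T) ^ 2 = γ ^ 2 * T - 2 * γ * τ + τ ^ 2 / T := by
    field_simp; ring
  have h6 : 2 * A0 + 2 * α ^ 2 * ρ ≤ M * (A0 + N / 2 * α ^ 2) := by
    have : M * (A0 + N / 2 * α ^ 2) = 2 * A0 + 2 * α ^ 2 * ρ + (4 * ρ / N * A0 + N * α ^ 2) := by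
      rw [hM]; field_simp; ring
    rw [this]
    have : 0 ≤ 4 * ρ / N * A0 + N * α ^ 2 := by positivity
    linarith
  have h7 : A ≤ M * (Q + 8 / N * σ ^ 2) + τ ^ 2 / T := by
    have := mul_le_mul_of_nonneg_left h2 hM0.le
    linarith
  rw [inv_mul_le_iff₀ hM0]
  refine h7.trans ?_
  have e7 : M * (Q + (8 / N + (M * T)⁻¹) * (σ ^ 2 + τ ^ 2)) =
      M * (Q + 8 / N * σ ^ 2) + τ ^ 2 / T + (M * (8 / N) * τ ^ 2 + σ ^ 2 / T) := by
    field_simp; ring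
  rw [e7]
  have : 0 ≤ M * (8 / N) * τ ^ 2 + σ ^ 2 / T := by positivity
  linarith

/-- Coercivity of `L₊` away from the soliton and its derivative. -/
theorem exists_le_bl_plus (hs2 : s < 2) : ∃ c C : ℝ, 0 < c ∧ 0 ≤ C ∧ ∀ a a' : ℝ → ℝ, Sob a a' →
    c * ∫ x, a x ^ 2 ≤ bl s ((s + 1) * (2 * s + 1)) a a' a a'
      + C * ((∫ x, a x * sw s x) ^ 2 + (∫ x, a x * dsw s x) ^ 2) := by
  obtain ⟨y, hy, hRy, hdy⟩ := exists_tanh_zero hs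
  have hm := m0_pos hs
  have ht := t0_pos hs
  obtain ⟨k, hk⟩ : ∃ k, k = (s + 1) * (2 * s + 1) := ⟨_, rfl⟩
  obtain ⟨ρ, hρe⟩ : ∃ ρ, ρ = ∫ x, rsw s x ^ 2 := ⟨_, rfl⟩
  have hρ : 0 ≤ ρ := hρe ▸ integral_nonneg fun _ => sq_nonneg _
  -- Minus the value of the form of L₊ at R; positive by the slope condition.
  obtain ⟨N, hN⟩ : ∃ N, N = 2 * (s⁻¹ - 2⁻¹) * m0 s := ⟨_, rfl⟩
  have hN0 : 0 < N := by
    have : 2⁻¹ < s⁻¹ := by gcongr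
    have : 0 < s⁻¹ - 2⁻¹ := by linarith
    rw [hN]; positivity
  obtain ⟨M, hM⟩ : ∃ M, M = 2 + 4 * ρ / N := ⟨_, rfl⟩
  have hM0 : 0 < M := by rw [hM]; positivity
  have hMi := inv_pos.2 hM0
  have hC0 : 0 ≤ 8 / N + (M * t0 s)⁻¹ :=
    add_nonneg (div_nonneg (by norm_num) hN0.le) (inv_nonneg.2 (mul_nonneg hM0.le ht.le))
  refine ⟨M⁻¹, 8 / N + (M * t0 s)⁻¹, hMi, hC0, fun a a' ha => ?_⟩
  obtain ⟨σ, hσ⟩ : ∃ σ, σ = ∫ x, a x * sw s x := ⟨_, rfl⟩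
  obtain ⟨τ, hτ⟩ : ∃ τ, τ = ∫ x, a x * dsw s x := ⟨_, rfl⟩
  rw [← hσ, ← hτ]
  -- R is even and w' is odd, so these coefficients make a - αR - γw' vanish at both y and -y, as
  -- `le_bl_of_zeros` requires.
  obtain ⟨α, e1⟩ : ∃ α, α * rsw s y = (a y + a (-y)) / 2 :=
    ⟨(a y + a (-y)) / 2 / rsw s y, div_mul_cancel₀ _ hRy⟩
  obtain ⟨γ, e2⟩ : ∃ γ, γ * dsw s y = (a y - a (-y)) / 2 :=
    ⟨(a y - a (-y)) / 2 / dsw s y, div_mul_cancel₀ _ hdy⟩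
  have hR := sob_rsw hs
  have hd := sob_dsw hs
  have ha1 := ha.sub_const_mul hR α
  have ha0 := ha1.sub_const_mul hd γ
  have hz1 : a y - α * rsw s y - γ * dsw s y = 0 := by rw [e1, e2]; ring
  have hz2 : a (-y) - α * rsw s (-y) - γ * dsw s (-y) = 0 := by
    rw [rsw_neg, dsw_neg, mul_neg, e1, e2]; ring
  have h1 := le_bl_of_zeros hs hy ha0 hz1 hz2
  rw [← hk] at h1 ⊢
  have hRR : bl s k (rsw s) (drsw s) (rsw s) (drsw s) = -N := by
    rw [bl_eq_integral s k hR hR (sob_drsw hs) (hk ▸ linearized_rsw hs), hN]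
    have : ∀ x, rsw s x * (-2 * sw s x) = -2 * (rsw s x * sw s x) := fun x => by ring
    simp_rw [this]
    rw [integral_const_mul, integral_rsw_mul_sw hs]; ring
  have haR : bl s k a a' (rsw s) (drsw s) = -2 * σ := by
    rw [bl_eq_integral s k ha hR (sob_drsw hs) (hk ▸ linearized_rsw hs)]
    have : ∀ x, a x * (-2 * sw s x) = -2 * (a x * sw s x) := fun x => by ring
    simp_rw [this]
    rw [integral_const_mul, hσ]
  rw [bl_sub_const_mul s k ha1 hd, bl_sub_const_mul s k ha hR,
    bl_eq_integral s k ha1 hd (sob_ddsw hs) (hk ▸ linearized_dsw s),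
    bl_eq_integral s k hd hd (sob_ddsw hs) (hk ▸ linearized_dsw s), hRR, haR] at h1
  simp only [mul_zero, integral_zero, sub_zero, add_zero] at h1
  have h3 : (∫ x, (a x - γ * dsw s x) ^ 2)
      ≤ 2 * (∫ x, (a x - α * rsw s x - γ * dsw s x) ^ 2) + 2 * α ^ 2 * ρ := by
    rw [hρe]
    refine (integral_mono (ha.sub_const_mul hd γ).integrable_sq
      ((ha0.integrable_sq.const_mul 2).add (hR.integrable_sq.const_mul (2 * α ^ 2)))
      fun x => ?_).trans_eq ?_
    · have := sq_nonneg (a x - α * rsw s x - γ * dsw s x - α * rsw s x)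
      simp only [Pi.add_apply]
      linarith
    · rw [← integral_const_mul, ← integral_const_mul]
      exact integral_add (ha0.integrable_sq.const_mul _) (hR.integrable_sq.const_mul _)
  have h4 := ha.integral_sub_const_mul_sq hd γ
  rw [← hτ] at h4
  refine coercivity_arith (X := ∫ x, (a x - γ * dsw s x) ^ 2) hN0 ht hρ hM0 hM
    (integral_nonneg fun _ => sq_nonneg _) ?_ h3 h4
  linarith

/-- Coercivity of the linearization at the soliton. -/
theorem exists_coercive (hs2 : s < 2) : ∃ c C : ℝ, 0 < c ∧ 0 ≤ C ∧ ∀ a a' b b' : ℝ → ℝ, Sob a a' →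
    Sob b b' → c * ((∫ x, a x ^ 2) + ∫ x, b x ^ 2) ≤ bl s ((s + 1) * (2 * s + 1)) a a' a a'
      + bl s (s + 1) b b' b b'
      + C * ((∫ x, a x * sw s x) ^ 2 + (∫ x, a x * dsw s x) ^ 2 + (∫ x, b x * sw s x) ^ 2) := by
  obtain ⟨c, C, hc, hC, h⟩ := exists_le_bl_plus hs hs2
  have hm := m0_pos hs
  refine ⟨min c 1, C + (m0 s)⁻¹, by positivity, by positivity, fun a a' b b' ha hb => ?_⟩
  have h1 := h a a' ha
  have h2 := sub_le_bl_minus hs hb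
  have hA : 0 ≤ ∫ x, a x ^ 2 := integral_nonneg fun _ => sq_nonneg _
  have hB : 0 ≤ ∫ x, b x ^ 2 := integral_nonneg fun _ => sq_nonneg _
  have h3 : min c 1 * ∫ x, a x ^ 2 ≤ c * ∫ x, a x ^ 2 := by gcongr; exact min_le_left _ _
  have h4 : min c 1 * ∫ x, b x ^ 2 ≤ 1 * ∫ x, b x ^ 2 := by gcongr; exact min_le_right _ _
  set σ := ∫ x, a x * sw s x
  set τ := ∫ x, a x * dsw s x
  set ϑ := ∫ x, b x * sw s x
  have h5 : (C + (m0 s)⁻¹) * (σ ^ 2 + τ ^ 2 + ϑ ^ 2) = C * (σ ^ 2 + τ ^ 2) + ϑ ^ 2 / m0 s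
      + (C * ϑ ^ 2 + (m0 s)⁻¹ * (σ ^ 2 + τ ^ 2)) := by
    field_simp; ring
  have h6 : 0 ≤ C * ϑ ^ 2 + (m0 s)⁻¹ * (σ ^ 2 + τ ^ 2) := by positivity
  rw [h5]
  linarith

end

/-! ### Stability of the soliton through a first order factorization -/

/-- `v` is continuously differentiable with derivative `v'`, both are square integrable, and `v`
vanishes at infinity. -/
structure CSob (v v' : ℝ → ℂ) : Prop where
  deriv : ∀ x, HasDerivAt v (v' x) x
  cont : Continuous v'
  memLp : MemLp v 2
  memLp' : MemLp v' 2
  tendsto : Tendsto v (cocompact ℝ) (𝓝 0)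

namespace CSob

variable {v v' : ℝ → ℂ}

theorem continuous (h : CSob v v') : Continuous v :=
  continuous_iff_continuousAt.2 fun x => (h.deriv x).continuousAt

theorem integrable_sq (h : CSob v v') : Integrable fun x => ‖v x‖ ^ 2 :=
  (memLp_two_iff_integrable_sq_norm h.memLp.1).1 h.memLp

theorem integrable_deriv_sq (h : CSob v v') : Integrable fun x => ‖v' x‖ ^ 2 :=
  (memLp_two_iff_integrable_sq_norm h.memLp'.1).1 h.memLp'

theorem const_mul (h : CSob v v') (c : ℂ) : CSob (fun x => c * v x) fun x => c * v' x where
  deriv x := (h.deriv x).const_mul c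
  cont := continuous_const.mul h.cont
  memLp := h.memLp.const_mul c
  memLp' := h.memLp'.const_mul c
  tendsto := by simpa using h.tendsto.const_mul c

theorem comp_add (h : CSob v v') (y : ℝ) : CSob (fun x => v (x + y)) fun x => v' (x + y) where
  deriv x := (h.deriv (x + y)).comp_add_const x y
  cont := h.cont.comp (continuous_add_const y)
  memLp := h.memLp.comp_measurePreserving (measurePreserving_add_right volume y)
  memLp' := h.memLp'.comp_measurePreserving (measurePreserving_add_right volume y)
  tendsto := h.tendsto.comp (Homeomorph.addRight y).isClosedEmbedding.tendsto_cocompact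

theorem comp_neg (h : CSob v v') : CSob (fun x => v (-x)) fun x => -v' (-x) where
  deriv x := by
    have h1 : HasDerivAt (v ∘ Neg.neg) (-v' (-x)) x := by
      simpa using (h.deriv (-x)).scomp x (hasDerivAt_neg x)
    exact h1
  cont := (h.cont.comp continuous_neg).neg
  memLp := h.memLp.comp_measurePreserving (Measure.measurePreserving_neg volume)
  memLp' := (h.memLp'.comp_measurePreserving (Measure.measurePreserving_neg volume)).neg
  tendsto := h.tendsto.comp (Homeomorph.neg ℝ).isClosedEmbedding.tendsto_cocompact

end CSob

theorem csob_sw {s : ℝ} (hs : 1 < s) :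
    CSob (fun x => (sw s x : ℂ)) fun x => (dsw s x : ℂ) where
  deriv x := (hasDerivAt_sw (by linarith) x).ofReal_comp
  cont := Complex.continuous_ofReal.comp (continuous_dsw (by linarith))
  memLp := (dec_sw hs).memLp_ofReal (continuous_sw (by linarith))
  memLp' := (dec_dsw hs).memLp_ofReal (continuous_dsw (by linarith))
  tendsto := by
    have := (dec_sw hs).tendsto
    exact (Complex.continuous_ofReal.tendsto' 0 0 Complex.ofReal_zero).comp this

/-- The logarithmic decay rate of a soliton profile of height `M`, at a point where its square
is `n`, relative to the rate `M ^ s` at infinity. -/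
noncomputable def rate (s M n : ℝ) : ℝ := √(1 - (n / M ^ 2) ^ s)

section
variable {s M : ℝ}

theorem continuous_rate (hs : 0 < s) (M : ℝ) : Continuous (rate s M) :=
  Real.continuous_sqrt.comp (continuous_const.sub
    ((continuous_id.div_const _).rpow_const fun _ => Or.inr hs.le))

theorem rate_nonneg (s M n : ℝ) : 0 ≤ rate s M n := Real.sqrt_nonneg _

theorem rate_le_one {n : ℝ} (hn : 0 ≤ n) : rate s M n ≤ 1 := by
  have : 0 ≤ (n / M ^ 2) ^ s := by positivity
  rw [rate, Real.sqrt_le_left zero_le_one]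
  linarith

theorem rate_anti (hs : 0 < s) {n n' : ℝ} (hn : 0 ≤ n) (h : n ≤ n') :
    rate s M n' ≤ rate s M n := by
  rw [rate, rate]; gcongr

theorem integral_rate (hM : 0 < M) :
    ∫ n in (0:ℝ)..M ^ 2, rate s M n = M ^ 2 * ∫ n in (0:ℝ)..1, rate s 1 n := by
  have h := intervalIntegral.integral_comp_div (a := 0) (b := M ^ 2)
    (fun y => √(1 - y ^ s)) (pow_pos hM 2).ne'
  rw [zero_div, div_self (pow_pos hM 2).ne'] at h
  simpa [rate] using h

/-- The defect of `v` in the first order equation satisfied by a soliton profile of height `M`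
on the right half line. -/
noncomputable def defect (s M : ℝ) (v v' : ℝ → ℂ) (x : ℝ) : ℂ :=
  v' x + ((M ^ s * rate s M (‖v x‖ ^ 2) : ℝ) : ℂ) * v x

variable {v v' : ℝ → ℂ}

theorem CSob.integrable_rpow (hs : 0 < s) (hv : CSob v v') (hmax : ∀ x, ‖v x‖ ≤ M) :
    Integrable fun x => ‖v x‖ ^ (2 * s + 2) := by
  refine (hv.integrable_sq.const_mul (M ^ (2 * s))).mono'
    ((hv.continuous.norm.rpow_const fun _ => Or.inr (by positivity)).aestronglyMeasurable)
    (Eventually.of_forall fun x => ?_)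
  rw [Real.norm_of_nonneg (by positivity)]
  have : ‖v x‖ ^ (2 * s + 2) = ‖v x‖ ^ (2 * s) * ‖v x‖ ^ 2 := by
    rw [Real.rpow_add' (norm_nonneg _) (by positivity)]
    norm_num
  rw [this]
  gcongr
  exact hmax x

/-- The rate is chosen so that M^(2s) rate² |v|² = M^(2s)|v|² - |v|^(2s+2). What remains of the
square is a cross term that is the derivative of a function of |v|². -/
theorem norm_defect_sq (hs : 0 < s) (hM : 0 < M) {x : ℝ} (hmax : ‖v x‖ ≤ M) :
    ‖defect s M v v' x‖ ^ 2 = (‖v' x‖ ^ 2 + M ^ (2 * s) * ‖v x‖ ^ 2 - ‖v x‖ ^ (2 * s + 2))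
      + M ^ s * (rate s M (‖v x‖ ^ 2) * (2 * inner ℝ (v x) (v' x))) := by
  have h1 : rate s M (‖v x‖ ^ 2) ^ 2 = 1 - (‖v x‖ ^ 2 / M ^ 2) ^ s := by
    rw [rate, Real.sq_sqrt]
    have : ‖v x‖ ^ 2 / M ^ 2 ≤ 1 := by rw [div_le_one (by positivity)]; gcongr
    linarith [Real.rpow_le_one (by positivity) this hs.le]
  have h2 : (‖v x‖ ^ 2 / M ^ 2) ^ s = ‖v x‖ ^ (2 * s) / M ^ (2 * s) := by
    rw [Real.div_rpow (by positivity) (by positivity), ← Real.rpow_natCast, ← Real.rpow_natCast,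
      ← Real.rpow_mul (norm_nonneg _), ← Real.rpow_mul hM.le]
    norm_num
  have h3 : ‖v x‖ ^ (2 * s + 2) = ‖v x‖ ^ (2 * s) * ‖v x‖ ^ 2 := by
    rw [Real.rpow_add' (norm_nonneg _) (by positivity)]
    norm_num
  have h4 : (M ^ s) ^ 2 = M ^ (2 * s) := by
    rw [← Real.rpow_natCast, ← Real.rpow_mul hM.le]; norm_num [mul_comm]
  have h5 : 0 < M ^ (2 * s) := by positivity
  rw [defect, ← Complex.real_smul, norm_add_sq_real, norm_smul, inner_smul_right, mul_pow,
    Real.norm_eq_abs, sq_abs, mul_pow, h1, h2, h3, h4, real_inner_comm]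
  field_simp
  ring

theorem CSob.continuous_defect (hs : 0 < s) (hv : CSob v v') (M : ℝ) :
    Continuous (defect s M v v') :=
  hv.cont.add ((Complex.continuous_ofReal.comp (continuous_const.mul
    ((continuous_rate hs M).comp (hv.continuous.norm.pow 2)))).mul hv.continuous)

theorem CSob.integrable_rate_mul (hs : 0 < s) (hv : CSob v v') (M : ℝ) :
    Integrable fun x => rate s M (‖v x‖ ^ 2) * (2 * inner ℝ (v x) (v' x)) := by
  refine (hv.integrable_sq.add hv.integrable_deriv_sq).mono'
    (((continuous_rate hs M).comp (hv.continuous.norm.pow 2)).mul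
      (continuous_const.mul (hv.continuous.inner hv.cont))).aestronglyMeasurable
    (Eventually.of_forall fun x => ?_)
  rw [norm_mul, Real.norm_of_nonneg (rate_nonneg _ _ _), norm_mul, Real.norm_ofNat]
  have h1 := norm_inner_le_norm (𝕜 := ℝ) (v x) (v' x)
  have h2 := rate_le_one (s := s) (M := M) (sq_nonneg ‖v x‖)
  have h3 := two_mul_le_add_sq ‖v x‖ ‖v' x‖
  calc rate s M (‖v x‖ ^ 2) * (2 * ‖inner ℝ (v x) (v' x)‖)
      ≤ 1 * (2 * (‖v x‖ * ‖v' x‖)) := by gcongr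
    _ ≤ _ := by simp only [Pi.add_apply]; linarith

theorem CSob.integrable_energy (hs : 0 < s) (hv : CSob v v') (hmax : ∀ x, ‖v x‖ ≤ M) :
    Integrable fun x => ‖v' x‖ ^ 2 + M ^ (2 * s) * ‖v x‖ ^ 2 - ‖v x‖ ^ (2 * s + 2) :=
  (hv.integrable_deriv_sq.add (hv.integrable_sq.const_mul _)).sub (hv.integrable_rpow hs hmax)

theorem CSob.integrable_defect_sq (hs : 0 < s) (hM : 0 < M) (hv : CSob v v')
    (hmax : ∀ x, ‖v x‖ ≤ M) : Integrable fun x => ‖defect s M v v' x‖ ^ 2 := by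
  simp_rw [fun x => norm_defect_sq (v' := v') hs hM (hmax x)]
  exact (hv.integrable_energy hs hmax).add ((hv.integrable_rate_mul hs M).const_mul _)

/-- The cross term integrates to its boundary value at 0, where |v| = M. Rescaling the integral of
the rate produces the power M^(s+2). -/
theorem CSob.integral_Ioi_defect (hs : 0 < s) (hM : 0 < M) (hv : CSob v v')
    (hmax : ∀ x, ‖v x‖ ≤ M) (h0 : ‖v 0‖ = M) :
    ∫ x in Ioi (0:ℝ), ‖defect s M v v' x‖ ^ 2 =
      (∫ x in Ioi (0:ℝ), (‖v' x‖ ^ 2 + M ^ (2 * s) * ‖v x‖ ^ 2 - ‖v x‖ ^ (2 * s + 2)))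
      - M ^ (s + 2) * ∫ n in (0:ℝ)..1, rate s 1 n := by
  simp_rw [fun x => norm_defect_sq (v' := v') hs hM (hmax x)]
  rw [integral_add (hv.integrable_energy hs hmax).integrableOn
    ((hv.integrable_rate_mul hs M).const_mul _).integrableOn, integral_const_mul]
  have hd : ∀ x, HasDerivAt (fun x => ∫ n in (0:ℝ)..‖v x‖ ^ 2, rate s M n)
      (rate s M (‖v x‖ ^ 2) * (2 * inner ℝ (v x) (v' x))) x := fun x =>
    HasDerivAt.comp (h₂ := fun y => ∫ n in (0:ℝ)..y, rate s M n) x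
      ((continuous_rate hs M).integral_hasStrictDerivAt 0 (‖v x‖ ^ 2)).hasDerivAt
      (hv.deriv x).norm_sq
  have hlim : Tendsto (fun x => ∫ n in (0:ℝ)..‖v x‖ ^ 2, rate s M n) atTop (𝓝 0) := by
    have h1 : Tendsto (fun x => ‖v x‖ ^ 2) atTop (𝓝 0) := by
      simpa using (hv.tendsto.mono_left atTop_le_cocompact).norm.pow 2
    have h2 : Tendsto (fun y => ∫ n in (0:ℝ)..y, rate s M n) (𝓝 0) (𝓝 0) := by
      have := ((continuous_rate hs M).integral_hasStrictDerivAt 0 0).hasDerivAt.continuousAt.tendsto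
      simpa using this
    exact h2.comp h1
  rw [integral_Ioi_of_hasDerivAt_of_tendsto (hd 0).continuousAt.continuousWithinAt
    (fun x _ => hd x) (hv.integrable_rate_mul hs M).integrableOn hlim, h0, integral_rate hM,
    Real.rpow_add hM]
  norm_num
  ring

theorem integral_eq_integral_Ioi_add_comp_neg {f : ℝ → ℝ} (hf : Integrable f) :
    ∫ x, f x = (∫ x in Ioi (0:ℝ), f x) + ∫ x in Ioi (0:ℝ), f (-x) := by
  rw [integral_comp_neg_Ioi, neg_zero, add_comm,
    intervalIntegral.integral_Iic_add_Ioi hf.integrableOn hf.integrableOn]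

/-- Reflection treats the left half line with the same decaying profile. The identity bounds the
action from below by the height alone, with the defects as remainder. -/
theorem CSob.integral_defect (hs : 0 < s) (hM : 0 < M) (hv : CSob v v')
    (hmax : ∀ x, ‖v x‖ ≤ M) (h0 : ‖v 0‖ = M) :
    (∫ x in Ioi (0:ℝ), ‖defect s M v v' x‖ ^ 2)
      + (∫ x in Ioi (0:ℝ), ‖defect s M (fun x => v (-x)) (fun x => -v' (-x)) x‖ ^ 2) =
    (∫ x, ‖v' x‖ ^ 2) + M ^ (2 * s) * (∫ x, ‖v x‖ ^ 2) - (∫ x, ‖v x‖ ^ (2 * s + 2))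
      - 2 * (M ^ (s + 2) * ∫ n in (0:ℝ)..1, rate s 1 n) := by
  have h := integral_eq_integral_Ioi_add_comp_neg (hv.integrable_energy hs hmax)
  have h1 : (∫ x, (‖v' x‖ ^ 2 + M ^ (2 * s) * ‖v x‖ ^ 2 - ‖v x‖ ^ (2 * s + 2)))
      = (∫ x, ‖v' x‖ ^ 2) + M ^ (2 * s) * (∫ x, ‖v x‖ ^ 2) - (∫ x, ‖v x‖ ^ (2 * s + 2)) := by
    have := integral_linear_comb hv.integrable_deriv_sq hv.integrable_sq
      (hv.integrable_rpow hs hmax) 1 (M ^ (2 * s)) (-1)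
    simp_rw [one_mul, neg_one_mul, ← sub_eq_add_neg] at this
    exact this
  rw [hv.integral_Ioi_defect hs hM hmax h0, hv.comp_neg.integral_Ioi_defect hs hM
    (fun x => hmax _) (by simpa using h0), ← h1, h]
  simp only [norm_neg]
  ring

theorem st_nonneg (hs : 0 < s) {x : ℝ} (hx : 0 ≤ x) : 0 ≤ st s x := by
  rw [st, Real.tanh_eq_sinh_div_cosh]
  have : 0 ≤ Real.sinh (s * x) := Real.sinh_nonneg_iff.2 (by positivity)
  have := Real.cosh_pos (s * x)
  positivity

theorem st_pos (hs : 0 < s) {x : ℝ} (hx : 0 < x) : 0 < st s x := by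
  rw [st, Real.tanh_eq_sinh_div_cosh]
  have : 0 < Real.sinh (s * x) := Real.sinh_pos_iff.2 (by positivity)
  have := Real.cosh_pos (s * x)
  positivity

theorem rate_sw (hs : 0 < s) (x : ℝ) : rate s 1 (sw s x ^ 2) = |st s x| := by
  have : (sw s x ^ 2) ^ s = 1 - st s x ^ 2 := by
    rw [← sw_rpow hs, ← Real.rpow_natCast, ← Real.rpow_mul (sw_pos _ _).le]; norm_num
  rw [rate, one_pow, div_one, this, sub_sub_cancel, Real.sqrt_sq_eq_abs]

theorem defect_sw (hs : 0 < s) {x : ℝ} (hx : 0 ≤ x) :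
    defect s 1 (fun x => (sw s x : ℂ)) (fun x => (dsw s x : ℂ)) x = 0 := by
  rw [defect, Complex.norm_real, Real.norm_eq_abs, sq_abs, rate_sw hs,
    abs_of_nonneg (st_nonneg hs hx), Real.one_rpow, one_mul, dsw]
  push_cast; ring

/-- The soliton has no defect on either half line, so `CSob.integral_defect` with M = 1 evaluates
the integral as half of t0 + m0 - p0 = 2 t0. -/
theorem integral_rate_one (hs : 1 < s) : ∫ n in (0:ℝ)..1, rate s 1 n = t0 s := by
  have hs0 : 0 < s := by linarith
  have h := (csob_sw hs).integral_defect (M := 1) hs0 one_pos (fun x => by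
    rw [Complex.norm_real, Real.norm_of_nonneg (sw_pos _ _).le]; exact sw_le_one hs0 x)
    (by rw [sw_zero]; simp)
  have e1 : ∀ x ∈ Ioi (0:ℝ), ‖defect s 1 (fun x => (sw s x : ℂ)) (fun x => (dsw s x : ℂ)) x‖ ^ 2
      = 0 := fun x hx => by rw [defect_sw hs0 (mem_Ioi.1 hx).le]; simp
  have e2 : ∀ x ∈ Ioi (0:ℝ), ‖defect s 1 (fun x => (sw s (-x) : ℂ)) (fun x => -(dsw s (-x) : ℂ)) x‖
      ^ 2 = 0 := fun x hx => by
    have : (fun x => -(dsw s (-x) : ℂ)) = fun x => (dsw s x : ℂ) := by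
      ext x; rw [dsw_neg]; push_cast; ring
    simp_rw [sw_neg]
    rw [this, defect_sw hs0 (mem_Ioi.1 hx).le]; simp
  rw [setIntegral_congr_fun measurableSet_Ioi e1, setIntegral_congr_fun measurableSet_Ioi e2] at h
  simp only [Complex.norm_real, Real.norm_eq_abs, sq_abs, Real.one_rpow, one_mul,
    abs_of_pos (sw_pos s _)] at h
  have h1 : (∫ x, dsw s x ^ 2) = t0 s := rfl
  have h2 : (∫ x, sw s x ^ 2) = m0 s := rfl
  have h3 : (∫ x, sw s x ^ (2 * s + 2)) = p0 s := rfl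
  rw [h1, h2, h3] at h
  simp only [integral_zero] at h
  have := t0_eq hs
  linarith

/-- The energy of a function of height `M` and mass at most `m0`. -/
theorem height_near_one (hs : 1 < s) (hs2 : s < 2) {κ : ℝ} (hκ : 0 < κ) : ∃ η > 0, ∀ M > 0,
    2 * M ^ (s + 2) - (1 + 2 / s) * M ^ (2 * s) ≤ 2 - (1 + 2 / s) + η → |M - 1| ≤ κ := by
  obtain ⟨k, hk⟩ : ∃ k : ℝ → ℝ, k = fun M => 2 * M ^ (s + 2) - (1 + 2 / s) * M ^ (2 * s) :=
    ⟨_, rfl⟩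
  have hk1 : k 1 = 2 - (1 + 2 / s) := by simp [hk]
  have hcont : Continuous k := by
    rw [hk]
    exact (continuous_const.mul (continuous_id.rpow_const fun _ => Or.inr (by linarith))).sub
      (continuous_const.mul (continuous_id.rpow_const fun _ => Or.inr (by linarith)))
  -- The sign of the derivative is that of M^(2-s) - 1, so M = 1 is the strict global minimum on the
  -- positive axis.
  have hd : ∀ M : ℝ, 0 < M → deriv k M
      = 2 * (s + 2) * M ^ (2 * s - 1) * (M ^ (2 - s) - 1) := by
    intro M hM
    have h1 : HasDerivAt k (2 * ((s + 2) * M ^ (s + 2 - 1))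
        - (1 + 2 / s) * ((2 * s) * M ^ (2 * s - 1))) M := by
      rw [hk]
      exact ((Real.hasDerivAt_rpow_const (Or.inl hM.ne')).const_mul 2).sub
        ((Real.hasDerivAt_rpow_const (Or.inl hM.ne')).const_mul _)
    rw [h1.deriv]
    have : M ^ (s + 2 - 1) = M ^ (2 * s - 1) * M ^ (2 - s) := by
      rw [← Real.rpow_add hM]; ring_nf
    rw [this]; field_simp
  have hanti : StrictAntiOn k (Icc 0 1) := by
    refine strictAntiOn_of_deriv_neg (convex_Icc _ _) hcont.continuousOn fun M hM => ?_
    rw [interior_Icc] at hM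
    rw [hd M hM.1]
    have h1 : M ^ (2 - s) < 1 := Real.rpow_lt_one hM.1.le hM.2 (by linarith)
    have h2 : 0 < M ^ (2 * s - 1) := Real.rpow_pos_of_pos hM.1 _
    exact mul_neg_of_pos_of_neg (by positivity) (by linarith)
  have hmono : StrictMonoOn k (Ici 1) := by
    refine strictMonoOn_of_deriv_pos (convex_Ici _) hcont.continuousOn fun M hM => ?_
    rw [interior_Ici, mem_Ioi] at hM
    rw [hd M (by linarith)]
    have h1 : 1 < M ^ (2 - s) := Real.one_lt_rpow hM (by linarith)
    have h2 : 0 < M ^ (2 * s - 1) := Real.rpow_pos_of_pos (by linarith) _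
    exact mul_pos (by positivity) (by linarith)
  obtain ⟨κ', hκ', hle, hlt⟩ : ∃ κ' > 0, κ' ≤ κ ∧ κ' < 1 :=
    ⟨min κ (1/2), by positivity, min_le_left _ _, (min_le_right _ _).trans_lt (by norm_num)⟩
  have h1 : k 1 < k (1 - κ') := hanti ⟨by linarith, by linarith⟩ ⟨by linarith, le_rfl⟩ (by linarith)
  have h2 : k 1 < k (1 + κ') := hmono (mem_Ici.2 le_rfl) (mem_Ici.2 (by linarith)) (by linarith)
  refine ⟨(min (k (1 - κ')) (k (1 + κ')) - k 1) / 2, half_pos (sub_pos.2 (lt_min h1 h2)), ?_⟩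
  intro M hM h
  have h' : k M ≤ k 1 + (min (k (1 - κ')) (k (1 + κ')) - k 1) / 2 := by
    rw [hk1]; simpa [hk] using h
  have h3 := min_le_left (k (1 - κ')) (k (1 + κ'))
  have h4 := min_le_right (k (1 - κ')) (k (1 + κ'))
  have h5 := lt_min h1 h2
  refine (abs_le.2 ⟨?_, ?_⟩ : |M - 1| ≤ κ').trans hle
  · by_contra! hc
    have := hanti ⟨hM.le, by linarith⟩ ⟨by linarith, by linarith⟩ (show M < 1 - κ' by linarith)
    linarith
  · by_contra! hc
    have := hmono (mem_Ici.2 (by linarith)) (mem_Ici.2 (by linarith)) (show 1 + κ' < M by linarith)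
    linarith

end

section
variable {s : ℝ}

theorem sw_sub_le (hs : 0 < s) {x y : ℝ} (h : x ≤ y) : sw s x - sw s y ≤ y - x := by
  have h1 := (convex_univ (𝕜 := ℝ) (E := ℝ)).norm_image_sub_le_of_norm_hasDerivWithin_le (C := 1)
    (fun z _ => (hasDerivAt_sw hs z).hasDerivWithinAt) (fun z _ => by
      rw [norm_mul, norm_neg, Real.norm_eq_abs, Real.norm_of_nonneg (sw_pos s z).le]
      exact mul_le_one₀ (abs_st_le s z) (sw_pos s z).le (sw_le_one hs z)) (mem_univ x) (mem_univ y)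
  rw [one_mul, Real.norm_eq_abs, Real.norm_of_nonneg (sub_nonneg.2 h)] at h1
  linarith [neg_abs_le (sw s y - sw s x)]

theorem sw_lt_one (hs : 0 < s) {x : ℝ} (hx : 0 < x) : sw s x < 1 := by
  have h := sw_rpow hs x
  have h1 := st_pos hs hx
  by_contra! hc
  have : sw s x = 1 := le_antisymm (sw_le_one hs x) hc
  rw [this, Real.one_rpow] at h
  nlinarith

/-- The accelerated soliton w((1+θ)x + θ) decays strictly faster than the profile equation
prescribes when ρ = 0 and M = 1. The shift by θ keeps its argument positive, so that tanh does not
vanish at x = 0. Compactness of [0, L] extends the strict inequality to nearby ρ and M. -/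
theorem exists_barrier_speed (hs : 0 < s) (L : ℝ) {θ : ℝ} (hθ : 0 < θ) : ∃ ε > 0, ∀ ρ M : ℝ,
    |ρ| < ε → |M - 1| < ε → ∀ x ∈ Icc 0 L,
      M ^ s * (max (sw s ((1 + θ) * x + θ) - ρ) 0) *
        rate s M (max (sw s ((1 + θ) * x + θ) - ρ) 0 ^ 2)
      < (1 + θ) * (st s ((1 + θ) * x + θ) * sw s ((1 + θ) * x + θ)) := by
  have key := (isCompact_Icc (a := (0:ℝ)) (b := L)).eventually_forall_of_forall_eventually
    (x₀ := ((0:ℝ), (1:ℝ))) (P := fun z x =>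
      z.2 ^ s * (max (sw s ((1 + θ) * x + θ) - z.1) 0) *
        rate s z.2 (max (sw s ((1 + θ) * x + θ) - z.1) 0 ^ 2)
      < (1 + θ) * (st s ((1 + θ) * x + θ) * sw s ((1 + θ) * x + θ))) ?_
  · obtain ⟨ε, hε, h⟩ := Metric.eventually_nhds_iff.1 key
    refine ⟨ε, hε, fun ρ M h1 h2 => h (y := (ρ, M)) ?_⟩
    rw [Prod.dist_eq, max_lt_iff, Real.dist_eq, Real.dist_eq, sub_zero]
    exact ⟨h1, h2⟩
  · intro x hx
    have hy : 0 < (1 + θ) * x + θ := by have := hx.1; positivity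
    have c1 : Continuous fun z : (ℝ × ℝ) × ℝ => sw s ((1 + θ) * z.2 + θ) :=
      (continuous_sw hs).comp (by fun_prop)
    have c2 : Continuous fun z : (ℝ × ℝ) × ℝ => st s ((1 + θ) * z.2 + θ) :=
      (continuous_st s).comp (by fun_prop)
    have c3 : Continuous fun z : (ℝ × ℝ) × ℝ => max (sw s ((1 + θ) * z.2 + θ) - z.1.1) 0 :=
      (c1.sub (by fun_prop)).max continuous_const
    have c4 : ContinuousAt (fun z : (ℝ × ℝ) × ℝ => z.1.2 ^ s) ((0, 1), x) :=
      ContinuousAt.rpow_const (by fun_prop) (Or.inr hs.le)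
    have c5 : ContinuousAt (fun z : (ℝ × ℝ) × ℝ =>
        rate s z.1.2 (max (sw s ((1 + θ) * z.2 + θ) - z.1.1) 0 ^ 2)) ((0, 1), x) := by
      refine Real.continuous_sqrt.continuousAt.comp (continuousAt_const.sub
        (ContinuousAt.rpow_const (ContinuousAt.div (c3.pow 2).continuousAt (by fun_prop) ?_)
          (Or.inr hs.le)))
      norm_num
    refine ((c4.mul c3.continuousAt).mul c5).eventually_lt
      (continuous_const.mul (c2.mul c1)).continuousAt ?_
    have h1 := sw_pos s ((1 + θ) * x + θ)
    have h2 := st_pos hs hy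
    simp only [Pi.mul_apply, sub_zero, max_eq_left h1.le, Real.one_rpow, one_mul]
    rw [rate_sw hs, abs_of_pos h2]
    have := mul_pos h2 h1
    nlinarith

/-- Re v plus the accumulated defect cannot cross the accelerated soliton from above. A barrier
replaces a Grönwall estimate because the rate has a square root singularity at maximal height, which
is where the comparison starts. -/
theorem exists_barrier (hs : 0 < s) {L κ : ℝ} (hL : 0 < L) (hκ : 0 < κ) : ∃ η > 0, ∀ M,
    |M - 1| ≤ η → ∀ v v' : ℝ → ℂ, CSob v v' → (∀ x, ‖v x‖ ≤ M) → v 0 = M →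
      (∫ x in Ioi (0:ℝ), ‖defect s M v v' x‖ ^ 2) ≤ η → ∀ x ∈ Icc 0 L,
        sw s x - κ ≤ (v x).re := by
  obtain ⟨θ, hθ, hθL⟩ : ∃ θ > 0, θ * (L + 1) = κ / 2 :=
    ⟨κ / 2 / (L + 1), by positivity, by field_simp⟩
  obtain ⟨ε, hε, hb⟩ := exists_barrier_speed hs L hθ
  have hsθ := sw_lt_one hs hθ
  obtain ⟨ε₁, hε₁, h1ε, h1κ⟩ : ∃ ε₁ > 0, ε₁ < ε ∧ ε₁ ≤ κ / 2 :=
    ⟨min (ε / 2) (κ / 2), by positivity, (min_le_left _ _).trans_lt (by linarith),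
      min_le_right _ _⟩
  refine ⟨min (min (ε / 2) (1 - sw s θ)) (min (ε₁ ^ 2 / L) (1 / 2)), ?_, ?_⟩
  · have : 0 < 1 - sw s θ := by linarith
    positivity
  intro M hMη v v' hv hmax h0 hdef
  have hM1 : |M - 1| < ε := by
    refine hMη.trans_lt ((min_le_left _ _).trans_lt ((min_le_left _ _).trans_lt ?_)); linarith
  have hM2 : |M - 1| ≤ 1 - sw s θ := hMη.trans ((min_le_left _ _).trans (min_le_right _ _))
  have hM3 : |M - 1| ≤ 1 / 2 := hMη.trans ((min_le_right _ _).trans (min_le_right _ _))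
  have hd1 : (∫ x in Ioi (0:ℝ), ‖defect s M v v' x‖ ^ 2) ≤ ε₁ ^ 2 / L :=
    hdef.trans ((min_le_right _ _).trans (min_le_left _ _))
  have hM : 0 < M := by linarith [(abs_le.1 hM3).1]
  have hrc := hv.continuous_defect hs M
  -- The accumulated defect; its derivative compensates the error in the first order equation for v.
  obtain ⟨ρ, hρ⟩ : ∃ ρ : ℝ → ℝ, ρ = fun x => ∫ y in (0:ℝ)..x, ‖defect s M v v' y‖ := ⟨_, rfl⟩
  have hρd : ∀ x, HasDerivAt ρ ‖defect s M v v' x‖ x := fun x => by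
    rw [hρ]; exact (hrc.norm.integral_hasStrictDerivAt 0 x).hasDerivAt
  have hρ0 : ∀ x, 0 ≤ x → 0 ≤ ρ x := fun x hx => by
    rw [hρ]; exact intervalIntegral.integral_nonneg hx fun _ _ => norm_nonneg _
  have hρε : ∀ x ∈ Icc 0 L, ρ x ≤ ε₁ := by
    intro x hx
    obtain ⟨a, ha, haL⟩ : ∃ a > 0, a * L = ε₁ / 2 := ⟨ε₁ / 2 / L, by positivity, by field_simp⟩
    have i2 : IntervalIntegrable (fun y => ‖defect s M v v' y‖ ^ 2) volume 0 x :=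
      (hrc.norm.pow 2).intervalIntegrable _ _
    have h2 : ∫ y in (0:ℝ)..x, ‖defect s M v v' y‖ ^ 2 ≤ ε₁ ^ 2 / L := by
      rw [intervalIntegral.integral_of_le hx.1]
      exact (setIntegral_mono_set (hv.integrable_defect_sq hs hM hmax).integrableOn
        (Eventually.of_forall fun _ => sq_nonneg _) Ioc_subset_Ioi_self.eventuallyLE).trans hd1
    calc ρ x = ∫ y in (0:ℝ)..x, ‖defect s M v v' y‖ := by rw [hρ]
      _ ≤ ∫ y in (0:ℝ)..x, (a + (4 * a)⁻¹ * ‖defect s M v v' y‖ ^ 2) := by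
          refine intervalIntegral.integral_mono_on hx.1 (hrc.norm.intervalIntegrable _ _)
            (intervalIntegrable_const.add (i2.const_mul _)) fun y _ => ?_
          have : 0 ≤ (4 * a)⁻¹ * (‖defect s M v v' y‖ - 2 * a) ^ 2 := by positivity
          have e : (4 * a)⁻¹ * (‖defect s M v v' y‖ - 2 * a) ^ 2
            = a + (4 * a)⁻¹ * ‖defect s M v v' y‖ ^ 2 - ‖defect s M v v' y‖ := by
              field_simp; ring
          linarith
      _ = a * x + (4 * a)⁻¹ * ∫ y in (0:ℝ)..x, ‖defect s M v v' y‖ ^ 2 := by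
          rw [intervalIntegral.integral_add intervalIntegrable_const (i2.const_mul _),
            intervalIntegral.integral_const_mul, intervalIntegral.integral_const]
          simp [mul_comm]
      _ ≤ a * L + (4 * a)⁻¹ * (ε₁ ^ 2 / L) := by gcongr; exact hx.2
      _ = ε₁ := by
          have : L = ε₁ / (2 * a) := by field_simp; linarith
          rw [haL, this]; field_simp; norm_num
  have hre : ∀ x, HasDerivAt (fun x => (v x).re) (v' x).re x := fun x =>
    Complex.reCLM.hasFDerivAt.comp_hasDerivAt x (hv.deriv x)
  have hbd : ∀ x, HasDerivAt (fun x => sw s ((1 + θ) * x + θ))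
      (-st s ((1 + θ) * x + θ) * sw s ((1 + θ) * x + θ) * (1 + θ)) x := fun x => by
    have h1 : HasDerivAt (fun x => (1 + θ) * x + θ) (1 + θ) x := by
      simpa using ((hasDerivAt_id x).const_mul (1 + θ)).add_const θ
    exact (hasDerivAt_sw hs _).comp x h1
  have hfd : ∀ x, HasDerivAt (fun x => (v x).re + ρ x)
      ((v' x).re + ‖defect s M v v' x‖) x := fun x => (hre x).add (hρd x)
  have hle : ∀ ⦃x⦄, x ∈ Icc 0 L → sw s ((1 + θ) * x + θ) ≤ (v x).re + ρ x := by
    refine image_le_of_deriv_right_lt_deriv_boundary'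
      (fun x _ => (hbd x).continuousAt.continuousWithinAt) (fun x _ => (hbd x).hasDerivWithinAt)
      ?_ (fun x _ => (hfd x).continuousAt.continuousWithinAt)
      (fun x _ => (hfd x).hasDerivWithinAt) fun x hx hxe => ?_
    · have : ρ 0 = 0 := by rw [hρ]; simp
      rw [this, h0, mul_zero, zero_add, add_zero, Complex.ofReal_re]
      linarith [(abs_le.1 hM2).1]
    · have hx' : x ∈ Icc 0 L := ⟨hx.1, hx.2.le⟩
      have h1 := hb (ρ x) M (by rw [abs_of_nonneg (hρ0 x hx.1)]; exact (hρε x hx').trans_lt h1ε)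
        hM1 x hx'
      have e : sw s ((1 + θ) * x + θ) - ρ x = (v x).re := by linarith
      rw [e] at h1
      have h2 : (defect s M v v' x).re
          = (v' x).re + M ^ s * rate s M (‖v x‖ ^ 2) * (v x).re := by
        rw [defect, Complex.add_re, Complex.re_ofReal_mul]
      have h3 := neg_abs_le (defect s M v v' x).re
      have h4 := Complex.abs_re_le_norm (defect s M v v' x)
      -- The rate decreases in |v|², and |v| ≥ max(Re v, 0), so replacing |v| by the positive part
      -- of Re v only increases the bound on the speed of decay.
      have h5 : M ^ s * rate s M (‖v x‖ ^ 2) * (v x).re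
          ≤ M ^ s * max (v x).re 0 * rate s M (max (v x).re 0 ^ 2) := by
        have hM' : 0 ≤ M ^ s := by positivity
        have hr := rate_nonneg s M (‖v x‖ ^ 2)
        have h6 : rate s M (‖v x‖ ^ 2) ≤ rate s M (max (v x).re 0 ^ 2) := by
          refine rate_anti hs (sq_nonneg _) ?_
          gcongr
          exact max_le (Complex.re_le_norm _) (norm_nonneg _)
        calc M ^ s * rate s M (‖v x‖ ^ 2) * (v x).re
            ≤ M ^ s * rate s M (‖v x‖ ^ 2) * max (v x).re 0 := by
              gcongr; exact le_max_left _ _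
          _ ≤ M ^ s * rate s M (max (v x).re 0 ^ 2) * max (v x).re 0 := by
              gcongr
          _ = _ := by ring
      linarith
  intro x hx
  have h1 := hle hx
  have h2 := hρε x hx
  have h3 := sw_sub_le hs (show x ≤ (1 + θ) * x + θ by nlinarith [hx.1])
  have h4 : (1 + θ) * x + θ - x ≤ θ * (L + 1) := by nlinarith [hx.2]
  linarith

theorem exists_integral_sw_tail (hs : 1 < s) {δ : ℝ} (hδ : 0 < δ) :
    ∃ L > 0, (∫ x, sw s x) - (∫ x in Ioc (-L) L, sw s x) ≤ δ := by
  have hi := (dec_sw hs).integrable (continuous_sw (by linarith))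
  have h := intervalIntegral_tendsto_integral hi tendsto_neg_atTop_atBot tendsto_id
  have h1 := (h.eventually (lt_mem_nhds (show (∫ x, sw s x) - δ < ∫ x, sw s x by linarith))).and
    (eventually_gt_atTop (0:ℝ))
  obtain ⟨L, hL, hL0⟩ := h1.exists
  refine ⟨L, hL0, ?_⟩
  rw [id, intervalIntegral.integral_of_le (by linarith)] at hL
  linarith

/-- Weighted arithmetic-geometric mean of M^(s+2) and 1, with weights making the geometric mean
M^(2s). -/
theorem height_ge (hs : 0 < s) (hs2 : s < 2) {M : ℝ} (hM : 0 < M) :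
    2 - (1 + 2 / s) ≤ 2 * M ^ (s + 2) - (1 + 2 / s) * M ^ (2 * s) := by
  have h := Real.geom_mean_le_arith_mean2_weighted (w₁ := 2 * s / (s + 2))
    (w₂ := (2 - s) / (s + 2)) (p₁ := M ^ (s + 2)) (p₂ := 1) (by positivity)
    (div_nonneg (by linarith) (by linarith)) (by positivity) zero_le_one (by field_simp; ring)
  rw [Real.one_rpow, mul_one, mul_one, ← Real.rpow_mul hM.le] at h
  have e : (s + 2) * (2 * s / (s + 2)) = 2 * s := by field_simp
  rw [e] at h
  have h1 := mul_le_mul_of_nonneg_left h (show 0 ≤ 1 + 2 / s by positivity)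
  have e1 : (1 + 2 / s) * (2 * s / (s + 2) * M ^ (s + 2) + (2 - s) / (s + 2))
      = 2 * M ^ (s + 2) + (1 + 2 / s - 2) := by field_simp; ring
  linarith

/-- Stability of the soliton, for functions whose maximum is at the origin. -/
theorem exists_stable_of_max (hs : 1 < s) (hs2 : s < 2) {δ : ℝ} (hδ : 0 < δ) : ∃ η > 0,
    ∀ v v' : ℝ → ℂ, CSob v v' → ∀ M > 0, (∀ x, ‖v x‖ ≤ M) → v 0 = M → (∫ x, ‖v x‖ ^ 2) ≤ m0 s →
      (∫ x, ‖v' x‖ ^ 2) - (∫ x, ‖v x‖ ^ (2 * s + 2)) ≤ t0 s - p0 s + η →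
        (∫ x, ‖v x - sw s x‖ ^ 2) ≤ δ := by
  have hs0 : 0 < s := by linarith
  have iw := (dec_sw hs).integrable (continuous_sw hs0)
  have hW : 0 ≤ ∫ x, sw s x := integral_nonneg fun x => (sw_pos s x).le
  obtain ⟨κ, hκ, hκW⟩ : ∃ κ > 0, 2 * κ * (∫ x, sw s x) ≤ δ / 2 := by
    refine ⟨δ / (4 * ((∫ x, sw s x) + 1)), by positivity, ?_⟩
    have : 2 * (δ / (4 * ((∫ x, sw s x) + 1))) * (∫ x, sw s x)
      = δ / 2 * ((∫ x, sw s x) / ((∫ x, sw s x) + 1)) := by field_simp; norm_num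
    rw [this]
    have : (∫ x, sw s x) / ((∫ x, sw s x) + 1) ≤ 1 := by rw [div_le_one (by positivity)]; linarith
    nlinarith
  obtain ⟨L, hL, htail⟩ := exists_integral_sw_tail hs (show 0 < δ / 12 by positivity)
  obtain ⟨η₁, hη₁, hbar⟩ := exists_barrier hs0 hL hκ
  obtain ⟨η₂, hη₂, hht⟩ := height_near_one hs hs2 (show 0 < min η₁ 1 by positivity)
  have ht0 := t0_pos hs
  refine ⟨min η₁ (η₂ * t0 s), by positivity, fun v v' hv M hM hmax h0 hm hE => ?_⟩
  have hE1 := hE.trans (add_le_add_right (min_le_left η₁ (η₂ * t0 s)) _)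
  have hE2 := hE.trans (add_le_add_right (min_le_right η₁ (η₂ * t0 s)) _)
  have h0' : ‖v 0‖ = M := by rw [h0, Complex.norm_real, Real.norm_of_nonneg hM.le]
  have hD := hv.integral_defect hs0 hM hmax h0'
  rw [integral_rate_one hs] at hD
  have hD1 : 0 ≤ ∫ x in Ioi (0:ℝ), ‖defect s M v v' x‖ ^ 2 := integral_nonneg fun _ => sq_nonneg _
  have hD2 : 0 ≤ ∫ x in Ioi (0:ℝ), ‖defect s M (fun x => v (-x)) (fun x => -v' (-x)) x‖ ^ 2 :=
    integral_nonneg fun _ => sq_nonneg _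
  have e1 := t0_eq hs
  have e2 := m0_eq hs
  have hMm : M ^ (2 * s) * (∫ x, ‖v x‖ ^ 2) ≤ M ^ (2 * s) * ((1 + 2 / s) * t0 s) := by
    rw [← e2]; gcongr
  have hk1 : 0 ≤ 2 * M ^ (s + 2) - (1 + 2 / s) * M ^ (2 * s) - (2 - (1 + 2 / s)) := by
    have h2 := height_ge hs0 hs2 hM
    linarith
  -- Nonnegativity of the two defect integrals and the mass bound give t0 (2M^(s+2) - (1 +
  -- 2/s)M^(2s)) as a lower bound of the energy, whose minimal value t0 (2 - (1 + 2/s)) is t0 - p0.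
  have hM1 : |M - 1| ≤ min η₁ 1 := by
    refine hht M hM ?_
    rw [← mul_le_mul_iff_left₀ ht0]
    linarith
  have hk2 := mul_nonneg hk1 ht0.le
  have b1 := hbar M (hM1.trans (min_le_left _ _)) v v' hv hmax h0 (by linarith)
  have b2 := hbar M (hM1.trans (min_le_left _ _)) _ _ hv.comp_neg (fun x => hmax _)
    (by simpa using h0) (by linarith)
  have hM2 : M ≤ 2 := by linarith [(abs_le.1 (hM1.trans (min_le_right _ _))).2]
  have iL : Integrable (indicator (Ioc (-L) L) (sw s)) := iw.indicator measurableSet_Ioc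
  have ivw : Integrable fun x => (v x).re * sw s x := by
    have h1 : MemLp (fun x => (v x).re) 2 := hv.memLp.re
    exact h1.integrable_mul ((dec_sw hs).memLp (continuous_sw hs0))
  -- Inside the interval this is the barrier bound. Outside it only |v| ≤ 2 and w ≤ 1 are available,
  -- and the coefficient 3 absorbs both.
  have hpt : ∀ x, sw s x ^ 2 - (κ + 3) * sw s x + 3 * indicator (Ioc (-L) L) (sw s) x
      ≤ (v x).re * sw s x := by
    intro x
    have hw := sw_pos s x
    have hw1 := sw_le_one hs0 x
    by_cases hx : x ∈ Ioc (-L) L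
    · rw [indicator_of_mem hx]
      have : sw s x - κ ≤ (v x).re := by
        rcases le_total 0 x with h | h
        · exact b1 x ⟨h, hx.2⟩
        · have := b2 (-x) ⟨by linarith, by linarith [hx.1]⟩
          simpa [sw_neg] using this
      nlinarith
    · rw [indicator_of_notMem hx]
      have h1 : -2 ≤ (v x).re := by
        linarith [(abs_le.1 ((Complex.abs_re_le_norm (v x)).trans (hmax x))).1]
      nlinarith
  have hint := integral_mono (((integrable_sw_sq hs).sub (iw.const_mul (κ + 3))).add
    (iL.const_mul 3)) ivw hpt
  have e3 : (∫ x, (sw s x ^ 2 - (κ + 3) * sw s x + 3 * indicator (Ioc (-L) L) (sw s) x))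
      = m0 s - (κ + 3) * (∫ x, sw s x) + 3 * ∫ x in Ioc (-L) L, sw s x := by
    have := integral_linear_comb (integrable_sw_sq hs) iw iL 1 (-(κ + 3)) 3
    rw [integral_indicator measurableSet_Ioc] at this
    simp_rw [one_mul, neg_mul, ← sub_eq_add_neg] at this
    exact this
  have e4 : (∫ x, ‖v x - sw s x‖ ^ 2)
      = (∫ x, ‖v x‖ ^ 2) - 2 * (∫ x, (v x).re * sw s x) + m0 s := by
    have := integral_linear_comb hv.integrable_sq ivw (integrable_sw_sq hs) 1 (-2) 1
    simp_rw [one_mul, neg_mul, ← sub_eq_add_neg] at this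
    rw [m0, ← this]
    refine integral_congr_ae (Eventually.of_forall fun x => ?_)
    simp only [← Complex.normSq_eq_norm_sq, Complex.normSq_apply, Complex.sub_re, Complex.sub_im,
      Complex.ofReal_re, Complex.ofReal_im]
    ring
  have e5 : (∫ x, (v x).re * sw s x) ≥ m0 s - (κ + 3) * (∫ x, sw s x)
      + 3 * ∫ x in Ioc (-L) L, sw s x := by rw [← e3]; exact hint
  rw [e4]
  linarith

/-- Stability of the soliton. -/
theorem exists_stable (hs : 1 < s) (hs2 : s < 2) {δ : ℝ} (hδ : 0 < δ) : ∃ η > 0,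
    ∀ v v' : ℝ → ℂ, CSob v v' → (∫ x, ‖v x‖ ^ 2) ≤ m0 s →
      (∫ x, ‖v' x‖ ^ 2) - (∫ x, ‖v x‖ ^ (2 * s + 2)) ≤ t0 s - p0 s + η →
        ∃ φ y : ℝ, (∫ x, ‖Complex.exp (φ * Complex.I) * v (x + y) - sw s x‖ ^ 2) ≤ δ := by
  obtain ⟨η, hη, h⟩ := exists_stable_of_max hs hs2 hδ
  have htp := t0_lt_p0 hs hs2
  -- The second entry keeps the energy negative, so that v is not identically zero and its modulus
  -- has a positive maximum.
  refine ⟨min η ((p0 s - t0 s) / 2), by have := sub_pos.2 htp; positivity,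
    fun v v' hv hm hE => ?_⟩
  have hE1 := hE.trans (add_le_add_right (min_le_left _ _) _)
  have hE2 := hE.trans (add_le_add_right (min_le_right _ _) _)
  obtain ⟨x₀, hx₀⟩ : ∃ x₀, v x₀ ≠ 0 := by
    by_contra! hc
    have h1 : 0 ≤ ∫ x, ‖v' x‖ ^ 2 := integral_nonneg fun _ => sq_nonneg _
    have h2 : ∫ x, ‖v x‖ ^ (2 * s + 2) = 0 := by
      simp_rw [hc, norm_zero]
      rw [Real.zero_rpow (by linarith)]; simp
    linarith
  obtain ⟨y, hy⟩ := hv.continuous.norm.exists_forall_ge' x₀ (by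
    have h1 : Tendsto (fun x => ‖v x‖) (cocompact ℝ) (𝓝 0) := by simpa using hv.tendsto.norm
    exact (h1.eventually (gt_mem_nhds (norm_pos_iff.2 hx₀))).mono fun _ h => h.le)
  have hvy : 0 < ‖v y‖ := (norm_pos_iff.2 hx₀).trans_le (hy x₀)
  have hph : Complex.exp ((-Complex.arg (v y) : ℝ) * Complex.I) * v y = ‖v y‖ := by
    conv_lhs => rw [← Complex.norm_mul_exp_arg_mul_I (v y)]
    rw [mul_left_comm, ← Complex.exp_add]
    simp
  have hn : ‖Complex.exp ((-Complex.arg (v y) : ℝ) * Complex.I)‖ = 1 :=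
    Complex.norm_exp_ofReal_mul_I _
  refine ⟨-Complex.arg (v y), y, h _ _ ((hv.comp_add y).const_mul _) ‖v y‖ hvy ?_ ?_ ?_ ?_⟩
  · intro x; rw [norm_mul, hn, one_mul]; exact hy _
  · simpa using hph
  · simp_rw [norm_mul, hn, one_mul]
    rwa [integral_add_right_eq_self fun x => ‖v x‖ ^ 2]
  · simp_rw [norm_mul, hn, one_mul]
    rwa [integral_add_right_eq_self fun x => ‖v' x‖ ^ 2,
      integral_add_right_eq_self fun x => ‖v x‖ ^ (2 * s + 2)]

end

/-! ### Continuity of the potential energy and frequency truncation -/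

theorem rpow_sub_rpow_le {p x y : ℝ} (hp : 1 < p) (hx : 0 ≤ x) (hy : 0 ≤ y) :
    x ^ p - y ^ p ≤ p * x ^ (p - 1) * (x - y) := by
  rcases hx.eq_or_lt with rfl | hx
  · rw [Real.zero_rpow (by linarith), Real.zero_rpow (by linarith)]
    have := Real.rpow_nonneg hy p
    linarith
  · have h := one_add_mul_self_le_rpow_one_add (s := y / x - 1) (p := p)
      (by have := div_nonneg hy hx.le; linarith) hp.le
    rw [add_sub_cancel, Real.div_rpow hy hx.le, le_div_iff₀ (by positivity)] at h
    have e : x ^ p = x ^ (p - 1) * x := by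
      rw [← Real.rpow_add_one hx.ne', sub_add_cancel]
    have e2 : (1 + p * (y / x - 1)) * x ^ p = x ^ p + p * x ^ (p - 1) * (y - x) := by
      rw [e]; field_simp
    linarith

section
variable {s : ℝ} {G H : ℝ → ℂ}

theorem Adm.nsq_add_le (hG : Adm s G) (hH : Adm s H) :
    nsq (fun ξ => G ξ + H ξ) ≤ 2 * nsq G + 2 * nsq H := by
  rw [nsq, nsq, nsq, ← integral_const_mul, ← integral_const_mul,
    ← integral_add (hG.int_sq.const_mul 2) (hH.int_sq.const_mul 2)]
  refine integral_mono (hG.add hH).int_sq ((hG.int_sq.const_mul 2).add (hH.int_sq.const_mul 2))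
    fun ξ => ?_
  have h1 := norm_add_le (G ξ) (H ξ)
  have h2 : ‖G ξ + H ξ‖ ^ 2 ≤ (‖G ξ‖ + ‖H ξ‖) ^ 2 := by gcongr
  simp only
  nlinarith [sq_nonneg (‖G ξ‖ - ‖H ξ‖)]

theorem Adm.hom_add_le (hG : Adm s G) (hH : Adm s H) :
    hom s (fun ξ => G ξ + H ξ) ≤ 2 * hom s G + 2 * hom s H := by
  rw [hom, hom, hom, ← integral_const_mul, ← integral_const_mul,
    ← integral_add (hG.int_hom.const_mul 2) (hH.int_hom.const_mul 2)]
  refine integral_mono (hG.add hH).int_hom ((hG.int_hom.const_mul 2).add (hH.int_hom.const_mul 2))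
    fun ξ => ?_
  have h1 := norm_add_le (G ξ) (H ξ)
  have h2 : ‖G ξ + H ξ‖ ^ 2 ≤ (‖G ξ‖ + ‖H ξ‖) ^ 2 := by gcongr
  have h3 : ‖G ξ + H ξ‖ ^ 2 ≤ 2 * ‖G ξ‖ ^ 2 + 2 * ‖H ξ‖ ^ 2 := by
    nlinarith [sq_nonneg (‖G ξ‖ - ‖H ξ‖)]
  have h4 := mul_le_mul_of_nonneg_left h3 (show 0 ≤ |ξ| ^ s by positivity)
  simp only
  linarith

theorem nsq_neg (G : ℝ → ℂ) : nsq (fun ξ => -G ξ) = nsq G := by simp [nsq]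

theorem hom_neg (s : ℝ) (G : ℝ → ℂ) : hom s (fun ξ => -G ξ) = hom s G := by simp [hom]

theorem Adm.neg (hG : Adm s G) : Adm s fun ξ => -G ξ := by simpa using hG.const_mul (-1)

theorem Adm.nsq_sub_le (hG : Adm s G) (hH : Adm s H) :
    nsq (fun ξ => G ξ - H ξ) ≤ 2 * nsq G + 2 * nsq H := by
  simpa [sub_eq_add_neg, nsq_neg] using hG.nsq_add_le hH.neg

theorem Adm.hom_sub_le (hG : Adm s G) (hH : Adm s H) :
    hom s (fun ξ => G ξ - H ξ) ≤ 2 * hom s G + 2 * hom s H := by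
  simpa [sub_eq_add_neg, hom_neg] using hG.hom_add_le hH.neg

/-- The factor θ lets a small L² difference control the change of the potential energy by sums of
squares alone, without a Cauchy–Schwarz step. -/
theorem abs_rpow_norm_sub_le (hs : 0 < s) {Λ θ : ℝ} (hθ : 0 < θ) {a b : ℂ}
    (ha : ‖a‖ ^ (2 * s) ≤ Λ) (hb : ‖b‖ ^ (2 * s) ≤ Λ) :
    |‖a‖ ^ (2 * s + 2) - ‖b‖ ^ (2 * s + 2)| ≤ (2 * s + 2) * Λ *
      (θ * ‖a‖ ^ 2 + θ * ‖b‖ ^ 2 + (2 * θ)⁻¹ * ‖a - b‖ ^ 2) := by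
  have key : ∀ a b : ℂ, ‖a‖ ^ (2 * s) ≤ Λ → ‖a‖ ^ (2 * s + 2) - ‖b‖ ^ (2 * s + 2) ≤
      (2 * s + 2) * Λ * (θ * ‖a‖ ^ 2 + θ * ‖b‖ ^ 2 + (2 * θ)⁻¹ * ‖a - b‖ ^ 2) := by
    intro a b ha
    have h1 := rpow_sub_rpow_le (p := 2 * s + 2) (by linarith) (norm_nonneg a) (norm_nonneg b)
    have e : ‖a‖ ^ (2 * s + 2 - 1) = ‖a‖ ^ (2 * s) * ‖a‖ := by
      rw [← Real.rpow_add_one' (norm_nonneg _) (by linarith)]; ring_nf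
    rw [e] at h1
    have h2 : ‖a‖ * (‖a‖ - ‖b‖) ≤ ‖a‖ * ‖a - b‖ := by
      gcongr; exact norm_sub_norm_le a b
    have h3 : ‖a‖ * ‖a - b‖ ≤ θ * ‖a‖ ^ 2 + θ * ‖b‖ ^ 2 + (2 * θ)⁻¹ * ‖a - b‖ ^ 2 := by
      have : 0 ≤ (2 * θ)⁻¹ * (θ * ‖a‖ - ‖a - b‖) ^ 2 := by positivity
      have e : (2 * θ)⁻¹ * (θ * ‖a‖ - ‖a - b‖) ^ 2
        = θ / 2 * ‖a‖ ^ 2 - ‖a‖ * ‖a - b‖ + (2 * θ)⁻¹ * ‖a - b‖ ^ 2 := by field_simp; ring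
      have h5 : 0 ≤ θ / 2 * ‖a‖ ^ 2 := by positivity
      have h6 : 0 ≤ θ * ‖b‖ ^ 2 := by positivity
      linarith
    have hX : 0 ≤ θ * ‖a‖ ^ 2 + θ * ‖b‖ ^ 2 + (2 * θ)⁻¹ * ‖a - b‖ ^ 2 := by positivity
    calc _ ≤ (2 * s + 2) * ‖a‖ ^ (2 * s) * (‖a‖ * (‖a‖ - ‖b‖)) := by linarith
      _ ≤ (2 * s + 2) * ‖a‖ ^ (2 * s)
          * (θ * ‖a‖ ^ 2 + θ * ‖b‖ ^ 2 + (2 * θ)⁻¹ * ‖a - b‖ ^ 2) := by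
        gcongr; exact h2.trans h3
      _ ≤ _ := by gcongr
  rw [abs_sub_le_iff]
  refine ⟨key a b ha, (key b a hb).trans_eq ?_⟩
  rw [norm_sub_rev]; ring

theorem abs_pot_sub_le (hs : 1 < s) (hG : Adm s G) (hH : Adm s H) {Λ θ : ℝ} (hθ : 0 < θ)
    (hGΛ : (∫ ξ, ‖G ξ‖) ^ (2 * s) ≤ Λ) (hHΛ : (∫ ξ, ‖H ξ‖) ^ (2 * s) ≤ Λ) :
    |pot s G - pot s H| ≤ (2 * s + 2) * Λ *
      (θ * nsq G + θ * nsq H + (2 * θ)⁻¹ * nsq fun ξ => G ξ - H ξ) := by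
  have iG := hG.integrable hs
  have iH := hH.integrable hs
  have mG := memLp_fourierInv iG hG.memLp
  have mH := memLp_fourierInv iH hH.memLp
  have jG := (memLp_two_iff_integrable_sq_norm mG.1).1 mG
  have jH := (memLp_two_iff_integrable_sq_norm mH.1).1 mH
  have jD := (memLp_two_iff_integrable_sq_norm (mG.sub mH).1).1 (mG.sub mH)
  have eD : (∫ x, ‖(𝓕⁻ G - 𝓕⁻ H) x‖ ^ 2) = nsq fun ξ => G ξ - H ξ := by
    rw [nsq, ← integral_norm_sq_fourierInv (hG.sub hH |>.integrable hs) (hG.sub hH).memLp]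
    simp_rw [fourierInv_sub' iG iH, Pi.sub_apply]
  rw [pot, pot, ← integral_sub (hG.integrable_pot hs) (hH.integrable_pot hs)]
  refine (abs_integral_le_integral_abs).trans ?_
  have b : ∀ {K : ℝ → ℂ}, (∫ ξ, ‖K ξ‖) ^ (2 * s) ≤ Λ → ∀ x, ‖𝓕⁻ K x‖ ^ (2 * s) ≤ Λ :=
    fun h x => (Real.rpow_le_rpow (norm_nonneg _) (norm_fourierInv_le _ x) (by linarith)).trans h
  have e := integral_linear_comb jG jH jD θ θ (2 * θ)⁻¹
  rw [integral_norm_sq_fourierInv iG hG.memLp, integral_norm_sq_fourierInv iH hH.memLp, eD] at e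
  have e' : θ * nsq G + θ * nsq H + (2 * θ)⁻¹ * (nsq fun ξ => G ξ - H ξ)
    = ∫ x, (θ * ‖𝓕⁻ G x‖ ^ 2 + θ * ‖𝓕⁻ H x‖ ^ 2 + (2 * θ)⁻¹ * ‖(𝓕⁻ G - 𝓕⁻ H) x‖ ^ 2) := e.symm
  rw [e', ← integral_const_mul]
  exact integral_mono ((hG.integrable_pot hs).sub (hH.integrable_pot hs)).abs
    ((((jG.const_mul θ).add (jH.const_mul θ)).add (jD.const_mul _)).const_mul _)
    fun x => abs_rpow_norm_sub_le (by linarith) hθ (b hGΛ x) (b hHΛ x)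

/-- Truncation to the frequencies of size at most `R`. -/
noncomputable def low (R : ℝ) (G : ℝ → ℂ) : ℝ → ℂ := indicator (Icc (-R) R) G

/-- Truncation to the frequencies of size more than `R`. -/
noncomputable def high (R : ℝ) (G : ℝ → ℂ) : ℝ → ℂ := indicator (Icc (-R) R)ᶜ G

theorem low_add_high (R : ℝ) (G : ℝ → ℂ) (ξ : ℝ) : low R G ξ + high R G ξ = G ξ :=
  congrFun (indicator_self_add_compl (Icc (-R) R) G) ξ

theorem norm_low_le (R : ℝ) (G : ℝ → ℂ) (ξ : ℝ) : ‖low R G ξ‖ ≤ ‖G ξ‖ := by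
  unfold low; exact norm_indicator_le_norm_self _ _

theorem norm_high_le (R : ℝ) (G : ℝ → ℂ) (ξ : ℝ) : ‖high R G ξ‖ ≤ ‖G ξ‖ := by
  unfold high; exact norm_indicator_le_norm_self _ _

theorem Adm.low (hG : Adm s G) (R : ℝ) : Adm s (low R G) :=
  hG.of_le (hG.aesm.indicator measurableSet_Icc) (c := 1) fun ξ => by
    rw [one_mul]; have := norm_low_le R G ξ; gcongr

theorem Adm.high (hG : Adm s G) (R : ℝ) : Adm s (high R G) :=
  hG.of_le (hG.aesm.indicator measurableSet_Icc.compl) (c := 1) fun ξ => by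
    rw [one_mul]; have := norm_high_le R G ξ; gcongr

theorem norm_sq_low_add_high (R : ℝ) (G : ℝ → ℂ) (ξ : ℝ) :
    ‖low R G ξ‖ ^ 2 + ‖high R G ξ‖ ^ 2 = ‖G ξ‖ ^ 2 := by
  unfold FracNLS.low FracNLS.high
  by_cases h : ξ ∈ Icc (-R) R <;> simp [h]

theorem Adm.nsq_low_add_high (hG : Adm s G) (R : ℝ) :
    nsq (FracNLS.low R G) + nsq (FracNLS.high R G) = nsq G := by
  rw [nsq, nsq, nsq, ← integral_add (hG.low R).int_sq (hG.high R).int_sq]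
  simp_rw [norm_sq_low_add_high]

theorem Adm.deriv_low (hG : Adm s G) {R : ℝ} :
    Adm s fun ξ : ℝ => (2 * Real.pi * Complex.I * ξ) * FracNLS.low R G ξ := by
  refine hG.of_le ((Continuous.aestronglyMeasurable (by fun_prop)).mul (hG.low R).aesm)
    (c := (2 * Real.pi * R) ^ 2) fun ξ => ?_
  unfold FracNLS.low
  by_cases h : ξ ∈ Icc (-R) R
  · have h1 : |ξ| ≤ |R| := (abs_le.2 h).trans (le_abs_self R)
    have h2 : ξ ^ 2 ≤ R ^ 2 := sq_le_sq.2 h1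
    rw [indicator_of_mem h, norm_mul, mul_pow]
    have : ‖(2 * Real.pi * Complex.I * ξ : ℂ)‖ ^ 2 = (2 * Real.pi) ^ 2 * ξ ^ 2 := by
      simp [mul_pow]
    rw [this, mul_pow (2 * Real.pi)]
    gcongr
  · rw [indicator_of_notMem h, mul_zero, norm_zero, zero_pow two_ne_zero]; positivity

theorem Adm.csob_low (hs : 1 < s) (hG : Adm s G) (R : ℝ) : CSob (𝓕⁻ (FracNLS.low R G))
    (𝓕⁻ fun ξ : ℝ => (2 * Real.pi * Complex.I * ξ) * FracNLS.low R G ξ) where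
  deriv := hasDerivAt_fourierInv ((hG.low R).integrable hs) (by
    have h := (hG.deriv_low (R := R).integrable hs).const_mul (2 * Real.pi * Complex.I)⁻¹
    refine h.congr (Eventually.of_forall fun ξ => ?_)
    have : (2 * Real.pi * Complex.I : ℂ) ≠ 0 := Complex.two_pi_I_ne_zero
    simp only
    field_simp)
  cont := continuous_fourierInv (hG.deriv_low.integrable hs)
  memLp := memLp_fourierInv ((hG.low R).integrable hs) (hG.low R).memLp
  memLp' := memLp_fourierInv (hG.deriv_low.integrable hs) hG.deriv_low.memLp
  tendsto := tendsto_fourierInv_cocompact _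

theorem Adm.integral_norm_sq_deriv_low (hs : 1 < s) (hG : Adm s G) (R : ℝ) :
    ∫ x, ‖𝓕⁻ (fun ξ : ℝ => (2 * Real.pi * Complex.I * ξ) * FracNLS.low R G ξ) x‖ ^ 2
      = ∫ ξ, (2 * Real.pi * ξ) ^ 2 * ‖FracNLS.low R G ξ‖ ^ 2 := by
  rw [integral_norm_sq_fourierInv (hG.deriv_low.integrable hs) hG.deriv_low.memLp]
  congr 1; ext ξ
  rw [norm_mul, mul_pow]
  congr 1
  simp [mul_pow]

theorem Adm.integrable_deriv_low (hG : Adm s G) (R : ℝ) :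
    Integrable fun ξ => (2 * Real.pi * ξ) ^ 2 * ‖FracNLS.low R G ξ‖ ^ 2 := by
  refine (hG.deriv_low (R := R)).int_sq.congr (Eventually.of_forall fun ξ => ?_)
  simp only [norm_mul, mul_pow]
  congr 1
  simp

/-- At low frequencies the symbol is replaced by (2πξ)², with error κR² on the mass, and at high
frequencies by the constant B. The value B = 0 serves for closeness to the soliton, a large B for
absorbing high frequencies in the uniqueness argument. -/
theorem Adm.le_ten (hs : 1 < s) (hs2 : s < 2) (hG : Adm s G) {ε R κ B : ℝ} (hR : 0 ≤ R)
    (hκ : 0 ≤ κ) (hnear : ∀ η, |η| ≤ R → |sym s ε η - (2 * Real.pi * η) ^ 2| ≤ κ * η ^ 2)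
    (hfar : ∀ η, R ≤ |η| → B ≤ sym s ε η) :
    (∫ ξ, (2 * Real.pi * ξ) ^ 2 * ‖FracNLS.low R G ξ‖ ^ 2) + B * nsq (FracNLS.high R G)
      - κ * R ^ 2 * nsq G ≤ ten s ε G := by
  have h := integral_linear_comb (hG.integrable_deriv_low R) (hG.high R).int_sq hG.int_sq
    1 B (-(κ * R ^ 2))
  rw [one_mul, neg_mul, ← sub_eq_add_neg] at h
  rw [nsq, nsq, ← h]
  refine integral_mono (((hG.integrable_deriv_low R).const_mul 1 |>.add
    ((hG.high R).int_sq.const_mul B)).add (hG.int_sq.const_mul _)) (hG.integrable_ten hs hs2)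
    fun ξ => ?_
  simp only
  unfold FracNLS.low FracNLS.high
  by_cases hξ : ξ ∈ Icc (-R) R
  · have hξ' : ξ ∉ (Icc (-R) R)ᶜ := by simpa using hξ
    rw [indicator_of_mem hξ, indicator_of_notMem hξ']
    have h1 := (abs_le.1 (hnear ξ (abs_le.2 hξ))).1
    have h2 : ξ ^ 2 ≤ R ^ 2 := sq_le_sq.2 (by rw [abs_of_nonneg hR]; exact abs_le.2 hξ)
    have h3 : κ * ξ ^ 2 ≤ κ * R ^ 2 := by gcongr
    have h4 := mul_le_mul_of_nonneg_right (show (2 * Real.pi * ξ) ^ 2 - κ * R ^ 2 ≤ sym s ε ξ by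
      linarith) (sq_nonneg ‖G ξ‖)
    simp
    linarith
  · have hξ' : ξ ∈ (Icc (-R) R)ᶜ := hξ
    rw [indicator_of_notMem hξ, indicator_of_mem hξ']
    have h1 : R ≤ |ξ| := by
      by_contra! hc; exact hξ (abs_le.1 hc.le)
    have h2 := mul_le_mul_of_nonneg_right (hfar ξ h1) (sq_nonneg ‖G ξ‖)
    have h3 : 0 ≤ κ * R ^ 2 * ‖G ξ‖ ^ 2 := by positivity
    simp
    linarith

theorem Adm.nsq_high_le (hs : 0 < s) (hG : Adm s G) {R : ℝ} (hR : 0 < R) :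
    R ^ s * nsq (FracNLS.high R G) ≤ hom s G := by
  rw [nsq, hom, ← integral_const_mul]
  refine integral_mono ((hG.high R).int_sq.const_mul _) hG.int_hom fun ξ => ?_
  simp only
  unfold FracNLS.high
  by_cases hξ : ξ ∈ Icc (-R) R
  · have hξ' : ξ ∉ (Icc (-R) R)ᶜ := by simpa using hξ
    rw [indicator_of_notMem hξ']; simp; positivity
  · have hξ' : ξ ∈ (Icc (-R) R)ᶜ := hξ
    have h1 : R ≤ |ξ| := by
      by_contra! hc; exact hξ (abs_le.1 hc.le)
    rw [indicator_of_mem hξ']; gcongr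

/-! ### Phase rotations and translations -/

/-- Multiplication by a phase and translation, on the Fourier side. -/
noncomputable def tw (φ y : ℝ) (G : ℝ → ℂ) (ξ : ℝ) : ℂ :=
  Complex.exp ((φ + 2 * Real.pi * ξ * y : ℝ) * Complex.I) * G ξ

theorem norm_tw (φ y : ℝ) (G : ℝ → ℂ) (ξ : ℝ) : ‖tw φ y G ξ‖ = ‖G ξ‖ := by
  rw [tw, norm_mul, Complex.norm_exp_ofReal_mul_I, one_mul]

theorem nsq_tw (φ y : ℝ) (G : ℝ → ℂ) : nsq (tw φ y G) = nsq G := by simp_rw [nsq, norm_tw]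

theorem ten_tw (s ε φ y : ℝ) (G : ℝ → ℂ) : ten s ε (tw φ y G) = ten s ε G := by
  simp_rw [ten, norm_tw]

theorem fourierInv_tw (φ y : ℝ) (G : ℝ → ℂ) (x : ℝ) :
    𝓕⁻ (tw φ y G) x = Complex.exp (φ * Complex.I) * 𝓕⁻ G (x + y) := by
  rw [fourierInv_eq_integral, fourierInv_eq_integral, ← integral_const_mul]
  congr 1; ext ξ
  rw [tw, ← mul_assoc, ← mul_assoc, ← Complex.exp_add, ← Complex.exp_add]
  congr 2; push_cast; ring

theorem pot_tw (s φ y : ℝ) (G : ℝ → ℂ) : pot s (tw φ y G) = pot s G := by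
  simp_rw [pot, fourierInv_tw, norm_mul, Complex.norm_exp_ofReal_mul_I, one_mul]
  exact integral_add_right_eq_self (fun x => ‖𝓕⁻ G x‖ ^ (2 * s + 2)) y

theorem en_tw (s ε φ y : ℝ) (G : ℝ → ℂ) : en s ε (tw φ y G) = en s ε G := by
  rw [en, en, ten_tw, pot_tw]

theorem Adm.tw (hG : Adm s G) (φ y : ℝ) : Adm s (tw φ y G) :=
  hG.of_le ((Continuous.aestronglyMeasurable (by fun_prop)).mul hG.aesm) (c := 1)
    fun ξ => by rw [norm_tw, one_mul]

theorem tw_tw (φ y φ' y' : ℝ) (G : ℝ → ℂ) : tw φ y (tw φ' y' G) = tw (φ + φ') (y + y') G := by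
  ext ξ
  rw [tw, tw, tw, ← mul_assoc, ← Complex.exp_add]
  congr 2; push_cast; ring

theorem tw_zero (G : ℝ → ℂ) : tw 0 0 G = G := by ext ξ; simp [tw]

end

/-! ### Rescaled minimizers: a priori bounds, closeness to the soliton and modulation -/

/-- `G` minimizes the rescaled energy among functions of the mass of the soliton. -/
structure IsMin (s ε : ℝ) (G : ℝ → ℂ) : Prop where
  adm : Adm s G
  nsq : nsq G = m0 s
  le : ∀ H, Adm s H → FracNLS.nsq H = m0 s → en s ε G ≤ en s ε H

section
variable {s : ℝ}

theorem IsMin.tw {ε : ℝ} {G : ℝ → ℂ} (h : IsMin s ε G) (φ y : ℝ) : IsMin s ε (tw φ y G) where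
  adm := h.adm.tw φ y
  nsq := (nsq_tw φ y G).trans h.nsq
  le H hH hn := (en_tw s ε φ y G).trans_le (h.le H hH hn)

variable (hs : 1 < s) (hs2 : s < 2)
include hs hs2

theorem exists_en_le {η : ℝ} (hη : 0 < η) : ∃ ε₀ > 0, ∀ ε, 0 < ε → ε ≤ ε₀ → ∀ G, IsMin s ε G →
    en s ε G ≤ t0 s - p0 s + η := by
  have h := (tendsto_en_fsw hs hs2).eventually
    (gt_mem_nhds (show t0 s - p0 s < t0 s - p0 s + η by linarith))
  obtain ⟨ε₀, hε₀, h⟩ := mem_nhdsGT_iff_exists_Ioc_subset.1 h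
  exact ⟨ε₀, hε₀, fun ε h1 h2 G hG =>
    (hG.le _ (adm_fsw hs hs2) (nsq_fsw hs)).trans (h ⟨h1, h2⟩).le⟩

/-- Minimizers have nonpositive energy for small ε, so kinetic energy is at most potential energy.
The symbol dominates a large multiple of |η|^s at high frequencies, and half of this absorbs the
potential energy. -/
theorem exists_hom_le : ∃ ε₀ > 0, ∃ K > 0, ∀ ε, 0 < ε → ε ≤ ε₀ → ∀ G, IsMin s ε G →
    hom s G ≤ K := by
  have hm := m0_pos hs
  have hg := gnConst_pos s
  -- Twice the Gagliardo–Nirenberg factor at mass `m0 s`, so that the potential energy is at most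
  -- half of B times the homogeneous form.
  obtain ⟨B, hB⟩ : ∃ B, B = 2 * (gnConst s * m0 s ^ s) := ⟨_, rfl⟩
  have hB0 : 0 < B := by rw [hB]; positivity
  obtain ⟨A, hA, hsym⟩ := exists_sym_ge hs hs2 hB0
  -- With tolerance p0 - t0 the energy bound reads `en s ε G` ≤ 0.
  obtain ⟨ε₁, hε₁, hen⟩ := exists_en_le hs hs2 (sub_pos.2 (t0_lt_p0 hs hs2))
  refine ⟨min ε₁ A⁻¹, by positivity, 2 * A ^ s * m0 s, by positivity, fun ε h1 h2 G hG => ?_⟩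
  have h3 := hen ε h1 (h2.trans (min_le_left _ _)) G hG
  have h4 : B * hom s G ≤ B * A ^ s * m0 s + ten s ε G := by
    rw [← hG.nsq, hom, nsq, ten, ← integral_const_mul, ← integral_const_mul,
      ← integral_add (hG.adm.int_sq.const_mul _) (hG.adm.integrable_ten hs hs2)]
    refine integral_mono (hG.adm.int_hom.const_mul _) ((hG.adm.int_sq.const_mul _).add
      (hG.adm.integrable_ten hs hs2)) fun η => ?_
    simp only
    have h5 := sym_nonneg hs ε η
    rcases le_total A |η| with h | h
    · have h6 := mul_le_mul_of_nonneg_right (hsym ε η h1 (h2.trans (min_le_right _ _)) h)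
        (sq_nonneg ‖G η‖)
      have : 0 ≤ B * A ^ s * ‖G η‖ ^ 2 := by positivity
      linarith
    · have h6 : |η| ^ s ≤ A ^ s := by gcongr
      have h7 : B * (|η| ^ s * ‖G η‖ ^ 2) ≤ B * (A ^ s * ‖G η‖ ^ 2) := by gcongr
      have : 0 ≤ sym s ε η * ‖G η‖ ^ 2 := by positivity
      linarith
  have h5 := pot_le hs hG.adm
  rw [hG.nsq] at h5
  have h6 : ten s ε G ≤ 2⁻¹ * (B * hom s G) := by
    have : 2⁻¹ * (B * hom s G) = gnConst s * (hom s G * m0 s ^ s) := by rw [hB]; ring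
    rw [this]
    have : en s ε G = ten s ε G - pot s G := rfl
    linarith
  have h7 : B * hom s G ≤ B * (2 * A ^ s * m0 s) := by linarith
  exact le_of_mul_le_mul_left h7 hB0

/-- Minimizers are close to the soliton up to symmetries. -/
theorem exists_close {δ : ℝ} (hδ : 0 < δ) : ∃ ε₀ > 0, ∀ ε, 0 < ε → ε ≤ ε₀ → ∀ G, IsMin s ε G →
    ∃ φ y, nsq (fun ξ => tw φ y G ξ - fsw s ξ) ≤ δ := by
  have hm := m0_pos hs
  have hg := gnConst_pos s
  have hs0 : 0 < s := by linarith
  obtain ⟨η, hη, hstab⟩ := exists_stable hs hs2 (show 0 < δ / 4 by positivity)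
  obtain ⟨ε₁, hε₁, K, hK, hhom⟩ := exists_hom_le hs hs2
  obtain ⟨ε₂, hε₂, hen⟩ := exists_en_le hs hs2 (show 0 < η / 4 by positivity)
  obtain ⟨Λ, hΛ⟩ : ∃ Λ, Λ = gnConst s * (K * m0 s ^ (s - 1)) := ⟨_, rfl⟩
  have hΛ0 : 0 < Λ := by rw [hΛ]; positivity
  obtain ⟨θ, hθ, hθe⟩ : ∃ θ > 0, (2 * s + 2) * Λ * (θ * m0 s + θ * m0 s) = η / 4 :=
    ⟨η / 4 / ((2 * s + 2) * Λ * (2 * m0 s)), by positivity, by field_simp; ring⟩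
  obtain ⟨d, hd, hdδ, hde⟩ : ∃ d > 0, d ≤ δ / 4 ∧ (2 * s + 2) * Λ * ((2 * θ)⁻¹ * d) ≤ η / 4 := by
    refine ⟨min (δ / 4) (η / 4 / ((2 * s + 2) * Λ * (2 * θ)⁻¹)), by positivity, min_le_left _ _, ?_⟩
    have h := min_le_right (δ / 4) (η / 4 / ((2 * s + 2) * Λ * (2 * θ)⁻¹))
    rw [le_div_iff₀ (by positivity)] at h
    linarith
  -- The homogeneous bound K leaves at most mass d above frequency R once R^s ≥ K/d.
  obtain ⟨R, hRK, hR⟩ := (((tendsto_rpow_atTop hs0).eventually_ge_atTop (K / d)).and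
    (eventually_gt_atTop 0)).exists
  rw [div_le_iff₀ hd] at hRK
  obtain ⟨ε₃, hε₃, hnear⟩ := exists_sym_near hs hR (show 0 < η / 4 / (R ^ 2 * m0 s) by positivity)
  refine ⟨min ε₁ (min ε₂ ε₃), by positivity, fun ε h0 hle G hG => ?_⟩
  have hK' := hhom ε h0 (hle.trans (min_le_left _ _)) G hG
  have hen' := hen ε h0 (hle.trans ((min_le_right _ _).trans (min_le_left _ _))) G hG
  have hnear' := fun ξ h => hnear ε ξ h0 (hle.trans ((min_le_right _ _).trans (min_le_right _ _))) h
  have hhigh : nsq (high R G) ≤ d := by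
    have h1 := (hG.adm.nsq_high_le hs0 hR).trans (hK'.trans hRK)
    exact le_of_mul_le_mul_left h1 (by positivity)
  have hsplit := hG.adm.nsq_low_add_high R
  have hlow : nsq (low R G) ≤ m0 s := by
    rw [← hG.nsq, ← hsplit]; linarith [nsq_nonneg (high R G)]
  have hΛG : (∫ ξ, ‖G ξ‖) ^ (2 * s) ≤ Λ := by
    refine (integral_norm_rpow_le hs hG.adm).trans ?_
    rw [hG.nsq, hΛ]; gcongr
  have hΛL : (∫ ξ, ‖low R G ξ‖) ^ (2 * s) ≤ Λ := by
    refine (Real.rpow_le_rpow (integral_nonneg fun _ => norm_nonneg _) ?_ (by linarith)).trans hΛG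
    exact integral_mono ((hG.adm.low R).integrable hs).norm (hG.adm.integrable hs).norm
      fun ξ => norm_low_le R G ξ
  have hpot : pot s G - pot s (low R G) ≤ η / 4 + η / 4 := by
    refine (le_abs_self _).trans ((abs_pot_sub_le hs hG.adm (hG.adm.low R) hθ hΛG hΛL).trans ?_)
    have e : (fun ξ => G ξ - low R G ξ) = high R G := by
      ext ξ; rw [← low_add_high R G ξ]; ring
    rw [e]
    calc _ ≤ (2 * s + 2) * Λ * (θ * m0 s + θ * m0 s + (2 * θ)⁻¹ * d) := by
          rw [hG.nsq]; gcongr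
      _ = (2 * s + 2) * Λ * (θ * m0 s + θ * m0 s) + (2 * s + 2) * Λ * ((2 * θ)⁻¹ * d) := by ring
      _ ≤ _ := by rw [hθe]; gcongr
  have hten := hG.adm.le_ten hs hs2 hR.le (show 0 ≤ η / 4 / (R ^ 2 * m0 s) by positivity) hnear'
    (B := 0) fun ξ _ => sym_nonneg hs ε ξ
  have e1 : η / 4 / (R ^ 2 * m0 s) * R ^ 2 * m0 s = η / 4 := by field_simp
  rw [hG.nsq, zero_mul, add_zero, e1] at hten
  have e2 : en s ε G = ten s ε G - pot s G := rfl
  -- Stability applies to the smooth low frequency part: its mass is at most m0, and its limiting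
  -- energy exceeds the minimum by at most four errors of size η/4.
  obtain ⟨φ, y, hφ⟩ := hstab _ _ (hG.adm.csob_low hs R)
    (by rw [integral_norm_sq_fourierInv ((hG.adm.low R).integrable hs) (hG.adm.low R).memLp]
        exact hlow)
    (by rw [hG.adm.integral_norm_sq_deriv_low hs R]
        have : (∫ x, ‖𝓕⁻ (low R G) x‖ ^ (2 * s + 2)) = pot s (low R G) := rfl
        rw [this]
        linarith)
  have aL := (hG.adm.low R).tw φ y
  have aF := adm_fsw hs hs2
  refine ⟨φ, y, ?_⟩
  have e3 : (fun ξ => tw φ y G ξ - fsw s ξ)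
      = fun ξ => (tw φ y (low R G) ξ - fsw s ξ) + tw φ y (high R G) ξ := by
    ext ξ
    rw [tw, tw, tw, ← low_add_high R G ξ]; ring
  rw [e3]
  refine ((aL.sub aF).nsq_add_le ((hG.adm.high R).tw φ y)).trans ?_
  rw [nsq_tw]
  have e4 : nsq (fun ξ => tw φ y (low R G) ξ - fsw s ξ) ≤ δ / 4 := by
    rw [nsq, ← integral_norm_sq_fourierInv ((aL.sub aF).integrable hs) (aL.sub aF).memLp]
    simp_rw [fourierInv_sub' (aL.integrable hs) (aF.integrable hs), fourierInv_tw,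
      fourierInv_fsw hs]
    exact hφ
  linarith

omit hs2 in
theorem Adm.nsq_sub_fsw (hs2 : s < 2) {G : ℝ → ℂ} (hG : Adm s G) :
    FracNLS.nsq (fun ξ => G ξ - fsw s ξ)
      = FracNLS.nsq G + m0 s - 2 * (∫ ξ, inner ℂ (fsw s ξ) (G ξ)).re := by
  have hF := adm_fsw hs hs2
  have hi : Integrable fun ξ => inner ℂ (fsw s ξ) (G ξ) := by
    simp_rw [RCLike.inner_apply]
    exact hG.memLp.integrable_mul hF.memLp.star
  have h := integral_linear_comb hG.int_sq hF.int_sq hi.re 1 1 (-2)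
  have e : (∫ ξ, RCLike.re (inner ℂ (fsw s ξ) (G ξ))) = (∫ ξ, inner ℂ (fsw s ξ) (G ξ)).re :=
    integral_re hi
  have e2 : (∫ ξ, ‖fsw s ξ‖ ^ 2) = m0 s := nsq_fsw hs
  rw [e, e2] at h
  have e3 : ∀ ξ, ‖G ξ - fsw s ξ‖ ^ 2 = 1 * ‖G ξ‖ ^ 2 + 1 * ‖fsw s ξ‖ ^ 2
      + -2 * RCLike.re (inner ℂ (fsw s ξ) (G ξ)) := fun ξ => by
    rw [@norm_sub_sq ℂ, ← inner_conj_symm, RCLike.conj_re]; ring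
  rw [FracNLS.nsq]
  simp_rw [e3]
  rw [h, FracNLS.nsq]; ring

-- As a function of the translation the overlap is an inverse Fourier transform. This yields its
-- differentiability and decay.
omit hs hs2 in
theorem inner_tw (φ y : ℝ) (F G : ℝ → ℂ) :
    ∫ ξ, inner ℂ (F ξ) (tw φ y G ξ)
      = Complex.exp (φ * Complex.I) * 𝓕⁻ (fun ξ => inner ℂ (F ξ) (G ξ)) y := by
  rw [fourierInv_eq_integral, ← integral_const_mul]
  congr 1; ext ξ
  rw [tw, RCLike.inner_apply, RCLike.inner_apply, ← mul_assoc, ← mul_assoc, ← Complex.exp_add]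
  congr 3; push_cast; ring

/-- Modulation: after a phase rotation and a translation, a minimizer is close to the soliton and
satisfies orthogonality conditions. -/
theorem exists_modulated {δ : ℝ} (hδ : 0 < δ) : ∃ ε₀ > 0, ∀ ε, 0 < ε → ε ≤ ε₀ → ∀ G, IsMin s ε G →
    ∃ φ y, nsq (fun ξ => tw φ y G ξ - fsw s ξ) ≤ δ ∧
      (∫ ξ, inner ℂ (fsw s ξ) (tw φ y G ξ)).im = 0 ∧
      (∫ ξ, inner ℂ (fdsw s ξ) (tw φ y G ξ)).re = 0 := by
  have hm := m0_pos hs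
  -- Distance at most m0 forces an overlap of modulus at least m0/2 somewhere, hence a nonzero
  -- maximum.
  obtain ⟨ε₀, hε₀, h⟩ := exists_close hs hs2 (show 0 < min δ (m0 s) by positivity)
  refine ⟨ε₀, hε₀, fun ε h1 h2 G hG => ?_⟩
  obtain ⟨φ₁, y₁, h⟩ := h ε h1 h2 G hG
  have hF := adm_fsw hs hs2
  obtain ⟨P, hP⟩ : ∃ P : ℝ → ℂ, P = fun ξ => inner ℂ (fsw s ξ) (G ξ) := ⟨_, rfl⟩
  have hPi : Integrable P := by
    simp_rw [hP, RCLike.inner_apply]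
    exact hG.adm.memLp.integrable_mul hF.memLp.star
  have hdF : MemLp (fun ξ : ℝ => (ξ : ℂ) * fsw s ξ) 2 := by
    have hc := continuous_fsw hs
    refine (memLp_two_iff_integrable_sq_norm (Continuous.aestronglyMeasurable (by fun_prop))).2
      ((integrable_sq_mul_fsw hs).mono' (Continuous.aestronglyMeasurable (by fun_prop))
        (Eventually.of_forall fun ξ => ?_))
    rw [Real.norm_of_nonneg (by positivity), norm_mul, mul_pow, Complex.norm_real, Real.norm_eq_abs,
      sq_abs]
    nlinarith [sq_nonneg ‖fsw s ξ‖]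
  have hPi' : Integrable fun ξ : ℝ => (ξ : ℂ) * P ξ := by
    refine (hG.adm.memLp.integrable_mul hdF.star).congr (Eventually.of_forall fun ξ => ?_)
    simp [hP, mul_left_comm]
  have hder := hasDerivAt_fourierInv hPi hPi'
  have hre : ∀ φ y, (∫ ξ, inner ℂ (fsw s ξ) (tw φ y G ξ))
      = Complex.exp (φ * Complex.I) * 𝓕⁻ P y := fun φ y => by rw [inner_tw, hP]
  have hdre : ∀ φ y, (∫ ξ, inner ℂ (fdsw s ξ) (tw φ y G ξ)) = -(Complex.exp (φ * Complex.I) *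
      𝓕⁻ (fun ξ : ℝ => (2 * Real.pi * Complex.I * ξ) * P ξ) y) := fun φ y => by
    have e : (fun ξ => inner ℂ (fdsw s ξ) (G ξ))
        = fun ξ : ℝ => (-1 : ℂ) * ((2 * Real.pi * Complex.I * ξ) * P ξ) := by
      ext ξ
      have h2 : (starRingEnd ℂ) 2 = 2 := map_ofNat _ 2
      rw [fdsw_eq hs, hP]
      simp [h2]
      ring
    rw [inner_tw, e, fourierInv_const_mul]
    ring
  have hn : ∀ φ y, nsq (fun ξ => tw φ y G ξ - fsw s ξ)
      = 2 * m0 s - 2 * (Complex.exp (φ * Complex.I) * 𝓕⁻ P y).re := fun φ y => by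
    rw [(hG.adm.tw φ y).nsq_sub_fsw hs hs2, nsq_tw, hG.nsq, hre]; ring
  rw [hn] at h
  have h3 : m0 s ≤ 2 * ‖𝓕⁻ P y₁‖ := by
    have h5 := Complex.re_le_norm (Complex.exp (φ₁ * Complex.I) * 𝓕⁻ P y₁)
    rw [norm_mul, Complex.norm_exp_ofReal_mul_I, one_mul] at h5
    linarith [min_le_right δ (m0 s)]
  have hcont := continuous_fourierInv hPi
  -- At fixed mass the distance to the soliton is minimal where the real part of the overlap is
  -- maximal: y maximizes the modulus, and the phase then makes the overlap real and positive.
  obtain ⟨y, hy⟩ := hcont.norm.exists_forall_ge' y₁ (by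
    have h1 : Tendsto (fun x => ‖𝓕⁻ P x‖) (cocompact ℝ) (𝓝 0) := by
      simpa using (tendsto_fourierInv_cocompact P).norm
    exact (h1.eventually (gt_mem_nhds (show 0 < ‖𝓕⁻ P y₁‖ by linarith))).mono fun _ h => h.le)
  have hr : 0 < ‖𝓕⁻ P y‖ := by linarith [hy y₁]
  have hph : Complex.exp ((-Complex.arg (𝓕⁻ P y) : ℝ) * Complex.I) * 𝓕⁻ P y = ‖𝓕⁻ P y‖ := by
    conv_lhs => rw [← Complex.norm_mul_exp_arg_mul_I (𝓕⁻ P y)]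
    rw [mul_left_comm, ← Complex.exp_add]
    simp
  obtain ⟨φ, hφ⟩ : ∃ φ, φ = -Complex.arg (𝓕⁻ P y) := ⟨_, rfl⟩
  rw [← hφ] at hph
  refine ⟨φ, y, ?_, ?_, ?_⟩
  · rw [hn, hph, Complex.ofReal_re]
    have h5 := Complex.re_le_norm (Complex.exp (φ₁ * Complex.I) * 𝓕⁻ P y₁)
    rw [norm_mul, Complex.norm_exp_ofReal_mul_I, one_mul] at h5
    linarith [min_le_left δ (m0 s), hy y₁]
  · rw [hre, hph, Complex.ofReal_im]
  · rw [hdre, Complex.neg_re, neg_eq_zero]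
    -- Criticality in the translation parameter is the orthogonality to the derivative of the
    -- soliton.
    have hmax : IsLocalMax (fun x => ‖𝓕⁻ P x‖ ^ 2) y := Eventually.of_forall fun x =>
      pow_le_pow_left₀ (norm_nonneg _) (hy x) 2
    have h6 := hmax.hasDerivAt_eq_zero (hder y).norm_sq
    rw [mul_eq_zero, or_iff_right two_ne_zero] at h6
    obtain ⟨z, hz⟩ : ∃ z, z = 𝓕⁻ (fun ξ : ℝ => (2 * Real.pi * Complex.I * ξ) * P ξ) y := ⟨_, rfl⟩
    rw [← hz] at h6 ⊢
    have h7 : ‖𝓕⁻ P y‖ * (Complex.exp (φ * Complex.I) * z).re = 0 := by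
      have e0 : inner ℝ (Complex.exp (φ * Complex.I) * 𝓕⁻ P y) (Complex.exp (φ * Complex.I) * z)
          = inner ℝ (𝓕⁻ P y) z := by
        have hu : ‖Complex.exp (φ * Complex.I)‖ ^ 2 = 1 := by
          rw [Complex.norm_exp_ofReal_mul_I, one_pow]
        rw [Complex.inner, Complex.inner]
        congr 1
        have := Complex.conj_mul' (Complex.exp (φ * Complex.I))
        rw [← Complex.ofReal_pow, hu, Complex.ofReal_one] at this
        rw [map_mul]
        linear_combination (starRingEnd ℂ (𝓕⁻ P y) * z) * this
      rw [hph, h6, Complex.inner, Complex.conj_ofReal, mul_comm,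
        Complex.re_ofReal_mul] at e0
      exact e0
    exact (mul_eq_zero.1 h7).resolve_left hr.ne'

end

/-! ### Second order expansion of the potential energy -/

/-- The difference of the two sides, as a function of x with the maximum frozen, has a derivative of
the sign of x - y by the tangent inequality for the power s. -/
theorem rpow_add_one_le_taylor {s x y : ℝ} (hs : 1 < s) (hx : 0 ≤ x) (hy : 0 ≤ y) :
    x ^ (s + 1) ≤ y ^ (s + 1) + (s + 1) * y ^ s * (x - y)
      + s * (s + 1) / 2 * max x y ^ (s - 1) * (x - y) ^ 2 := by
  obtain ⟨N, hN⟩ : ∃ N, N = max x y ^ (s - 1) := ⟨_, rfl⟩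
  obtain ⟨ψ, hψ⟩ : ∃ ψ : ℝ → ℝ, ψ = fun m => (s + 1) * y ^ s * (m - y)
      + s * (s + 1) / 2 * N * (m - y) ^ 2 - m ^ (s + 1) := ⟨_, rfl⟩
  have hd : ∀ m, HasDerivAt ψ ((s + 1) * (y ^ s + s * N * (m - y) - m ^ s)) m := by
    intro m
    have h1 : HasDerivAt (fun m : ℝ => m - y) 1 m := (hasDerivAt_id m).sub_const y
    have h2 := Real.hasDerivAt_rpow_const (x := m) (p := s + 1) (Or.inr (by linarith))
    have h3 := ((h1.const_mul ((s + 1) * y ^ s)).add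
      ((h1.pow 2).const_mul (s * (s + 1) / 2 * N))).sub h2
    have e : (s + 1) * y ^ s * 1 + s * (s + 1) / 2 * N * (((2 : ℕ) : ℝ) * (m - y) ^ (2 - 1) * 1)
        - (s + 1) * m ^ (s + 1 - 1) = (s + 1) * (y ^ s + s * N * (m - y) - m ^ s) := by
      rw [add_sub_cancel_right]
      push_cast; ring
    rw [hψ, ← e]
    exact h3
  have hc : Continuous ψ := continuous_iff_continuousAt.2 fun m => (hd m).continuousAt
  have key : ψ y ≤ ψ x := by
    rcases le_total y x with h | h
    · refine monotoneOn_of_deriv_nonneg (convex_Icc y x) hc.continuousOn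
        (fun m _ => (hd m).differentiableAt.differentiableWithinAt) (fun m hm => ?_)
        (left_mem_Icc.2 h) (right_mem_Icc.2 h) h
      rw [interior_Icc] at hm
      rw [(hd m).deriv]
      have h1 := rpow_sub_rpow_le hs (hy.trans hm.1.le) hy
      have h2 : s * m ^ (s - 1) * (m - y) ≤ s * N * (m - y) := by
        rw [hN, max_eq_left h]
        have h3 : m ^ (s - 1) ≤ x ^ (s - 1) :=
          Real.rpow_le_rpow (hy.trans hm.1.le) hm.2.le (by linarith)
        have h4 : 0 ≤ m - y := by linarith [hm.1]
        gcongr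
      exact mul_nonneg (by linarith) (by linarith)
    · refine antitoneOn_of_deriv_nonpos (convex_Icc x y) hc.continuousOn
        (fun m _ => (hd m).differentiableAt.differentiableWithinAt) (fun m hm => ?_)
        (left_mem_Icc.2 h) (right_mem_Icc.2 h) h
      rw [interior_Icc] at hm
      rw [(hd m).deriv]
      have h1 := rpow_sub_rpow_le hs hy (hx.trans hm.1.le)
      have h2 : N = y ^ (s - 1) := by rw [hN, max_eq_right h]
      rw [h2]
      exact mul_nonpos_of_nonneg_of_nonpos (by linarith) (by linarith)
  rw [hψ] at key
  simp only [sub_self] at key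
  rw [← hN]
  linarith

section
variable {s : ℝ}

/-- Taylor's bound is applied to the power s + 1 of the squared modulus, a quadratic polynomial in
H. The terms linear in H cancel between U + H and U - H. -/
theorem norm_rpow_second_diff_le (hs : 1 < s) (U H : ℂ) :
    ‖U + H‖ ^ (2 * s + 2) + ‖U - H‖ ^ (2 * s + 2) - 2 * ‖U‖ ^ (2 * s + 2)
      ≤ 2 * (s + 1) * (‖U‖ ^ 2) ^ s * ‖H‖ ^ 2
        + s * (s + 1) * ((‖U‖ + ‖H‖) ^ 2) ^ (s - 1)
          * ((‖H‖ ^ 2) ^ 2 + 4 * (inner ℝ U H) ^ 2) := by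
  have e : ∀ z : ℂ, ‖z‖ ^ (2 * s + 2) = (‖z‖ ^ 2) ^ (s + 1) := fun z => by
    rw [← Real.rpow_natCast, ← Real.rpow_mul (norm_nonneg _)]; push_cast; ring_nf
  rw [e, e, e]
  have hp := norm_add_sq_real U H
  have hm := norm_sub_sq_real U H
  have key : ∀ z : ℂ, ‖z‖ ≤ ‖U‖ + ‖H‖ → (‖z‖ ^ 2) ^ (s + 1) ≤ (‖U‖ ^ 2) ^ (s + 1)
      + (s + 1) * (‖U‖ ^ 2) ^ s * (‖z‖ ^ 2 - ‖U‖ ^ 2)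
      + s * (s + 1) / 2 * ((‖U‖ + ‖H‖) ^ 2) ^ (s - 1) * (‖z‖ ^ 2 - ‖U‖ ^ 2) ^ 2 := fun z hz => by
    refine (rpow_add_one_le_taylor hs (sq_nonneg ‖z‖) (sq_nonneg ‖U‖)).trans ?_
    have h0 : 0 ≤ ‖U‖ ^ 2 := sq_nonneg _
    have h1 : max (‖z‖ ^ 2) (‖U‖ ^ 2) ≤ (‖U‖ + ‖H‖) ^ 2 :=
      max_le (by gcongr) (by gcongr; linarith [norm_nonneg H])
    have h2 : max (‖z‖ ^ 2) (‖U‖ ^ 2) ^ (s - 1) ≤ ((‖U‖ + ‖H‖) ^ 2) ^ (s - 1) :=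
      Real.rpow_le_rpow (le_max_of_le_right h0) h1 (by linarith)
    gcongr
  have h1 := key _ (norm_add_le U H)
  have h2 := key _ (norm_sub_le U H)
  rw [hp] at h1 ⊢
  rw [hm] at h2 ⊢
  linarith

/-- Bookkeeping for `exists_second_diff_le`: n and A stand for |U|^(2s) and w^(2s), N and B for
powers 2(s-1) of |U| + |H| and w, h for |H|², a for Re H and c for the real inner product of U and
H. -/
theorem second_diff_arith {K β κ κ' A B w n h a c N : ℝ} (hβ : 0 ≤ β) (hK : 0 ≤ K)
    (hβ1 : β ≤ 1) (hκ0 : 0 ≤ κ) (hκ1 : κ ≤ 1) (hw : w ^ 2 ≤ 1) (hB1 : B ≤ 1)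
    (hn : n ≤ A + β) (hN0 : 0 ≤ N) (hN : N ≤ B + β) (hh0 : 0 ≤ h) (hh : h ≤ κ ^ 2) (ha : a ^ 2 ≤ h)
    (hc : c ^ 2 ≤ w ^ 2 * a ^ 2 + 3 * κ * h) (s1 : ℝ) (hs1 : 0 ≤ s1) (hAB : B * w ^ 2 = A)
    (hκ' : (2 * s1 + 4 * K) * β + 26 * K * κ ≤ κ') :
    2 * s1 * n * h + K * N * (h ^ 2 + 4 * c ^ 2) ≤ 2 * s1 * A * h + 4 * K * A * a ^ 2 + κ' * h := by
  have h1 : n * h ≤ (A + β) * h := by gcongr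
  have h2 : h ^ 2 ≤ κ * h := by
    have : h ≤ κ := hh.trans (by nlinarith)
    nlinarith
  have hκh : 0 ≤ κ * h := by positivity
  have h3 : N * (h ^ 2 + 4 * c ^ 2) ≤ N * (13 * κ * h) + N * (4 * (w ^ 2 * a ^ 2)) := by
    rw [← mul_add]
    refine mul_le_mul_of_nonneg_left ?_ hN0
    linarith
  have h4 : N * (13 * κ * h) ≤ 2 * (13 * κ * h) := by
    have : N ≤ 2 := by linarith
    have : 0 ≤ 13 * κ * h := by positivity
    gcongr
  have hwa : 0 ≤ w ^ 2 * a ^ 2 := by positivity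
  have h5 : N * (4 * (w ^ 2 * a ^ 2)) ≤ (B + β) * (4 * (w ^ 2 * a ^ 2)) := by gcongr
  have h6 : w ^ 2 * a ^ 2 ≤ h := (mul_le_of_le_one_left (sq_nonneg a) hw).trans ha
  have h7 : β * (4 * (w ^ 2 * a ^ 2)) ≤ β * (4 * h) := by gcongr
  have h8 : K * (N * (h ^ 2 + 4 * c ^ 2)) ≤ K * (26 * κ * h + 4 * A * a ^ 2 + β * (4 * h)) := by
    refine mul_le_mul_of_nonneg_left ?_ hK
    have e : B * (4 * (w ^ 2 * a ^ 2)) = 4 * A * a ^ 2 := by rw [← hAB]; ring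
    linarith
  have h9 := mul_le_mul_of_nonneg_left h1 (show 0 ≤ 2 * s1 by positivity)
  have h10 := mul_le_mul_of_nonneg_right hκ' hh0
  linarith

theorem exists_rpow_modulus {p : ℝ} (hp : 0 < p) {β : ℝ} (hβ : 0 < β) : ∃ κ₀ > 0, ∀ κ, |κ| < κ₀ →
    ∀ w ∈ Icc (0:ℝ) 1, ((w + κ) ^ 2) ^ p ≤ (w ^ 2) ^ p + β := by
  have key := (isCompact_Icc (a := (0:ℝ)) (b := 1)).eventually_forall_of_forall_eventually
    (x₀ := (0:ℝ)) (P := fun κ w => ((w + κ) ^ 2) ^ p < (w ^ 2) ^ p + β) ?_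
  · obtain ⟨ε, hε, h⟩ := Metric.eventually_nhds_iff.1 key
    exact ⟨ε, hε, fun κ hκ w hw => (h (y := κ) (by simpa using hκ) w hw).le⟩
  · intro w _
    have c1 : Continuous fun z : ℝ × ℝ => ((z.2 + z.1) ^ 2) ^ p :=
      Continuous.rpow_const (by fun_prop) fun _ => Or.inr hp.le
    have c2 : Continuous fun z : ℝ × ℝ => (z.2 ^ 2) ^ p + β :=
      (Continuous.rpow_const (by fun_prop) fun _ => Or.inr hp.le).add continuous_const
    refine c1.continuousAt.eventually_lt c2.continuousAt ?_
    simp only [add_zero]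
    linarith

/-- The right side is the second derivative of |·|^(2s+2) at the real point w plus an error. The
tolerance κ is uniform in w, including w = 0, since the powers involved are uniformly continuous on
[0, 1]. -/
theorem exists_second_diff_le (hs : 1 < s) {κ' : ℝ} (hκ' : 0 < κ') : ∃ κ > 0, ∀ w ∈ Icc (0:ℝ) 1,
    ∀ U H : ℂ, ‖U - w‖ ≤ κ → ‖H‖ ≤ κ →
      ‖U + H‖ ^ (2 * s + 2) + ‖U - H‖ ^ (2 * s + 2) - 2 * ‖U‖ ^ (2 * s + 2)
        ≤ 2 * (s + 1) * w ^ (2 * s) * ((2 * s + 1) * H.re ^ 2 + H.im ^ 2) + κ' * ‖H‖ ^ 2 := by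
  have hs0 : 0 < s := by linarith
  obtain ⟨β, hβ, hβ1, hβκ⟩ : ∃ β > 0, β ≤ 1 ∧ (2 * (s + 1) + 4 * (s * (s + 1))) * β ≤ κ' / 2 := by
    refine ⟨min 1 (κ' / 2 / (2 * (s + 1) + 4 * (s * (s + 1)))), by positivity, min_le_left _ _, ?_⟩
    have h := min_le_right 1 (κ' / 2 / (2 * (s + 1) + 4 * (s * (s + 1))))
    rwa [le_div_iff₀' (by positivity)] at h
  obtain ⟨κ₁, hκ₁, h1⟩ := exists_rpow_modulus hs0 hβ
  obtain ⟨κ₂, hκ₂, h2⟩ := exists_rpow_modulus (show 0 < s - 1 by linarith) hβ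
  obtain ⟨κ, hκ, hle1, hle2, hle3, hle4⟩ : ∃ κ > 0, κ < κ₁ ∧ 2 * κ < κ₂ ∧ κ ≤ 1 ∧
      26 * (s * (s + 1)) * κ ≤ κ' / 2 := by
    refine ⟨min (min (κ₁ / 2) (κ₂ / 4)) (min 1 (κ' / 2 / (26 * (s * (s + 1))))), by positivity,
      ?_, ?_, (min_le_right _ _).trans (min_le_left _ _), ?_⟩
    · exact ((min_le_left _ _).trans (min_le_left _ _)).trans_lt (by linarith)
    · have : min (min (κ₁ / 2) (κ₂ / 4)) (min 1 (κ' / 2 / (26 * (s * (s + 1))))) ≤ κ₂ / 4 :=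
        (min_le_left _ _).trans (min_le_right _ _)
      linarith
    · have h : min (min (κ₁ / 2) (κ₂ / 4)) (min 1 (κ' / 2 / (26 * (s * (s + 1)))))
        ≤ κ' / 2 / (26 * (s * (s + 1))) := (min_le_right _ _).trans (min_le_right _ _)
      rwa [le_div_iff₀' (by positivity)] at h
  refine ⟨κ, hκ, fun w hw U H hU hH => (norm_rpow_second_diff_le hs U H).trans ?_⟩
  have hUw : ‖U‖ ≤ w + κ := by
    have := norm_le_norm_add_norm_sub' U (w : ℂ)
    rw [Complex.norm_real, Real.norm_of_nonneg hw.1] at this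
    linarith
  have hw2 : w ^ 2 ≤ 1 := by nlinarith [hw.1, hw.2]
  have hB1 : (w ^ 2) ^ (s - 1) ≤ 1 := Real.rpow_le_one (sq_nonneg _) hw2 (by linarith)
  have hn : (‖U‖ ^ 2) ^ s ≤ (w ^ 2) ^ s + β := by
    refine le_trans ?_ (h1 κ (by rwa [abs_of_pos hκ]) w hw)
    gcongr
  have hN : ((‖U‖ + ‖H‖) ^ 2) ^ (s - 1) ≤ (w ^ 2) ^ (s - 1) + β := by
    refine le_trans ?_ (h2 (2 * κ) (by rwa [abs_of_pos (by positivity)]) w hw)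
    refine Real.rpow_le_rpow (sq_nonneg _) ?_ (by linarith)
    exact pow_le_pow_left₀ (by positivity) (by linarith) 2
  have hAB : (w ^ 2) ^ (s - 1) * w ^ 2 = (w ^ 2) ^ s := by
    rw [← Real.rpow_add_one' (sq_nonneg _) (by linarith), sub_add_cancel]
  have hA : w ^ (2 * s) = (w ^ 2) ^ s := by
    rw [← Real.rpow_natCast, ← Real.rpow_mul hw.1]; norm_num
  have hsq : H.re ^ 2 + H.im ^ 2 = ‖H‖ ^ 2 := by
    rw [← Complex.normSq_eq_norm_sq, Complex.normSq_apply]; ring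
  have hc : (inner ℝ U H) ^ 2 ≤ w ^ 2 * H.re ^ 2 + 3 * κ * ‖H‖ ^ 2 := by
    have e : inner ℝ U H = w * H.re + inner ℝ (U - w) H := by
      rw [inner_sub_left]
      have : inner ℝ (w : ℂ) H = w * H.re := by
        rw [Complex.inner, Complex.conj_ofReal, mul_comm]
        exact Complex.re_ofReal_mul _ _
      rw [this]; ring
    have h5 : |inner ℝ (U - w) H| ≤ κ * ‖H‖ :=
      (abs_real_inner_le_norm _ _).trans (by gcongr)
    have h6 : |w * H.re| ≤ ‖H‖ := by
      rw [abs_mul, abs_of_nonneg hw.1]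
      exact (mul_le_of_le_one_left (abs_nonneg _) hw.2).trans (Complex.abs_re_le_norm H)
    rw [e]
    have h7 : (inner ℝ (U - w) H) ^ 2 ≤ (κ * ‖H‖) ^ 2 := sq_le_sq' (by
      linarith [(abs_le.1 h5).1]) (abs_le.1 h5).2
    have h8 : w * H.re * inner ℝ (U - w) H ≤ ‖H‖ * (κ * ‖H‖) := by
      refine (le_abs_self _).trans ?_
      rw [abs_mul]
      gcongr
    have h9 : (κ * ‖H‖) ^ 2 ≤ κ * ‖H‖ ^ 2 := by
      have : κ ^ 2 ≤ κ := by nlinarith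
      rw [mul_pow]; gcongr
    nlinarith
  have key := second_diff_arith (K := s * (s + 1)) (s1 := s + 1) hβ.le (by positivity) hβ1 hκ.le
    hle3 hw2 hB1 hn (by positivity) hN (sq_nonneg ‖H‖) (by gcongr)
    (show H.re ^ 2 ≤ ‖H‖ ^ 2 by rw [← hsq]; linarith [sq_nonneg H.im]) hc (by positivity) hAB
    (κ' := κ') (by linarith)
  refine key.trans_eq ?_
  rw [hA, ← hsq]
  ring

/-- The quadratic form of the potential energy at the soliton. -/
noncomputable def vq (s : ℝ) (v : ℝ → ℂ) : ℝ :=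
  ∫ x, (s + 1) * ((1 - st s x ^ 2) * ((2 * s + 1) * (v x).re ^ 2 + (v x).im ^ 2))

theorem integrable_vq (s : ℝ) {v : ℝ → ℂ} (hv : MemLp v 2) : Integrable fun x =>
    (s + 1) * ((1 - st s x ^ 2) * ((2 * s + 1) * (v x).re ^ 2 + (v x).im ^ 2)) := by
  have h1 : Integrable fun x => (v x).re ^ 2 := hv.re.integrable_sq
  have h2 : Integrable fun x => (v x).im ^ 2 := hv.im.integrable_sq
  exact (integrable_bdd_mul (continuous_const.sub ((continuous_st s).pow 2))
    (abs_one_sub_st_sq_le s) ((h1.const_mul (2 * s + 1)).add h2)).const_mul (s + 1)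

theorem vq_le (hs : 1 < s) {v : ℝ → ℂ} (hv : MemLp v 2) :
    vq s v ≤ (s + 1) * (2 * s + 1) * ∫ x, ‖v x‖ ^ 2 := by
  have hi := (memLp_two_iff_integrable_sq_norm hv.1).1 hv
  rw [vq, ← integral_const_mul]
  refine integral_mono (integrable_vq s hv) (hi.const_mul _) fun x => ?_
  simp only
  rw [← Complex.normSq_eq_norm_sq, Complex.normSq_apply, mul_assoc]
  have h1 := sq_nonneg (st s x)
  have h2 := st_sq_lt_one s x
  have h3 : (1 - st s x ^ 2) * ((2 * s + 1) * (v x).re ^ 2 + (v x).im ^ 2)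
      ≤ 1 * ((2 * s + 1) * (v x).re ^ 2 + (v x).im ^ 2) := by
    have : 0 ≤ (2 * s + 1) * (v x).re ^ 2 + (v x).im ^ 2 := by positivity
    gcongr; linarith
  have h4 : 0 ≤ 2 * s * (v x).im ^ 2 := by positivity
  refine mul_le_mul_of_nonneg_left ?_ (by positivity)
  linarith

theorem vq_add_le (hs : 1 < s) {v w : ℝ → ℂ} (hv : MemLp v 2) (hw : MemLp w 2) {θ : ℝ}
    (hθ : 0 < θ) : vq s (fun x => v x + w x) ≤ (1 + θ) * vq s v + (1 + θ⁻¹) * vq s w := by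
  rw [vq, vq, vq, ← integral_const_mul, ← integral_const_mul,
    ← integral_add ((integrable_vq s hv).const_mul _) ((integrable_vq s hw).const_mul _)]
  refine integral_mono (integrable_vq s (hv.add hw)) (((integrable_vq s hv).const_mul _).add
    ((integrable_vq s hw).const_mul _)) fun x => ?_
  simp only [Complex.add_re, Complex.add_im]
  have key : ∀ a b : ℝ, (a + b) ^ 2 ≤ (1 + θ) * a ^ 2 + (1 + θ⁻¹) * b ^ 2 := fun a b => by
    have h : 0 ≤ θ⁻¹ * (θ * a - b) ^ 2 := by positivity
    have e : θ⁻¹ * (θ * a - b) ^ 2 = θ * a ^ 2 - 2 * a * b + θ⁻¹ * b ^ 2 := by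
      field_simp; ring
    linarith
  have h1 := key (v x).re (w x).re
  have h2 := key (v x).im (w x).im
  have h3 : 0 ≤ 1 - st s x ^ 2 := by linarith [st_sq_lt_one s x]
  have h4 : (s + 1) * ((1 - st s x ^ 2) * ((2 * s + 1) * ((v x).re + (w x).re) ^ 2
        + ((v x).im + (w x).im) ^ 2))
      ≤ (s + 1) * ((1 - st s x ^ 2) * ((2 * s + 1) * ((1 + θ) * (v x).re ^ 2
        + (1 + θ⁻¹) * (w x).re ^ 2) + ((1 + θ) * (v x).im ^ 2 + (1 + θ⁻¹) * (w x).im ^ 2))) := by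
    gcongr
  refine h4.trans_eq ?_
  ring

/-- L¹ smallness on the Fourier side gives uniform smallness in x, so the pointwise expansion around
w(x) holds everywhere and can be integrated. -/
theorem pot_second_diff_le (hs : 1 < s) (hs2 : s < 2) {κ κ' : ℝ}
    (hκ : ∀ w ∈ Icc (0:ℝ) 1, ∀ U H : ℂ, ‖U - w‖ ≤ κ → ‖H‖ ≤ κ →
      ‖U + H‖ ^ (2 * s + 2) + ‖U - H‖ ^ (2 * s + 2) - 2 * ‖U‖ ^ (2 * s + 2)
        ≤ 2 * (s + 1) * w ^ (2 * s) * ((2 * s + 1) * H.re ^ 2 + H.im ^ 2) + κ' * ‖H‖ ^ 2)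
    {u h : ℝ → ℂ} (hu : Adm s u) (hh : Adm s h) (hu' : ∫ ξ, ‖u ξ - fsw s ξ‖ ≤ κ)
    (hh' : ∫ ξ, ‖h ξ‖ ≤ κ) :
    pot s (fun ξ => u ξ + h ξ) + pot s (fun ξ => u ξ - h ξ) - 2 * pot s u
      ≤ 2 * vq s (𝓕⁻ h) + κ' * nsq h := by
  have hs0 : 0 < s := by linarith
  have iu := hu.integrable hs
  have ih := hh.integrable hs
  have mh := memLp_fourierInv ih hh.memLp
  have jh := (memLp_two_iff_integrable_sq_norm mh.1).1 mh
  have e1 := integral_linear_comb ((hu.add hh).integrable_pot hs) ((hu.sub hh).integrable_pot hs)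
    (hu.integrable_pot hs) 1 1 (-2)
  have e2 := integral_linear_comb (integrable_vq s mh) jh jh 2 κ' 0
  rw [integral_norm_sq_fourierInv ih hh.memLp] at e2
  have e3 : pot s (fun ξ => u ξ + h ξ) + pot s (fun ξ => u ξ - h ξ) - 2 * pot s u
    = 1 * pot s (fun ξ => u ξ + h ξ) + 1 * pot s (fun ξ => u ξ - h ξ) + (-2) * pot s u := by ring
  have e4 : 2 * vq s (𝓕⁻ h) + κ' * nsq h = 2 * vq s (𝓕⁻ h) + κ' * nsq h + 0 * nsq h := by ring
  rw [e3, e4]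
  refine e1.symm.trans_le (le_of_le_of_eq ?_ e2)
  refine integral_mono (((((hu.add hh).integrable_pot hs).const_mul 1).add
    (((hu.sub hh).integrable_pot hs).const_mul 1)).add ((hu.integrable_pot hs).const_mul (-2)))
    ((((integrable_vq s mh).const_mul 2).add (jh.const_mul κ')).add (jh.const_mul 0)) fun x => ?_
  simp only
  rw [fourierInv_add' iu ih, fourierInv_sub' iu ih]
  have h1 : ‖𝓕⁻ u x - (sw s x : ℂ)‖ ≤ κ := by
    rw [← fourierInv_fsw hs, ← fourierInv_sub' iu (integrable_fsw hs)]
    exact (norm_fourierInv_le _ _).trans hu'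
  have h2 := hκ (sw s x) ⟨(sw_pos s x).le, sw_le_one hs0 x⟩ _ _ h1
    ((norm_fourierInv_le h x).trans hh')
  rw [sw_rpow hs0] at h2
  linarith

theorem sob_re {v v' : ℝ → ℂ} (h : CSob v v') : Sob (fun x => (v x).re) fun x => (v' x).re where
  deriv x := Complex.reCLM.hasFDerivAt.comp_hasDerivAt x (h.deriv x)
  memLp := h.memLp.re
  memLp' := h.memLp'.re
  tendsto := (Complex.continuous_re.tendsto' 0 0 Complex.zero_re).comp h.tendsto

theorem sob_im {v v' : ℝ → ℂ} (h : CSob v v') : Sob (fun x => (v x).im) fun x => (v' x).im where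
  deriv x := Complex.imCLM.hasFDerivAt.comp_hasDerivAt x (h.deriv x)
  memLp := h.memLp.im
  memLp' := h.memLp'.im
  tendsto := (Complex.continuous_im.tendsto' 0 0 Complex.zero_im).comp h.tendsto

theorem integral_re_sq_add_im_sq {v : ℝ → ℂ} (hv : MemLp v 2) :
    (∫ x, (v x).re ^ 2) + (∫ x, (v x).im ^ 2) = ∫ x, ‖v x‖ ^ 2 := by
  have h1 : Integrable fun x => (v x).re ^ 2 := hv.re.integrable_sq
  have h2 : Integrable fun x => (v x).im ^ 2 := hv.im.integrable_sq
  rw [← integral_add h1 h2]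
  refine integral_congr_ae (Eventually.of_forall fun x => ?_)
  simp only
  rw [← Complex.normSq_eq_norm_sq, Complex.normSq_apply]
  ring

/-- Coercivity of the linearization at the soliton, for complex valued functions. -/
theorem exists_coercive_complex (hs : 1 < s) (hs2 : s < 2) : ∃ c C : ℝ, 0 < c ∧ 0 ≤ C ∧
    ∀ v v' : ℝ → ℂ, CSob v v' → c * (∫ x, ‖v x‖ ^ 2) ≤
      (∫ x, ‖v' x‖ ^ 2) + (∫ x, ‖v x‖ ^ 2) - vq s v
      + C * ((∫ x, (v x).re * sw s x) ^ 2 + (∫ x, (v x).re * dsw s x) ^ 2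
        + (∫ x, (v x).im * sw s x) ^ 2) := by
  obtain ⟨c, C, hc, hC, h⟩ := exists_coercive hs hs2
  refine ⟨c, C, hc, hC, fun v v' hv => ?_⟩
  have ha := sob_re hv
  have hb := sob_im hv
  have h1 := h _ _ _ _ ha hb
  rw [integral_re_sq_add_im_sq hv.memLp] at h1
  have e : bl s ((s + 1) * (2 * s + 1)) (fun x => (v x).re) (fun x => (v' x).re)
      (fun x => (v x).re) (fun x => (v' x).re) + bl s (s + 1) (fun x => (v x).im)
      (fun x => (v' x).im) (fun x => (v x).im) (fun x => (v' x).im)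
      = (∫ x, ‖v' x‖ ^ 2) + (∫ x, ‖v x‖ ^ 2) - vq s v := by
    rw [bl, bl, ← integral_add (integrable_bl s _ ha ha) (integrable_bl s _ hb hb), vq]
    have e1 := integral_linear_comb hv.integrable_deriv_sq hv.integrable_sq
      (integrable_vq s hv.memLp) 1 1 (-1)
    rw [one_mul, one_mul, neg_one_mul, ← sub_eq_add_neg] at e1
    rw [← e1]
    refine integral_congr_ae (Eventually.of_forall fun x => ?_)
    simp only [← Complex.normSq_eq_norm_sq, Complex.normSq_apply]
    ring
  linarith

theorem norm_integral_inner_sq_le {F G : ℝ → ℂ} (hF : MemLp F 2) (hG : MemLp G 2) :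
    ‖∫ ξ, inner ℂ (F ξ) (G ξ)‖ ^ 2 ≤ nsq F * nsq G := by
  have h1 : inner ℂ (hF.toLp F) (hG.toLp G) = ∫ ξ, inner ℂ (F ξ) (G ξ) := by
    rw [L2.inner_def]
    refine integral_congr_ae ?_
    filter_upwards [hF.coeFn_toLp, hG.coeFn_toLp] with ξ h1 h2
    rw [h1, h2]
  have h2 : ∀ {K : ℝ → ℂ} (hK : MemLp K 2), ‖hK.toLp K‖ ^ 2 = nsq K := fun {K} hK => by
    have h3 : (inner ℂ (hK.toLp K) (hK.toLp K) : ℂ) = ∫ ξ, inner ℂ (K ξ) (K ξ) := by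
      rw [L2.inner_def]
      refine integral_congr_ae ?_
      filter_upwards [hK.coeFn_toLp] with ξ h1
      rw [h1]
    simp_rw [inner_self_eq_norm_sq_to_K] at h3
    norm_cast at h3
  rw [← h1, ← h2 hF, ← h2 hG, ← mul_pow]
  gcongr
  exact norm_inner_le_norm _ _

end

/-! ### Midpoint comparison and local uniqueness -/

section
variable {s : ℝ}

theorem Adm.integrable_inner {F G : ℝ → ℂ} (hF : Adm s F) (hG : Adm s G) :
    Integrable fun ξ => inner ℂ (F ξ) (G ξ) := by
  simp_rw [RCLike.inner_apply]
  exact hG.memLp.integrable_mul hF.memLp.star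

theorem Adm.nsq_parallelogram {u h : ℝ → ℂ} (hu : Adm s u) (hh : Adm s h) :
    nsq (fun ξ => u ξ + h ξ) + nsq (fun ξ => u ξ - h ξ) = 2 * nsq u + 2 * nsq h := by
  rw [nsq, nsq, nsq, nsq, ← integral_add (hu.add hh).int_sq (hu.sub hh).int_sq,
    ← integral_const_mul, ← integral_const_mul,
    ← integral_add (hu.int_sq.const_mul 2) (hh.int_sq.const_mul 2)]
  refine integral_congr_ae (Eventually.of_forall fun ξ => ?_)
  have := parallelogram_law_with_norm ℂ (u ξ) (h ξ)
  simp only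
  linarith

theorem Adm.ten_parallelogram (hs : 1 < s) (hs2 : s < 2) {ε : ℝ} {u h : ℝ → ℂ} (hu : Adm s u)
    (hh : Adm s h) :
    ten s ε (fun ξ => u ξ + h ξ) + ten s ε (fun ξ => u ξ - h ξ) = 2 * ten s ε u + 2 * ten s ε h := by
  rw [ten, ten, ten, ten, ← integral_add ((hu.add hh).integrable_ten hs hs2)
    ((hu.sub hh).integrable_ten hs hs2), ← integral_const_mul, ← integral_const_mul,
    ← integral_add ((hu.integrable_ten hs hs2).const_mul 2)
      ((hh.integrable_ten hs hs2).const_mul 2)]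
  refine integral_congr_ae (Eventually.of_forall fun ξ => ?_)
  have := parallelogram_law_with_norm ℂ (u ξ) (h ξ)
  simp only
  linear_combination sym s ε ξ * this

theorem Adm.re_integral_inner_eq {u h : ℝ → ℂ} (hu : Adm s u) (hh : Adm s h) :
    4 * (∫ ξ, inner ℂ (u ξ) (h ξ)).re
      = nsq (fun ξ => u ξ + h ξ) - nsq (fun ξ => u ξ - h ξ) := by
  have e : (∫ ξ, RCLike.re (inner ℂ (u ξ) (h ξ))) = (∫ ξ, inner ℂ (u ξ) (h ξ)).re :=
    integral_re (hu.integrable_inner hh)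
  rw [← e, nsq, nsq, ← integral_sub (hu.add hh).int_sq (hu.sub hh).int_sq, ← integral_const_mul]
  refine integral_congr_ae (Eventually.of_forall fun ξ => ?_)
  have h1 := @norm_add_sq ℂ _ _ _ _ (u ξ) (h ξ)
  have h2 := @norm_sub_sq ℂ _ _ _ _ (u ξ) (h ξ)
  simp only
  linarith

theorem ten_const_mul (s ε : ℝ) (c : ℂ) (G : ℝ → ℂ) :
    ten s ε (fun ξ => c * G ξ) = ‖c‖ ^ 2 * ten s ε G := by
  simp_rw [ten, norm_mul, mul_pow]; rw [← integral_const_mul]; congr 1; ext; ring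

/-- The energy inequality obtained by comparing two minimizers with their midpoint. -/
theorem IsMin.midpoint (hs : 1 < s) (hs2 : s < 2) {ε : ℝ} {u h : ℝ → ℂ} (hu : Adm s u)
    (hh : Adm s h) (h1 : IsMin s ε fun ξ => u ξ + h ξ) (h2 : IsMin s ε fun ξ => u ξ - h ξ)
    (hpos : 0 < FracNLS.nsq u) :
    ten s ε h + FracNLS.nsq h / FracNLS.nsq u * ((s + 1) * pot s u - ten s ε u)
      ≤ 2⁻¹ * (pot s (fun ξ => u ξ + h ξ) + pot s (fun ξ => u ξ - h ξ) - 2 * pot s u) := by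
  have p1 := hu.nsq_parallelogram hh
  have p2 := hu.ten_parallelogram hs hs2 (ε := ε) hh
  rw [h1.nsq, h2.nsq] at p1
  obtain ⟨r, hr⟩ : ∃ r, r = FracNLS.nsq h / FracNLS.nsq u := ⟨_, rfl⟩
  have hr0 : 0 ≤ r := by rw [hr]; exact div_nonneg (nsq_nonneg h) hpos.le
  have hm : (1 + r) * FracNLS.nsq u = m0 s := by rw [hr]; field_simp; linarith
  have hsq : ‖((√(1 + r) : ℝ) : ℂ)‖ ^ 2 = 1 + r := by
    rw [Complex.norm_real, Real.norm_of_nonneg (Real.sqrt_nonneg _), Real.sq_sqrt (by linarith)]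
  have hp : ‖((√(1 + r) : ℝ) : ℂ)‖ ^ (2 * s + 2) = (1 + r) ^ (s + 1) := by
    conv_rhs => rw [← hsq, ← Real.rpow_natCast, ← Real.rpow_mul (norm_nonneg _)]
    push_cast; ring_nf
  -- Bernoulli's inequality linearizes the potential energy in r; the factor (s+1) `pot` - `ten`
  -- takes the place of the Lagrange multiplier.
  have hB := one_add_mul_self_le_rpow_one_add (s := r) (p := s + 1) (by linarith) (by linarith)
  have t1 := h1.le _ (hu.const_mul ((√(1 + r) : ℝ) : ℂ)) (by rw [nsq_const_mul, hsq, hm])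
  have t2 := h2.le _ (hu.const_mul ((√(1 + r) : ℝ) : ℂ)) (by rw [nsq_const_mul, hsq, hm])
  have e : en s ε (fun ξ => ((√(1 + r) : ℝ) : ℂ) * u ξ)
      = (1 + r) * ten s ε u - (1 + r) ^ (s + 1) * pot s u := by
    rw [en, ten_const_mul, pot_const_mul, hsq, hp]
  rw [e] at t1 t2
  rw [en] at t1 t2
  have hB' := mul_le_mul_of_nonneg_right hB (pot_nonneg s u)
  rw [← hr]
  linarith

/-- Interpolation: with the homogeneous form bounded, `integral_norm_rpow_le` turns L² smallness
into L¹ smallness on the Fourier side, through the positive power s - 1 of the mass. -/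
theorem exists_pot_near (hs : 1 < s) (hs2 : s < 2) {K μ : ℝ} (hK : 0 < K) (hμ : 0 < μ) :
    ∃ δ > 0, ∀ X, Adm s X → hom s X ≤ K → nsq X ≤ m0 s → nsq (fun ξ => X ξ - fsw s ξ) ≤ δ →
      |pot s X - p0 s| ≤ μ ∧ ∫ ξ, ‖X ξ - fsw s ξ‖ ≤ μ := by
  have hm := m0_pos hs
  have hg := gnConst_pos s
  have hF := adm_fsw hs hs2
  have hhF := hom_nonneg s (fsw s)
  have hs1 : 0 < s - 1 := by linarith
  obtain ⟨Λ, hΛ⟩ : ∃ Λ, Λ = gnConst s * ((K + hom s (fsw s)) * m0 s ^ (s - 1)) := ⟨_, rfl⟩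
  have hΛ0 : 0 < Λ := by rw [hΛ]; positivity
  obtain ⟨θ, hθ, hθe⟩ : ∃ θ > 0, (2 * s + 2) * Λ * (θ * m0 s + θ * m0 s) = μ / 2 :=
    ⟨μ / 2 / ((2 * s + 2) * Λ * (2 * m0 s)), by positivity, by field_simp; ring⟩
  obtain ⟨d, hd, hde⟩ : ∃ d > 0, (2 * s + 2) * Λ * ((2 * θ)⁻¹ * d) = μ / 2 :=
    ⟨μ / 2 / ((2 * s + 2) * Λ * (2 * θ)⁻¹), by positivity, by field_simp⟩
  obtain ⟨d', hd', hde'⟩ : ∃ d' > 0,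
      gnConst s * ((2 * K + 2 * hom s (fsw s)) * d' ^ (s - 1)) = μ ^ (2 * s) := by
    refine ⟨(μ ^ (2 * s) / (gnConst s * (2 * K + 2 * hom s (fsw s)))) ^ (s - 1)⁻¹,
      by positivity, ?_⟩
    rw [Real.rpow_inv_rpow (by positivity) hs1.ne']
    field_simp
  refine ⟨min d d', by positivity, fun X hX hXK hXm hXδ => ⟨?_, ?_⟩⟩
  · rw [← pot_fsw hs]
    have b1 : (∫ ξ, ‖X ξ‖) ^ (2 * s) ≤ Λ := by
      refine (integral_norm_rpow_le hs hX).trans ?_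
      rw [hΛ]
      have h1 := nsq_nonneg X
      have h2 := hom_nonneg s X
      gcongr
      linarith
    have b2 : (∫ ξ, ‖fsw s ξ‖) ^ (2 * s) ≤ Λ := by
      refine (integral_norm_rpow_le hs hF).trans ?_
      rw [hΛ, nsq_fsw hs]
      gcongr
      linarith
    refine (abs_pot_sub_le hs hX hF hθ b1 b2).trans ?_
    rw [nsq_fsw hs]
    have h3 := hXδ.trans (min_le_left _ _)
    calc _ ≤ (2 * s + 2) * Λ * (θ * m0 s + θ * m0 s + (2 * θ)⁻¹ * d) := by gcongr
      _ = (2 * s + 2) * Λ * (θ * m0 s + θ * m0 s) + (2 * s + 2) * Λ * ((2 * θ)⁻¹ * d) := by ring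
      _ = μ := by rw [hθe, hde]; ring
  · have h1 := integral_norm_rpow_le hs (hX.sub hF)
    have h2 : (∫ ξ, ‖X ξ - fsw s ξ‖) ^ (2 * s) ≤ μ ^ (2 * s) := by
      refine h1.trans ?_
      rw [← hde']
      have h3 := hX.hom_sub_le hF
      have h4 := nsq_nonneg fun ξ => X ξ - fsw s ξ
      have h5 := hom_nonneg s fun ξ => X ξ - fsw s ξ
      have h6 := hXδ.trans (min_le_right _ _)
      gcongr
      linarith
    exact (Real.rpow_le_rpow_iff (integral_nonneg fun _ => norm_nonneg _) hμ.le
      (by linarith)).1 h2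

theorem memLp_fdsw (hs : 1 < s) : MemLp (fdsw s) 2 ∧ nsq (fdsw s) = t0 s := by
  have e : ∀ ξ, ‖fdsw s ξ‖ ^ 2 = (2 * Real.pi * ξ) ^ 2 * ‖fsw s ξ‖ ^ 2 := fun ξ => by
    rw [fdsw_eq hs, norm_mul, mul_pow]
    congr 1
    simp [mul_pow]
  refine ⟨(memLp_two_iff_integrable_sq_norm ?_).2 ?_, ?_⟩
  · have hc := continuous_fsw hs
    have : fdsw s = fun ξ : ℝ => (2 * Real.pi * Complex.I * ξ) * fsw s ξ := funext (fdsw_eq hs)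
    rw [this]
    exact Continuous.aestronglyMeasurable (by fun_prop)
  · simp_rw [e]
    -- A non-integrable function has integral 0 by convention, while this integral equals t0 > 0.
    by_contra hc
    have h1 := integral_sq_mul_fsw hs
    rw [integral_undef hc] at h1
    exact (t0_pos hs).ne h1
  · rw [nsq, ← integral_sq_mul_fsw hs]
    simp_rw [e]

/-- The components of a low frequency truncation along the soliton and its derivative. -/
theorem Adm.low_components_le (hs : 1 < s) (hs2 : s < 2) {h : ℝ → ℂ} (hh : Adm s h) (R : ℝ)
    (him : (∫ ξ, inner ℂ (fsw s ξ) (h ξ)).im = 0) (hre : (∫ ξ, inner ℂ (fdsw s ξ) (h ξ)).re = 0) :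
    (∫ x, (𝓕⁻ (FracNLS.low R h) x).re * sw s x) ^ 2
      + (∫ x, (𝓕⁻ (FracNLS.low R h) x).re * dsw s x) ^ 2
      + (∫ x, (𝓕⁻ (FracNLS.low R h) x).im * sw s x) ^ 2
    ≤ 2 * (∫ ξ, inner ℂ (fsw s ξ) (h ξ)).re ^ 2 + 6 * m0 s * nsq (FracNLS.high R h) := by
  have hs0 : 0 < s := by linarith
  have hF := adm_fsw hs hs2
  obtain ⟨hdF, hdn⟩ := memLp_fdsw hs
  have aL := hh.low R
  have aH := hh.high R
  have iL := aL.integrable hs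
  have mL := memLp_fourierInv iL aL.memLp
  -- The overlap with h splits into a low frequency part, evaluated in physical space where
  -- coercivity is stated, and a high frequency remainder, controlled by Cauchy–Schwarz.
  have gen : ∀ {f : ℝ → ℝ}, Dec f → Continuous f → MemLp (𝓕 fun x => (f x : ℂ)) 2 →
      (∫ ξ, inner ℂ (𝓕 (fun x => (f x : ℂ)) ξ) (h ξ))
        = (((∫ x, (𝓕⁻ (FracNLS.low R h) x).re * f x : ℝ) : ℂ)
          + ((∫ x, (𝓕⁻ (FracNLS.low R h) x).im * f x : ℝ) : ℂ) * Complex.I)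
        + ∫ ξ, inner ℂ (𝓕 (fun x => (f x : ℂ)) ξ) (FracNLS.high R h ξ) := by
    intro f hf hc hm
    have hint : ∀ {K : ℝ → ℂ}, Adm s K →
        Integrable fun ξ => inner ℂ (𝓕 (fun x => (f x : ℂ)) ξ) (K ξ) := fun hK => by
      simp_rw [RCLike.inner_apply]
      exact hK.memLp.integrable_mul hm.star
    have e1 : (∫ ξ, inner ℂ (𝓕 (fun x => (f x : ℂ)) ξ) (h ξ))
        = (∫ ξ, inner ℂ (𝓕 (fun x => (f x : ℂ)) ξ) (FracNLS.low R h ξ))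
        + ∫ ξ, inner ℂ (𝓕 (fun x => (f x : ℂ)) ξ) (FracNLS.high R h ξ) := by
      rw [← integral_add (hint aL) (hint aH)]
      simp_rw [← inner_add_right, low_add_high]
    rw [e1, integral_inner_fourier_left (hf.integrable_ofReal hc) iL]
    congr 1
    have hi : Integrable fun x => inner ℂ (f x : ℂ) (𝓕⁻ (FracNLS.low R h) x) := by
      simp_rw [RCLike.inner_apply]
      exact mL.integrable_mul (hf.memLp_ofReal hc).star
    rw [← integral_re_add_im hi]
    congr 2
    · congr 2; ext x; simp
    · congr 2
      ext x; simp
  have g1 := gen (dec_sw hs) (continuous_sw hs0) hF.memLp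
  have g2 := gen (dec_dsw hs) (continuous_dsw hs0) hdF
  have c1 := norm_integral_inner_sq_le hF.memLp aH.memLp
  have c2 := norm_integral_inner_sq_le hdF aH.memLp
  rw [nsq_fsw hs] at c1
  rw [hdn] at c2
  rw [fsw] at him c1 ⊢
  rw [fdsw] at hre c2
  rw [g1] at him ⊢
  rw [g2] at hre
  obtain ⟨z, hz⟩ : ∃ z, z = ∫ ξ, inner ℂ (𝓕 (fun x => (sw s x : ℂ)) ξ) (FracNLS.high R h ξ) :=
    ⟨_, rfl⟩
  obtain ⟨z', hz'⟩ : ∃ z, z = ∫ ξ, inner ℂ (𝓕 (fun x => (dsw s x : ℂ)) ξ) (FracNLS.high R h ξ) :=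
    ⟨_, rfl⟩
  rw [← hz] at him c1 ⊢
  rw [← hz'] at hre c2
  simp only [Complex.add_re, Complex.add_im, Complex.ofReal_re, Complex.ofReal_im, Complex.mul_re,
    Complex.mul_im, Complex.I_re, Complex.I_im, mul_zero, mul_one, zero_add, add_zero,
    sub_zero] at him hre ⊢
  rw [← Complex.normSq_eq_norm_sq, Complex.normSq_apply] at c1 c2
  have ht : t0 s * nsq (FracNLS.high R h) ≤ m0 s * nsq (FracNLS.high R h) := by
    have h1 := m0_eq hs
    have h2 : 0 < 2 / s * t0 s := mul_pos (by positivity) (t0_pos hs)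
    have := nsq_nonneg (FracNLS.high R h)
    gcongr
    linarith
  obtain ⟨A, hA⟩ : ∃ A, A = ∫ x, (𝓕⁻ (FracNLS.low R h) x).re * sw s x := ⟨_, rfl⟩
  obtain ⟨B, hB⟩ : ∃ A, A = ∫ x, (𝓕⁻ (FracNLS.low R h) x).re * dsw s x := ⟨_, rfl⟩
  obtain ⟨D, hD⟩ : ∃ A, A = ∫ x, (𝓕⁻ (FracNLS.low R h) x).im * sw s x := ⟨_, rfl⟩
  rw [← hB] at hre
  rw [← hD] at him
  rw [← hA, ← hB, ← hD]
  have hB' : B = -z'.re := by linarith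
  have hD' : D = -z.im := by linarith
  rw [hB', hD']
  have h0 : 0 ≤ m0 s * nsq (FracNLS.high R h) := mul_nonneg (m0_pos hs).le (nsq_nonneg _)
  nlinarith [sq_nonneg (A + 2 * z.re), sq_nonneg z.im, sq_nonneg z'.im, sq_nonneg z.re]

end

/-- Five errors of size at most c/10 are set against the coercivity constant c: expansion of the
potential, replacement of the symbol, splitting by θ, multiplier, and component along the soliton. B
is large enough to absorb every term in the high frequency mass νH. -/
theorem local_uniqueness_arith {c C m α θ K B k ν νL νH T V VL S t δ : ℝ} (hc : 0 < c)
    (hC : 0 ≤ C) (hν : 0 ≤ ν) (hsplit : νL + νH = ν) (hνH : 0 ≤ νH) (hK : 0 ≤ K) (hθ : 0 < θ)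
    (hmid : t + ν * (1 - α) ≤ V + c / 10 * ν)
    (hten : T + B * νH - k * ν ≤ t) (hV : V ≤ (1 + θ) * VL + (1 + θ⁻¹) * (K * νH))
    (hVL : VL ≤ K * νL) (hcoer : c * νL ≤ T + νL - VL + C * S) (hS : S ≤ 2 * (δ * ν) + 6 * m * νH)
    (hα : α ≤ c / 10) (hk : k = c / 10) (hθK : θ * K = c / 10) (hδ : 2 * C * δ ≤ c / 10)
    (hB : B = c + (1 + θ⁻¹) * K + 6 * C * m) : ν = 0 := by
  have h1 : C * S ≤ C * (2 * (δ * ν) + 6 * m * νH) := by gcongr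
  have h2 : θ * VL ≤ θ * (K * νL) := by gcongr
  have h3 : θ * K * νL ≤ θ * K * ν := by
    have : 0 ≤ θ * K := by positivity
    gcongr; linarith
  have h4 : α * ν ≤ c / 10 * ν := by gcongr
  have h5 : 2 * C * δ * ν ≤ c / 10 * ν := by gcongr
  rw [hk] at hten
  rw [hB] at hten
  rw [hθK] at h3
  have h6 : θ * (K * νL) = c / 10 * νL := by rw [← hθK]; ring
  have h7 : c * νL + c * νH = c * ν := by rw [← hsplit]; ring
  have h8 : c * ν ≤ 0 := by linarith
  exact le_antisymm (nonpos_of_mul_nonpos_right h8 hc) hν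

section
variable {s : ℝ} (hs : 1 < s) (hs2 : s < 2)
include hs hs2

/-- Two minimizers near the soliton that satisfy the orthogonality conditions agree. -/
theorem exists_locally_unique : ∃ δ > 0, ∃ ε₀ > 0, ∀ ε, 0 < ε → ε ≤ ε₀ → ∀ G₁ G₂,
    IsMin s ε G₁ → IsMin s ε G₂ → nsq (fun ξ => G₁ ξ - fsw s ξ) ≤ δ →
      nsq (fun ξ => G₂ ξ - fsw s ξ) ≤ δ → (∫ ξ, inner ℂ (fsw s ξ) (G₁ ξ)).im = 0 →
      (∫ ξ, inner ℂ (fsw s ξ) (G₂ ξ)).im = 0 → (∫ ξ, inner ℂ (fdsw s ξ) (G₁ ξ)).re = 0 →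
      (∫ ξ, inner ℂ (fdsw s ξ) (G₂ ξ)).re = 0 → G₁ =ᵐ[volume] G₂ := by
  have hm := m0_pos hs
  have hF := adm_fsw hs hs2
  obtain ⟨c, C, hc, hC, hcoer⟩ := exists_coercive_complex hs hs2
  obtain ⟨K, hK⟩ : ∃ K, K = (s + 1) * (2 * s + 1) := ⟨_, rfl⟩
  have hK0 : 0 < K := by rw [hK]; positivity
  obtain ⟨θ, hθ, hθK⟩ : ∃ θ > 0, θ * K = c / 10 := ⟨c / 10 / K, by positivity, by field_simp⟩
  obtain ⟨B, hB⟩ : ∃ B, B = c + (1 + θ⁻¹) * K + 6 * C * m0 s := ⟨_, rfl⟩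
  have hB0 : 0 < B := by rw [hB]; positivity
  obtain ⟨R, hR, hfar⟩ := exists_sym_ge hs hs2 hB0
  have hR0 : 0 < R := by linarith
  obtain ⟨ε₁, hε₁, hnear⟩ := exists_sym_near hs hR0 (show 0 < c / 10 / R ^ 2 by positivity)
  obtain ⟨κ, hκ, hsd⟩ := exists_second_diff_le hs (show 0 < c / 5 by positivity)
  -- The factor s + 3 collects the error of (s+1) `pot` - `ten` at u: s + 1 from the potential, and
  -- 2 from the energy and potential of the two minimizers.
  obtain ⟨μ, hμ, hμκ, hμα⟩ : ∃ μ > 0, μ ≤ κ ∧ (s + 3) * μ ≤ m0 s * min 1 (c / 10) := by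
    refine ⟨min κ (m0 s * min 1 (c / 10) / (s + 3)), by positivity, min_le_left _ _, ?_⟩
    have h := min_le_right κ (m0 s * min 1 (c / 10) / (s + 3))
    rwa [le_div_iff₀' (by positivity)] at h
  obtain ⟨ε₂, hε₂, Kh, hKh, hhom⟩ := exists_hom_le hs hs2
  obtain ⟨ε₃, hε₃, hen⟩ := exists_en_le hs hs2 hμ
  obtain ⟨δ₁, hδ₁, hpn⟩ := exists_pot_near hs hs2 hKh hμ
  obtain ⟨δ, hδ, hδ1, hδm, hδC⟩ : ∃ δ > 0, δ ≤ δ₁ ∧ δ ≤ m0 s / 2 ∧ 2 * C * δ ≤ c / 10 := by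
    refine ⟨min δ₁ (min (m0 s / 2) (c / 10 / (2 * C + 1))), by positivity, min_le_left _ _,
      (min_le_right _ _).trans (min_le_left _ _), ?_⟩
    have h : min δ₁ (min (m0 s / 2) (c / 10 / (2 * C + 1))) ≤ c / 10 / (2 * C + 1) :=
      (min_le_right _ _).trans (min_le_right _ _)
    have h' : 0 < min δ₁ (min (m0 s / 2) (c / 10 / (2 * C + 1))) := by positivity
    rw [le_div_iff₀' (by positivity)] at h
    linarith
  refine ⟨δ, hδ, min (min ε₁ ε₂) (min ε₃ R⁻¹), by positivity,
    fun ε h0 hle G₁ G₂ hG₁ hG₂ hc₁ hc₂ hi₁ hi₂ hr₁ hr₂ => ?_⟩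
  have l1 : ε ≤ ε₁ := hle.trans ((min_le_left _ _).trans (min_le_left _ _))
  have l2 : ε ≤ ε₂ := hle.trans ((min_le_left _ _).trans (min_le_right _ _))
  have l3 : ε ≤ ε₃ := hle.trans ((min_le_right _ _).trans (min_le_left _ _))
  have l4 : ε ≤ R⁻¹ := hle.trans ((min_le_right _ _).trans (min_le_right _ _))
  obtain ⟨u, hu⟩ : ∃ u : ℝ → ℂ, u = fun ξ => 2⁻¹ * (G₁ ξ + G₂ ξ) := ⟨_, rfl⟩
  obtain ⟨h, hh⟩ : ∃ h : ℝ → ℂ, h = fun ξ => 2⁻¹ * (G₁ ξ - G₂ ξ) := ⟨_, rfl⟩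
  have au : Adm s u := by rw [hu]; exact (hG₁.adm.add hG₂.adm).const_mul _
  have ah : Adm s h := by rw [hh]; exact (hG₁.adm.sub hG₂.adm).const_mul _
  have e1 : (fun ξ => u ξ + h ξ) = G₁ := by rw [hu, hh]; ext ξ; ring
  have e2 : (fun ξ => u ξ - h ξ) = G₂ := by rw [hu, hh]; ext ξ; ring
  have n1 : nsq u + nsq h = m0 s := by
    have := au.nsq_parallelogram ah
    rw [e1, e2, hG₁.nsq, hG₂.nsq] at this
    linarith
  have a1 := hG₁.adm.sub hF
  have a2 := hG₂.adm.sub hF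
  have hhalf : ‖(2⁻¹ : ℂ)‖ ^ 2 = 4⁻¹ := by norm_num
  have n2 : nsq h ≤ δ := by
    have e : h = fun ξ => 2⁻¹ * ((G₁ ξ - fsw s ξ) - (G₂ ξ - fsw s ξ)) := by rw [hh]; ext ξ; ring
    rw [e, nsq_const_mul, hhalf]
    linarith [a1.nsq_sub_le a2]
  have eu : (fun ξ => u ξ - fsw s ξ)
      = fun ξ => 2⁻¹ * ((G₁ ξ - fsw s ξ) + (G₂ ξ - fsw s ξ)) := by rw [hu]; ext ξ; ring
  have n3 : nsq (fun ξ => u ξ - fsw s ξ) ≤ δ := by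
    rw [eu, nsq_const_mul, hhalf]
    linarith [a1.nsq_add_le a2]
  have hom1 := hhom ε h0 l2 G₁ hG₁
  have hom2 := hhom ε h0 l2 G₂ hG₂
  have homu : hom s u ≤ Kh := by
    rw [hu, hom_const_mul, hhalf]
    linarith [hG₁.adm.hom_add_le hG₂.adm]
  have hν := nsq_nonneg h
  obtain ⟨pu, su⟩ := hpn u au homu (by linarith) (n3.trans hδ1)
  obtain ⟨p1, s1⟩ := hpn G₁ hG₁.adm hom1 hG₁.nsq.le (hc₁.trans hδ1)
  obtain ⟨p2, s2⟩ := hpn G₂ hG₂.adm hom2 hG₂.nsq.le (hc₂.trans hδ1)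
  have sh : ∫ ξ, ‖h ξ‖ ≤ κ := by
    have i1 := (a1.integrable hs).norm
    have i2 := (a2.integrable hs).norm
    calc ∫ ξ, ‖h ξ‖ ≤ ∫ ξ, 2⁻¹ * (‖G₁ ξ - fsw s ξ‖ + ‖G₂ ξ - fsw s ξ‖) := by
          refine integral_mono (ah.integrable hs).norm ((i1.add i2).const_mul _) fun ξ => ?_
          have e : h ξ = 2⁻¹ * ((G₁ ξ - fsw s ξ) - (G₂ ξ - fsw s ξ)) := by rw [hh]; ring
          simp only
          rw [e, norm_mul, norm_inv, Complex.norm_ofNat]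
          gcongr
          exact norm_sub_le _ _
      _ = 2⁻¹ * ((∫ ξ, ‖G₁ ξ - fsw s ξ‖) + ∫ ξ, ‖G₂ ξ - fsw s ξ‖) := by
          rw [integral_const_mul, integral_add i1 i2]
      _ ≤ κ := by linarith
  have hmid := IsMin.midpoint hs hs2 au ah (e1 ▸ hG₁) (e2 ▸ hG₂) (by linarith)
  have hpsd := pot_second_diff_le hs hs2 hsd au ah (su.trans hμκ) sh
  have ht0 := two_t0_eq hs
  have hm0 := t0_eq hs
  -- For the soliton (s+1) p0 - t0 = m0, so the multiplier is close to 1 after division by the mass.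
  have hα : m0 s * (1 - min 1 (c / 10)) ≤ (s + 1) * pot s u - ten s ε u := by
    have t1 := hen ε h0 l3 G₁ hG₁
    have t2 := hen ε h0 l3 G₂ hG₂
    rw [en] at t1 t2
    have tp := au.ten_parallelogram hs hs2 (ε := ε) ah
    rw [e1, e2] at tp
    have th := ten_nonneg hs ε h
    have := mul_le_mul_of_nonneg_left (abs_le.1 pu).1 (show 0 ≤ s + 1 by linarith)
    linarith [(abs_le.1 p1).2, (abs_le.1 p2).2]
  have hr : nsq h * (1 - min 1 (c / 10))
      ≤ nsq h / nsq u * ((s + 1) * pot s u - ten s ε u) := by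
    have h1 : nsq h / m0 s ≤ nsq h / nsq u := by
      gcongr <;> linarith
    have h2 : 0 ≤ 1 - min 1 (c / 10) := by linarith [min_le_left 1 (c / 10)]
    calc nsq h * (1 - min 1 (c / 10)) = nsq h / m0 s * (m0 s * (1 - min 1 (c / 10))) := by
          field_simp
      _ ≤ nsq h / nsq u * (m0 s * (1 - min 1 (c / 10))) := by gcongr
      _ ≤ _ := by
          refine mul_le_mul_of_nonneg_left hα (div_nonneg hν (by linarith))
  have hten := ah.le_ten hs hs2 hR0.le (show 0 ≤ c / 10 / R ^ 2 by positivity)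
    (fun η hη => hnear ε η h0 l1 hη) (B := B) fun η hη => by
      refine le_trans ?_ (hfar ε η h0 l4 hη)
      exact le_mul_of_one_le_right hB0.le (Real.one_le_rpow (hR.trans hη) (by linarith))
  have aL := ah.low R
  have aH := ah.high R
  have mL := memLp_fourierInv (aL.integrable hs) aL.memLp
  have mH := memLp_fourierInv (aH.integrable hs) aH.memLp
  have hV : vq s (𝓕⁻ h) ≤ (1 + θ) * vq s (𝓕⁻ (low R h)) + (1 + θ⁻¹) * (K * nsq (high R h)) := by
    have e : 𝓕⁻ h = fun x => 𝓕⁻ (low R h) x + 𝓕⁻ (high R h) x := by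
      ext x
      rw [← fourierInv_add' (aL.integrable hs) (aH.integrable hs)]
      simp_rw [low_add_high]
    rw [e]
    refine (vq_add_le hs mL mH hθ).trans ?_
    have := vq_le hs mH
    rw [integral_norm_sq_fourierInv (aH.integrable hs) aH.memLp, ← hK] at this
    gcongr
    exact this
  have hVL := vq_le hs mL
  rw [integral_norm_sq_fourierInv (aL.integrable hs) aL.memLp, ← hK] at hVL
  have hco := hcoer _ _ (ah.csob_low hs R)
  rw [integral_norm_sq_fourierInv (aL.integrable hs) aL.memLp,
    ah.integral_norm_sq_deriv_low hs R] at hco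
  have i1 := hG₁.adm
  have i2 := hG₂.adm
  have hsub : ∀ {F : ℝ → ℂ}, MemLp F 2 → (∫ ξ, inner ℂ (F ξ) (h ξ))
      = 2⁻¹ * ((∫ ξ, inner ℂ (F ξ) (G₁ ξ)) - ∫ ξ, inner ℂ (F ξ) (G₂ ξ)) := fun {F} hF => by
    have hint : ∀ {K : ℝ → ℂ}, Adm s K → Integrable fun ξ => inner ℂ (F ξ) (K ξ) := fun hK => by
      simp_rw [RCLike.inner_apply]
      exact hK.memLp.integrable_mul hF.star
    rw [← integral_sub (hint i1) (hint i2), ← integral_const_mul]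
    refine integral_congr_ae (Eventually.of_forall fun ξ => ?_)
    simp only [hh, RCLike.inner_apply]
    ring
  have o1 : (∫ ξ, inner ℂ (fsw s ξ) (h ξ)).im = 0 := by
    rw [hsub hF.memLp, Complex.mul_im, Complex.sub_im, hi₁, hi₂]; simp
  have o2 : (∫ ξ, inner ℂ (fdsw s ξ) (h ξ)).re = 0 := by
    rw [hsub (memLp_fdsw hs).1, Complex.mul_re, Complex.sub_re, hr₁, hr₂]; simp
  -- Equal masses of u + h and u - h make h orthogonal to u in the real sense. Hence its component
  -- along the soliton is minus that along u - w, which is small relative to h.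
  have o3 : (∫ ξ, inner ℂ (fsw s ξ) (h ξ)).re ^ 2 ≤ δ * nsq h := by
    have r0 := au.re_integral_inner_eq ah
    rw [e1, e2, hG₁.nsq, hG₂.nsq, sub_self] at r0
    have e : (∫ ξ, inner ℂ (u ξ - fsw s ξ) (h ξ))
        = (∫ ξ, inner ℂ (u ξ) (h ξ)) - ∫ ξ, inner ℂ (fsw s ξ) (h ξ) := by
      rw [← integral_sub (au.integrable_inner ah) (hF.integrable_inner ah)]
      simp_rw [inner_sub_left]
    have q := norm_integral_inner_sq_le (au.sub hF).memLp ah.memLp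
    rw [e] at q
    have q2 := Complex.abs_re_le_norm ((∫ ξ, inner ℂ (u ξ) (h ξ)) - ∫ ξ, inner ℂ (fsw s ξ) (h ξ))
    rw [Complex.sub_re, show (∫ ξ, inner ℂ (u ξ) (h ξ)).re = 0 by linarith, zero_sub, abs_neg] at q2
    calc _ = |(∫ ξ, inner ℂ (fsw s ξ) (h ξ)).re| ^ 2 := (sq_abs _).symm
      _ ≤ _ := by gcongr
      _ ≤ nsq (fun ξ => u ξ - fsw s ξ) * nsq h := q
      _ ≤ _ := by gcongr
  have hcomp := ah.low_components_le hs hs2 R o1 o2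
  rw [e1, e2] at hmid hpsd
  have final : nsq h = 0 := by
    refine local_uniqueness_arith (k := c / 10 / R ^ 2 * R ^ 2) (m := m0 s) hc hC hν
      (ah.nsq_low_add_high R) (nsq_nonneg _) hK0.le hθ
      (by linarith : ten s ε h + nsq h * (1 - min 1 (c / 10)) ≤ vq s (𝓕⁻ h) + c / 10 * nsq h)
      hten hV hVL hco (by linarith) (min_le_right _ _) (by field_simp) hθK hδC hB
  filter_upwards [ae_zero_of_nsq_eq_zero ah final] with ξ hξ
  rw [hh] at hξ
  simpa [sub_eq_zero] using hξ

/-- Minimizers are unique up to phase and translation. -/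
theorem exists_unique_minimizer : ∃ ε₀ > 0, ∀ ε, 0 < ε → ε ≤ ε₀ → ∀ G₁ G₂,
    IsMin s ε G₁ → IsMin s ε G₂ → ∃ φ y, G₂ =ᵐ[volume] tw φ y G₁ := by
  obtain ⟨δ, hδ, ε₁, hε₁, huniq⟩ := exists_locally_unique hs hs2
  obtain ⟨ε₂, hε₂, hmod⟩ := exists_modulated hs hs2 hδ
  refine ⟨min ε₁ ε₂, by positivity, fun ε h0 hle G₁ G₂ h1 h2 => ?_⟩
  obtain ⟨φ₁, y₁, a1, b1, c1⟩ := hmod ε h0 (hle.trans (min_le_right _ _)) G₁ h1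
  obtain ⟨φ₂, y₂, a2, b2, c2⟩ := hmod ε h0 (hle.trans (min_le_right _ _)) G₂ h2
  have h := huniq ε h0 (hle.trans (min_le_left _ _)) _ _ (h1.tw φ₁ y₁) (h2.tw φ₂ y₂) a1 a2 b1 b2
    c1 c2
  refine ⟨-φ₂ + φ₁, -y₂ + y₁, ?_⟩
  have e : G₂ = tw (-φ₂) (-y₂) (tw φ₂ y₂ G₂) := by
    rw [tw_tw, neg_add_cancel, neg_add_cancel, tw_zero]
  rw [← tw_tw]
  filter_upwards [h] with ξ hξ
  rw [congrFun e ξ]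
  exact congrArg (Complex.exp _ * ·) hξ.symm

end

/-! ### From L² functions to Fourier profiles, and the rescaling -/

section
variable {s : ℝ}

theorem one_add_abs_rpow_le (hs : 1 < s) (ξ : ℝ) : 1 + |ξ| ^ s ≤ 2 * (1 + ξ ^ 2) ^ (s / 2) := by
  have h1 : |ξ| ^ s = (ξ ^ 2) ^ (s / 2) := by
    rw [← sq_abs, ← Real.rpow_natCast, ← Real.rpow_mul (abs_nonneg _)]; norm_num; ring_nf
  have h2 : (ξ ^ 2) ^ (s / 2) ≤ (1 + ξ ^ 2) ^ (s / 2) := by gcongr; linarith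
  have h3 : 1 ≤ (1 + ξ ^ 2) ^ (s / 2) := Real.one_le_rpow (by nlinarith) (by linarith)
  rw [h1]; linarith

theorem le_one_add_abs_rpow (hs : 1 < s) (ξ : ℝ) : (1 + ξ ^ 2) ^ (s / 2) ≤ 2 ^ s * (1 + |ξ| ^ s) := by
  refine le_trans ?_ (one_add_rpow_le (by linarith) (abs_nonneg ξ))
  have : (1 + |ξ|) ^ s = ((1 + |ξ|) ^ 2) ^ (s / 2) := by
    rw [← Real.rpow_natCast, ← Real.rpow_mul (by positivity)]; norm_num
    congr 1; ring
  rw [this]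
  gcongr
  rw [← sq_abs ξ]; nlinarith [abs_nonneg ξ]

/-- Sobolev membership says that the weighted transform, as a distribution, comes from L². Testing
against Schwartz functions makes this a pointwise statement, and the weight (1 + ξ²)^(s/2) is
comparable to 1 + |ξ|^s. -/
theorem memH_iff (hs : 1 < s) (u : L2) : MemH (s / 2) u ↔ Adm s ((𝓕 u : L2) : ℝ → ℂ) := by
  obtain ⟨W, hW⟩ : ∃ W : ℝ → ℂ, W = fun x : ℝ => (((1 + ‖x‖ ^ 2) ^ (s / 2 / 2) : ℝ) : ℂ) := ⟨_, rfl⟩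
  have hWt : W.HasTemperateGrowth := by rw [hW]; fun_prop
  have hWc : Continuous W := hWt.1.continuous
  have hWn : ∀ ξ, ‖W ξ‖ ^ 2 = (1 + ξ ^ 2) ^ (s / 2) := fun ξ => by
    rw [hW]
    simp only
    rw [Complex.norm_real, Real.norm_of_nonneg (by positivity), ← Real.rpow_natCast,
      ← Real.rpow_mul (by positivity), Real.norm_eq_abs, sq_abs]
    congr 1; push_cast; ring
  have hU := Lp.memLp (𝓕 u : L2)
  have iff1 : MemH (s / 2) u ↔ ∃ f' : L2, (fun ξ => W ξ * (𝓕 u : L2) ξ) =ᵐ[volume] f' := by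
    rw [MemH, TemperedDistribution.memSobolev_iff_exists_smulLeftCLM_fourier, ← hW,
      Lp.fourier_toTemperedDistribution_eq]
    refine exists_congr fun f' => ⟨fun h => ?_, fun h => ?_⟩
    · have hl := LocallyIntegrable.continuous_mul hWc (hU.locallyIntegrable (by norm_num))
      refine ae_eq_of_integral_schwartz_smul_eq hl
        ((Lp.memLp f').locallyIntegrable (by norm_num)) fun φ => ?_
      have h1 := DFunLike.congr_fun h φ
      rw [TemperedDistribution.smulLeftCLM_apply_apply, Lp.toTemperedDistribution_apply,
        Lp.toTemperedDistribution_apply] at h1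
      rw [← h1]
      refine integral_congr_ae (Eventually.of_forall fun ξ => ?_)
      simp only [SchwartzMap.smulLeftCLM_apply_apply hWt, smul_eq_mul]
      ring
    · ext φ
      rw [TemperedDistribution.smulLeftCLM_apply_apply, Lp.toTemperedDistribution_apply,
        Lp.toTemperedDistribution_apply]
      refine integral_congr_ae ?_
      filter_upwards [h] with ξ hξ
      rw [SchwartzMap.smulLeftCLM_apply_apply hWt, ← hξ, smul_eq_mul, smul_eq_mul, smul_eq_mul]
      ring
  have hm : AEStronglyMeasurable (fun ξ => W ξ * (𝓕 u : L2) ξ) :=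
    hWc.aestronglyMeasurable.mul hU.1
  have iff2 : (∃ f' : L2, (fun ξ => W ξ * (𝓕 u : L2) ξ) =ᵐ[volume] f')
      ↔ Integrable fun ξ => ‖W ξ * (𝓕 u : L2) ξ‖ ^ 2 := by
    rw [← memLp_two_iff_integrable_sq_norm hm]
    exact ⟨fun ⟨f', hf⟩ => (memLp_congr_ae hf).2 (Lp.memLp f'),
      fun h => ⟨h.toLp _, h.coeFn_toLp.symm⟩⟩
  rw [iff1, iff2]
  simp_rw [norm_mul, mul_pow, hWn]
  constructor
  · refine fun h => ⟨hU.1, (h.const_mul 2).mono' ?_ (Eventually.of_forall fun ξ => ?_)⟩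
    · exact ((measurable_const.add (measurable_abs_rpow s)).aestronglyMeasurable).mul
        (hU.1.norm.pow 2)
    · rw [Real.norm_of_nonneg (by positivity), ← mul_assoc]
      gcongr
      exact one_add_abs_rpow_le hs ξ
  · refine fun h => (h.int.const_mul (2 ^ s)).mono' ?_ (Eventually.of_forall fun ξ => ?_)
    · exact (Measurable.aestronglyMeasurable (by fun_prop)).mul (hU.1.norm.pow 2)
    · rw [Real.norm_of_nonneg (by positivity), ← mul_assoc]
      gcongr
      exact le_one_add_abs_rpow hs ξ

theorem mass_eq (u : L2) : mass u = nsq ((𝓕 u : L2) : ℝ → ℂ) := by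
  have h : ∀ f : L2, ‖f‖ ^ 2 = ∫ x, ‖f x‖ ^ 2 := fun f => by
    have h3 : (inner ℂ f f : ℂ) = ∫ ξ, inner ℂ (f ξ) (f ξ) := L2.inner_def f f
    simp_rw [inner_self_eq_norm_sq_to_K] at h3
    norm_cast at h3
  rw [mass, nsq, ← h, ← h, Lp.norm_fourier_eq]

theorem coe_ae_eq_fourierInv {u : L2} (hs : 1 < s) (hu : Adm s ((𝓕 u : L2) : ℝ → ℂ)) :
    (u : ℝ → ℂ) =ᵐ[volume] 𝓕⁻ ((𝓕 u : L2) : ℝ → ℂ) := by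
  have h := fourierInv_L2_ae_eq (hu.integrable hs)
  rwa [FourierTransform.fourierInv_fourier_eq] at h

theorem kinetic_eq (s : ℝ) (u : L2) :
    kinetic s u = (2 * Real.pi) ^ s * hom s ((𝓕 u : L2) : ℝ → ℂ) := by
  rw [kinetic, hom, ← integral_const_mul]
  congr 1; ext ξ
  rw [abs_mul, abs_of_pos (by positivity : 0 < 2 * Real.pi), Real.mul_rpow (by positivity)
    (abs_nonneg _)]
  ring

theorem potential_eq (hs : 1 < s) {u : L2} (hu : Adm s ((𝓕 u : L2) : ℝ → ℂ)) :
    potential s u = pot s ((𝓕 u : L2) : ℝ → ℂ) := by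
  refine integral_congr_ae ?_
  filter_upwards [coe_ae_eq_fourierInv hs hu] with x hx
  rw [hx]

/-- The function with a given Fourier transform. -/
theorem Adm.exists_L2 {V : ℝ → ℂ} (hV : Adm s V) :
    ∃ v : L2, ((𝓕 v : L2) : ℝ → ℂ) =ᵐ[volume] V := by
  refine ⟨𝓕⁻ (hV.memLp.toLp V), ?_⟩
  rw [FourierTransform.fourier_fourierInv_eq]
  exact hV.memLp.coeFn_toLp

theorem nsq_congr {G H : ℝ → ℂ} (h : G =ᵐ[volume] H) : nsq G = nsq H :=
  integral_congr_ae (h.mono fun ξ hξ => by simp only [hξ])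

theorem hom_congr {G H : ℝ → ℂ} (h : G =ᵐ[volume] H) : hom s G = hom s H :=
  integral_congr_ae (h.mono fun ξ hξ => by simp only [hξ])

theorem fourierInv_congr {G H : ℝ → ℂ} (h : G =ᵐ[volume] H) : 𝓕⁻ G = 𝓕⁻ H := by
  ext x
  rw [fourierInv_eq_integral, fourierInv_eq_integral]
  exact integral_congr_ae (h.mono fun ξ hξ => by simp only [hξ])

theorem pot_congr {G H : ℝ → ℂ} (h : G =ᵐ[volume] H) : pot s G = pot s H := by
  rw [pot, pot, fourierInv_congr h]

/-- Rescaling on the Fourier side. -/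
noncomputable def resc (c a b : ℝ) (G : ℝ → ℂ) (ξ : ℝ) : ℂ := c * G ((ξ - b) / a)

theorem integral_comp_affine {E : Type*} [NormedAddCommGroup E] [NormedSpace ℝ E] {a : ℝ}
    (ha : 0 < a) (b : ℝ) (f : ℝ → E) : ∫ ξ, f ((ξ - b) / a) = a • ∫ ξ, f ξ := by
  rw [integral_sub_right_eq_self (fun ξ => f (ξ / a)) b, Measure.integral_comp_div, abs_of_pos ha]

theorem resc_resc {c a : ℝ} (hc : c ≠ 0) (ha : a ≠ 0) (b : ℝ) (G : ℝ → ℂ) :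
    resc c a b (resc c⁻¹ a⁻¹ (-b / a) G) = G := by
  ext ξ
  have e : ((ξ - b) / a - -b / a) / a⁻¹ = ξ := by field_simp; ring
  have hc' : (c : ℂ) ≠ 0 := Complex.ofReal_ne_zero.2 hc
  rw [resc, resc, e]
  push_cast
  field_simp

theorem nsq_resc {c a : ℝ} (ha : 0 < a) (b : ℝ) (G : ℝ → ℂ) :
    nsq (resc c a b G) = c ^ 2 * a * nsq G := by
  simp_rw [nsq, resc, norm_mul, mul_pow]
  rw [integral_const_mul, integral_comp_affine ha b fun ξ => ‖G ξ‖ ^ 2, Complex.norm_real,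
    Real.norm_eq_abs, sq_abs, smul_eq_mul, mul_assoc]

theorem fourierInv_resc {c a : ℝ} (ha : 0 < a) (b : ℝ) (G : ℝ → ℂ) (x : ℝ) :
    𝓕⁻ (resc c a b G) x
      = (c * a : ℝ) * Complex.exp ((2 * Real.pi * b * x : ℝ) * Complex.I) * 𝓕⁻ G (a * x) := by
  have h := integral_comp_affine ha b fun η => Complex.exp ((2 * Real.pi * b * x : ℝ) * Complex.I)
    * (c * (Complex.exp ((2 * Real.pi * η * (a * x) : ℝ) * Complex.I) * G η))
  rw [fourierInv_eq_integral, fourierInv_eq_integral]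
  have e : ∀ ξ, Complex.exp ((2 * Real.pi * ξ * x : ℝ) * Complex.I) * resc c a b G ξ
    = Complex.exp ((2 * Real.pi * b * x : ℝ) * Complex.I) * (c * (Complex.exp
      ((2 * Real.pi * ((ξ - b) / a) * (a * x) : ℝ) * Complex.I) * G ((ξ - b) / a))) := fun ξ => by
    have e1 : ((2 * Real.pi * ξ * x : ℝ) : ℂ) * Complex.I = (2 * Real.pi * b * x : ℝ) * Complex.I
        + (2 * Real.pi * ((ξ - b) / a) * (a * x) : ℝ) * Complex.I := by
      rw [← add_mul, ← Complex.ofReal_add]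
      congr 2; field_simp; ring
    rw [resc, e1, Complex.exp_add]; ring
  simp_rw [e]
  rw [h, integral_const_mul, integral_const_mul, Complex.real_smul]
  push_cast; ring

theorem pot_resc (s : ℝ) {c a : ℝ} (ha : 0 < a) (b : ℝ) (G : ℝ → ℂ) :
    pot s (resc c a b G) = (|c| * a) ^ (2 * s + 2) * a⁻¹ * pot s G := by
  simp_rw [pot, fourierInv_resc ha, norm_mul, Complex.norm_exp_ofReal_mul_I, mul_one]
  have h : ∀ x, (‖((c * a : ℝ) : ℂ)‖ * ‖𝓕⁻ G (a * x)‖) ^ (2 * s + 2)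
      = (|c| * a) ^ (2 * s + 2) * ‖𝓕⁻ G (a * x)‖ ^ (2 * s + 2) := fun x => by
    rw [Real.mul_rpow (norm_nonneg _) (norm_nonneg _), Complex.norm_real, Real.norm_eq_abs,
      abs_mul, abs_of_pos ha]
  simp_rw [h]
  rw [integral_const_mul, Measure.integral_comp_mul_left (fun x => ‖𝓕⁻ G x‖ ^ (2 * s + 2)),
    abs_of_pos (inv_pos.2 ha), smul_eq_mul, mul_assoc]

theorem Adm.resc (hs : 1 < s) {a : ℝ} (ha : 0 < a) (c b : ℝ) {G : ℝ → ℂ} (hG : Adm s G) :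
    Adm s (resc c a b G) := by
  have hq : Measure.QuasiMeasurePreserving (fun ξ : ℝ => (ξ - b) / a) volume volume := by
    have h1 : Measure.QuasiMeasurePreserving (fun ξ : ℝ => ξ / a) volume volume := by
      simpa only [smul_eq_mul, div_eq_inv_mul] using
        Measure.quasiMeasurePreserving_smul (volume : Measure ℝ) (inv_ne_zero ha.ne')
    exact h1.comp (measurePreserving_sub_right volume b).quasiMeasurePreserving
  have hm : AEStronglyMeasurable (FracNLS.resc c a b G) :=
    (hG.aesm.comp_quasiMeasurePreserving hq).const_mul _
  obtain ⟨M, hM⟩ : ∃ M, M = 1 + a + |b| := ⟨_, rfl⟩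
  have hM1 : 1 ≤ M := by rw [hM]; linarith [abs_nonneg b]
  have hbd : ∀ η : ℝ, 1 + |a * η + b| ^ s ≤ (1 + M ^ s * 2 ^ s) * (1 + |η| ^ s) := fun η => by
    have h1 : |a * η + b| ≤ M * (1 + |η|) := by
      refine (abs_add_le _ _).trans ?_
      rw [abs_mul, abs_of_pos ha, hM]
      nlinarith [abs_nonneg η, abs_nonneg b, mul_nonneg (abs_nonneg b) (abs_nonneg η)]
    have h2 : |a * η + b| ^ s ≤ M ^ s * (1 + |η|) ^ s := by
      rw [← Real.mul_rpow (by linarith) (by positivity)]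
      exact Real.rpow_le_rpow (abs_nonneg _) h1 (by linarith)
    have h3 := mul_le_mul_of_nonneg_left (one_add_rpow_le (s := s) (by linarith) (abs_nonneg η))
      (show 0 ≤ M ^ s by positivity)
    have h4 : 0 ≤ |η| ^ s := by positivity
    linarith
  have h1 : Integrable fun η => (1 + |a * η + b| ^ s) * (c ^ 2 * ‖G η‖ ^ 2) := by
    refine (hG.int.const_mul ((1 + M ^ s * 2 ^ s) * c ^ 2)).mono' ?_ (Eventually.of_forall fun η => ?_)
    · exact (Measurable.aestronglyMeasurable (by fun_prop)).mul ((hG.aesm.norm.pow 2).const_mul _)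
    · rw [Real.norm_of_nonneg (by positivity)]
      calc _ ≤ (1 + M ^ s * 2 ^ s) * (1 + |η| ^ s) * (c ^ 2 * ‖G η‖ ^ 2) := by
            gcongr; exact hbd η
        _ = _ := by ring
  refine ⟨hm, ((h1.comp_div ha.ne').comp_sub_right b).congr (Eventually.of_forall fun ξ => ?_)⟩
  simp only
  have e : a * ((ξ - b) / a) + b = ξ := by field_simp; ring
  rw [e, FracNLS.resc, norm_mul, mul_pow, Complex.norm_real, Real.norm_eq_abs, sq_abs]

end

section
variable {s : ℝ}

/-- The energy on the Fourier side. -/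
noncomputable def fen (s β : ℝ) (G : ℝ → ℂ) : ℝ :=
  (∫ ξ : ℝ, (1 / 2 * |2 * Real.pi * ξ| ^ s - β * (2 * Real.pi * ξ)) * ‖G ξ‖ ^ 2)
    - 1 / (2 * s + 2) * pot s G

theorem fen_congr {β : ℝ} {G H : ℝ → ℂ} (h : G =ᵐ[volume] H) : fen s β G = fen s β H := by
  have : (fun ξ : ℝ => (1 / 2 * |2 * Real.pi * ξ| ^ s - β * (2 * Real.pi * ξ)) * ‖G ξ‖ ^ 2)
      =ᵐ[volume] fun ξ : ℝ => (1 / 2 * |2 * Real.pi * ξ| ^ s - β * (2 * Real.pi * ξ)) * ‖H ξ‖ ^ 2 :=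
    h.mono fun ξ hξ => by simp only [hξ]
  rw [fen, fen, pot_congr h, integral_congr_ae this]

theorem abs_le_one_add_rpow (hs : 1 < s) (ξ : ℝ) : |ξ| ≤ 1 + |ξ| ^ s := by
  have h0 : 0 ≤ |ξ| ^ s := by positivity
  rcases le_or_gt |ξ| 1 with h | h
  · linarith
  · have := Real.self_le_rpow_of_one_le h.le hs.le
    linarith

theorem energy_eq (hs : 1 < s) (β : ℝ) {u : L2} (hu : Adm s ((𝓕 u : L2) : ℝ → ℂ)) :
    energy s β u = fen s β ((𝓕 u : L2) : ℝ → ℂ) := by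
  have hk : Integrable fun ξ : ℝ => |2 * Real.pi * ξ| ^ s * ‖(𝓕 u : L2) ξ‖ ^ 2 := by
    refine (hu.int_hom.const_mul ((2 * Real.pi) ^ s)).congr (Eventually.of_forall fun ξ => ?_)
    simp only
    rw [abs_mul, abs_of_pos (by positivity : 0 < 2 * Real.pi), Real.mul_rpow (by positivity)
      (abs_nonneg _), mul_assoc]
  have hm : Integrable fun ξ : ℝ => (2 * Real.pi * ξ) * ‖(𝓕 u : L2) ξ‖ ^ 2 := by
    refine (hu.int.const_mul (2 * Real.pi)).mono' ?_ (Eventually.of_forall fun ξ => ?_)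
    · exact (Measurable.aestronglyMeasurable (by fun_prop)).mul (hu.aesm.norm.pow 2)
    · rw [norm_mul, norm_mul, Real.norm_of_nonneg (by positivity : 0 ≤ 2 * Real.pi),
        Real.norm_of_nonneg (by positivity : 0 ≤ ‖(𝓕 u : L2) ξ‖ ^ 2), mul_assoc]
      gcongr
      exact abs_le_one_add_rpow hs ξ
  have e : ∀ ξ : ℝ, (1 / 2 * |2 * Real.pi * ξ| ^ s - β * (2 * Real.pi * ξ)) * ‖(𝓕 u : L2) ξ‖ ^ 2
      = 1 / 2 * (|2 * Real.pi * ξ| ^ s * ‖(𝓕 u : L2) ξ‖ ^ 2)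
        - β * ((2 * Real.pi * ξ) * ‖(𝓕 u : L2) ξ‖ ^ 2) := fun ξ => by ring
  rw [energy, fen, potential_eq hs hu, kinetic, momentum]
  simp_rw [e]
  rw [integral_sub (hk.const_mul _) (hm.const_mul _), integral_const_mul, integral_const_mul]

/-- The energy of a function whose Fourier transform concentrates near the frequency `k`. -/
theorem fen_resc (hs : 1 < s) (hs2 : s < 2) {β k ε c : ℝ} (hk : 0 < k) (hε : 0 < ε) (hc : 0 < c)
    (hβ : s / 2 * k ^ (s - 1) = β)
    (hcε : (c * (k * ε)) ^ (2 * s) = k ^ s * ε ^ 2 * (s * (s - 1) * (s + 1) / 2))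
    {G : ℝ → ℂ} (hG : Adm s G) :
    fen s β (resc c (k * ε) (k / (2 * Real.pi)) G)
      = 1 / 2 * k ^ s * (1 - s) * (c ^ 2 * (k * ε) * nsq G)
        + k ^ s * (s * (s - 1) * ε ^ 2 / 4) * (c ^ 2 * (k * ε)) * en s ε G := by
  obtain ⟨a, ha⟩ : ∃ a, a = k * ε := ⟨_, rfl⟩
  have ha0 : 0 < a := by rw [ha]; positivity
  have hs1 : s - 1 ≠ 0 := by linarith
  -- The relation between β and k cancels the linear term of the symbol at k, leaving the constant
  -- k^s(1-s)/2 and the remainder `om`.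
  have hβk : β * k = s / 2 * k ^ s := by
    rw [← hβ, mul_assoc, ← Real.rpow_add_one hk.ne']; norm_num
  have hsym : ∀ η : ℝ, 1 / 2 * |2 * Real.pi * (a * η + k / (2 * Real.pi))| ^ s
      - β * (2 * Real.pi * (a * η + k / (2 * Real.pi)))
      = 1 / 2 * k ^ s * (1 - s) + k ^ s * (s * (s - 1) * ε ^ 2 / 4) * sym s ε η := fun η => by
    have e : 2 * Real.pi * (a * η + k / (2 * Real.pi)) = k * (1 + 2 * Real.pi * ε * η) := by
      rw [ha]; field_simp; ring
    rw [e, abs_mul, abs_of_pos hk, Real.mul_rpow hk.le (abs_nonneg _), ← mul_assoc β, hβk, sym, om]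
    field_simp
    ring
  have h1 := integral_comp_affine ha0 (k / (2 * Real.pi)) fun η : ℝ =>
    (1 / 2 * |2 * Real.pi * (a * η + k / (2 * Real.pi))| ^ s
      - β * (2 * Real.pi * (a * η + k / (2 * Real.pi)))) * (c ^ 2 * ‖G η‖ ^ 2)
  have e1 : ∀ ξ : ℝ, a * ((ξ - k / (2 * Real.pi)) / a) + k / (2 * Real.pi) = ξ := fun ξ => by
    field_simp; ring
  have e2 : ∀ ξ : ℝ, c ^ 2 * ‖G ((ξ - k / (2 * Real.pi)) / a)‖ ^ 2
      = ‖resc c a (k / (2 * Real.pi)) G ξ‖ ^ 2 := fun ξ => by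
    rw [resc, norm_mul, mul_pow, Complex.norm_real, Real.norm_eq_abs, sq_abs]
  simp_rw [e1, e2, hsym] at h1
  have e3 : ∀ η, (1 / 2 * k ^ s * (1 - s) + k ^ s * (s * (s - 1) * ε ^ 2 / 4) * sym s ε η)
      * (c ^ 2 * ‖G η‖ ^ 2) = 1 / 2 * k ^ s * (1 - s) * c ^ 2 * ‖G η‖ ^ 2
        + k ^ s * (s * (s - 1) * ε ^ 2 / 4) * c ^ 2 * (sym s ε η * ‖G η‖ ^ 2) := fun η => by ring
  simp_rw [e3] at h1
  rw [integral_add (hG.int_sq.const_mul _) ((hG.integrable_ten hs hs2).const_mul _),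
    integral_const_mul, integral_const_mul, smul_eq_mul] at h1
  rw [← ha] at hcε ⊢
  have hp : (|c| * a) ^ (2 * s + 2) = k ^ s * ε ^ 2 * (s * (s - 1) * (s + 1) / 2) * (c * a) ^ 2 := by
    rw [abs_of_pos hc, Real.rpow_add (by positivity), hcε]
    norm_num
  rw [fen, h1, pot_resc s ha0, hp, en, ten, nsq]
  have hs3 : s + 1 ≠ 0 := by linarith
  have hs4 : 2 * s + 2 = 2 * (s + 1) := by ring
  rw [hs4]
  field_simp
  ring

/-- At fixed mass, `fen_resc` expresses the energy as an increasing affine function of `en`, so the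
two minimization problems correspond under the rescaling. -/
theorem isMin_resc (hs : 1 < s) (hs2 : s < 2) {β N k ε c : ℝ} (hk : 0 < k) (hε : 0 < ε) (hc : 0 < c)
    (hβ : s / 2 * k ^ (s - 1) = β)
    (hcε : (c * (k * ε)) ^ (2 * s) = k ^ s * ε ^ 2 * (s * (s - 1) * (s + 1) / 2))
    (hN : c ^ 2 * (k * ε) * m0 s = N) {Q : L2} (hQ : Q ∈ minimizers s β N) :
    IsMin s ε (resc c⁻¹ (k * ε)⁻¹ (-(k / (2 * Real.pi)) / (k * ε)) ((𝓕 Q : L2) : ℝ → ℂ)) := by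
  obtain ⟨hmem, hmass, hmin⟩ := hQ
  have hU := (memH_iff hs Q).1 hmem
  have ha : 0 < k * ε := by positivity
  have hG := hU.resc hs (inv_pos.2 ha) c⁻¹ (-(k / (2 * Real.pi)) / (k * ε))
  have hr := resc_resc hc.ne' ha.ne' (k / (2 * Real.pi)) ((𝓕 Q : L2) : ℝ → ℂ)
  obtain ⟨G, hGd⟩ : ∃ G, G = resc c⁻¹ (k * ε)⁻¹ (-(k / (2 * Real.pi)) / (k * ε))
    ((𝓕 Q : L2) : ℝ → ℂ) := ⟨_, rfl⟩
  rw [← hGd] at hG hr ⊢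
  have hca : 0 < c ^ 2 * (k * ε) := by positivity
  have hnG : nsq G = m0 s := by
    have h := mass_eq Q
    rw [hmass, ← hr, nsq_resc ha, ← hN] at h
    exact (mul_left_cancel₀ hca.ne' h).symm
  refine ⟨hG, hnG, fun H hH hnH => ?_⟩
  have hV := hH.resc hs ha c (k / (2 * Real.pi))
  obtain ⟨v, hv⟩ := hV.exists_L2
  have hv' := hV.congr hv.symm
  have hle := hmin v ((memH_iff hs v).2 hv') (by
    rw [mass_eq, nsq_congr hv, nsq_resc ha, hnH, hN])
  rw [energy_eq hs β hU, energy_eq hs β hv', fen_congr hv, ← hr,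
    fen_resc hs hs2 hk hε hc hβ hcε hG, fen_resc hs hs2 hk hε hc hβ hcε hH, hnG, hnH] at hle
  have hΓ : 0 < k ^ s * (s * (s - 1) * ε ^ 2 / 4) * (c ^ 2 * (k * ε)) := by
    have : 0 < s - 1 := by linarith
    have : 0 < s := by linarith
    positivity
  exact le_of_mul_le_mul_left (by linarith) hΓ

/-- A translation by y in the rescaled variable is one by y/a in x. The carrier wave of frequency b
turns it into an additional phase 2πb y/a. -/
theorem eq_translate_of_tw (hs : 1 < s) {c a b φ y : ℝ} (ha : 0 < a) {Q Q' : L2} {G G' : ℝ → ℂ}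
    (hQ : Adm s ((𝓕 Q : L2) : ℝ → ℂ)) (hQ' : Adm s ((𝓕 Q' : L2) : ℝ → ℂ))
    (hG : resc c a b G = ((𝓕 Q : L2) : ℝ → ℂ)) (hG' : resc c a b G' = ((𝓕 Q' : L2) : ℝ → ℂ))
    (h : G' =ᵐ[volume] tw φ y G) :
    ∃ φ y : ℝ, ∀ᵐ x : ℝ, Q' x = Complex.exp (Complex.I * (φ : ℂ)) * Q (x - y) := by
  refine ⟨φ - 2 * Real.pi * b * (y / a), -(y / a), ?_⟩
  have h1 := coe_ae_eq_fourierInv hs hQ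
  have h2 := (measurePreserving_sub_right volume (-(y / a))).quasiMeasurePreserving.ae h1
  filter_upwards [coe_ae_eq_fourierInv hs hQ', h2] with x hx hx2
  rw [hx, hx2, ← hG, ← hG', fourierInv_resc ha, fourierInv_resc ha, fourierInv_congr h,
    fourierInv_tw]
  have e1 : a * (x - -(y / a)) = a * x + y := by field_simp; ring
  rw [e1]
  have e2 : Complex.exp ((2 * Real.pi * b * x : ℝ) * Complex.I) * Complex.exp (φ * Complex.I)
      = Complex.exp (Complex.I * (φ - 2 * Real.pi * b * (y / a) : ℝ))
        * Complex.exp ((2 * Real.pi * b * (x - -(y / a)) : ℝ) * Complex.I) := by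
    rw [← Complex.exp_add, ← Complex.exp_add]
    congr 1; push_cast; ring
  linear_combination ((c * a : ℝ) : ℂ) * 𝓕⁻ G (a * x + y) * e2

/-- The parameters of the rescaling. -/
theorem exists_parameters (hs : 1 < s) (hs2 : s < 2) {m N β ε₀ : ℝ} (hm : 0 < m) (hN : 0 < N)
    (hβ : 0 < β) (hε₀ : 0 < ε₀)
    (hle : N ^ s ≤ m ^ s * (s * (s - 1) * (s + 1) / 2) * ε₀ ^ (2 - s)) :
    ∃ k > 0, ∃ ε > 0, ∃ c > 0, ε ≤ ε₀ ∧ s / 2 * k ^ (s - 1) = β ∧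
      (c * (k * ε)) ^ (2 * s) = k ^ s * ε ^ 2 * (s * (s - 1) * (s + 1) / 2) ∧
      c ^ 2 * (k * ε) * m = N := by
  obtain ⟨K, hK⟩ : ∃ K, K = s * (s - 1) * (s + 1) / 2 := ⟨_, rfl⟩
  have hs1 : 0 < s - 1 := by linarith
  have hs0 : 0 < s := by linarith
  have hs3 : 0 < 2 - s := by linarith
  have hK0 : 0 < K := by rw [hK]; positivity
  rw [← hK] at hle ⊢
  obtain ⟨k, hk⟩ : ∃ k, k = (2 * β / s) ^ (s - 1)⁻¹ := ⟨_, rfl⟩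
  -- Eliminating c and k from the mass and nonlinearity conditions leaves ε depending on N but not
  -- on β. This makes the mass threshold uniform in β.
  obtain ⟨ε, hε⟩ : ∃ ε, ε = ((N / m) ^ s / K) ^ (2 - s)⁻¹ := ⟨_, rfl⟩
  have hk0 : 0 < k := by rw [hk]; positivity
  have hε0 : 0 < ε := by rw [hε]; positivity
  have hεs : ε ^ (2 - s) = (N / m) ^ s / K := by
    rw [hε, ← Real.rpow_mul (by positivity), inv_mul_cancel₀ hs3.ne', Real.rpow_one]
  obtain ⟨c, hc⟩ : ∃ c, c = √(N / (k * ε * m)) := ⟨_, rfl⟩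
  have hc0 : 0 < c := by rw [hc]; positivity
  have hc2 : c ^ 2 = N / (k * ε * m) := by rw [hc, Real.sq_sqrt (by positivity)]
  refine ⟨k, hk0, ε, hε0, c, hc0, ?_, ?_, ?_, ?_⟩
  · refine (Real.rpow_le_rpow_iff hε0.le hε₀.le hs3).1 ?_
    rw [hεs, Real.div_rpow hN.le hm.le, div_div, div_le_iff₀ (by positivity)]
    linarith
  · rw [hk, ← Real.rpow_mul (by positivity), inv_mul_cancel₀ hs1.ne', Real.rpow_one]
    field_simp
  · have e : (c * (k * ε)) ^ 2 = N / m * k * ε := by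
      rw [mul_pow, hc2]; field_simp
    rw [Real.rpow_mul (by positivity), show (c * (k * ε)) ^ (2 : ℝ) = (c * (k * ε)) ^ 2 by norm_cast,
      e, Real.mul_rpow (by positivity) hε0.le, Real.mul_rpow (by positivity) hk0.le]
    have e2 : (N / m) ^ s = ε ^ (2 - s) * K := by rw [hεs]; field_simp
    have e3 : ε ^ (2 - s) * ε ^ s = ε ^ 2 := by rw [← Real.rpow_add hε0]; norm_num
    rw [e2, ← e3]; ring
  · rw [hc2]; field_simp

/-! ### Zero momentum parameter and the mass of the ground state -/

theorem hom_resc (s : ℝ) {c a : ℝ} (ha : 0 < a) (G : ℝ → ℂ) :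
    hom s (resc c a 0 G) = c ^ 2 * a * a ^ s * hom s G := by
  have h := integral_comp_affine ha 0 fun η : ℝ => c ^ 2 * a ^ s * (|η| ^ s * ‖G η‖ ^ 2)
  have e : ∀ ξ : ℝ, c ^ 2 * a ^ s * (|(ξ - 0) / a| ^ s * ‖G ((ξ - 0) / a)‖ ^ 2)
      = |ξ| ^ s * ‖resc c a 0 G ξ‖ ^ 2 := fun ξ => by
    rw [resc, norm_mul, mul_pow, Complex.norm_real, Real.norm_eq_abs, sq_abs, sub_zero, abs_div,
      abs_of_pos ha, Real.div_rpow (abs_nonneg _) ha.le]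
    field_simp
  simp_rw [e] at h
  rw [hom, h, integral_const_mul, hom, smul_eq_mul]; ring

theorem potential_le (hs : 1 < s) {u : L2} (hu : Adm s ((𝓕 u : L2) : ℝ → ℂ))
    (hm : gnConst s * mass u ^ s ≤ (2 * Real.pi) ^ s) : potential s u ≤ kinetic s u := by
  rw [potential_eq hs hu, kinetic_eq]
  refine (pot_le hs hu).trans ?_
  rw [← mass_eq]
  calc _ = gnConst s * mass u ^ s * hom s ((𝓕 u : L2) : ℝ → ℂ) := by ring
    _ ≤ _ := mul_le_mul_of_nonneg_right hm (hom_nonneg _ _)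

theorem kinetic_pos {u : L2} (hu : Adm s ((𝓕 u : L2) : ℝ → ℂ)) (hm : 0 < mass u) :
    0 < kinetic s u := by
  have h0 : hom s ((𝓕 u : L2) : ℝ → ℂ) ≠ 0 := fun h => by
    have h1 := nsq_congr (ae_zero_of_hom_eq_zero hu h)
    rw [← mass_eq] at h1
    simp [h1, nsq] at hm
  rw [kinetic_eq]
  have := (hom_nonneg s ((𝓕 u : L2) : ℝ → ℂ)).lt_of_ne' h0
  positivity

/-- Without momentum a small mass can spread out. -/
theorem minimizers_zero_eq_empty (hs : 1 < s) {N : ℝ} (hN : 0 < N)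
    (hm : gnConst s * N ^ s ≤ (2 * Real.pi) ^ s) : minimizers s 0 N = ∅ := by
  refine eq_empty_iff_forall_notMem.2 fun Q ⟨hmem, hmass, hmin⟩ => ?_
  have hU := (memH_iff hs Q).1 hmem
  have hk := kinetic_pos hU (hmass ▸ hN)
  have hp := potential_le hs hU (hmass ▸ hm)
  -- The dilation preserves the mass and divides the kinetic energy by 4. The energy then drops from
  -- at least kinetic/4 to at most kinetic/8, because 1/(2s+2) ≤ 1/4 and the potential is at most
  -- the kinetic energy.
  obtain ⟨a, ha⟩ : ∃ a : ℝ, a = (1 / 4) ^ s⁻¹ := ⟨_, rfl⟩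
  have ha0 : 0 < a := by rw [ha]; positivity
  have has : a ^ s = 1 / 4 := by
    rw [ha, ← Real.rpow_mul (by norm_num), inv_mul_cancel₀ (by linarith), Real.rpow_one]
  have hc : (√a⁻¹) ^ 2 * a = 1 := by rw [Real.sq_sqrt (by positivity), inv_mul_cancel₀ ha0.ne']
  have hV := hU.resc hs ha0 (√a⁻¹) 0
  obtain ⟨v, hv⟩ := hV.exists_L2
  have hv' := hV.congr hv.symm
  have hle := hmin v ((memH_iff hs v).2 hv') (by
    rw [mass_eq, nsq_congr hv, nsq_resc ha0, hc, one_mul, ← mass_eq, hmass])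
  have hkv : kinetic s v = 1 / 4 * kinetic s Q := by
    rw [kinetic_eq, kinetic_eq, hom_congr hv, hom_resc s ha0, hc, has]; ring
  have hpv : 0 ≤ potential s v := integral_nonneg fun _ => by positivity
  rw [energy, energy, hkv] at hle
  have h1 : 1 / (2 * s + 2) * potential s Q ≤ 1 / 4 * kinetic s Q := by
    have hpQ : 0 ≤ potential s Q := integral_nonneg fun _ => by positivity
    have : 1 / (2 * s + 2) ≤ 1 / 4 := by
      rw [div_le_div_iff₀ (by linarith) (by norm_num)]; linarith
    calc _ ≤ 1 / 4 * potential s Q := mul_le_mul_of_nonneg_right this hpQ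
      _ ≤ _ := by linarith
  have h2 : 0 ≤ 1 / (2 * s + 2) * potential s v := mul_nonneg (by positivity) hpv
  linarith

/-- The weak equation is tested with Q itself. -/
theorem mass_add_kinetic (hs : 1 < s) {Q : L2} (hmem : MemH (s / 2) Q) (h : SolvesGroundStateEq s Q) :
    kinetic s Q + mass Q = potential s Q := by
  have h1 := h Q hmem
  have e : ∀ z : ℂ, z * star z = ((‖z‖ ^ 2 : ℝ) : ℂ) := fun z => by
    rw [Complex.star_def, Complex.mul_conj, Complex.normSq_eq_norm_sq]
  simp_rw [mul_assoc _ (_ : ℂ) (star _), e] at h1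
  have e1 : ∀ x, ‖Q x‖ ^ (2 * s) * ‖Q x‖ ^ 2 = ‖Q x‖ ^ (2 * s + 2) := fun x => by
    rw [Real.rpow_add_of_nonneg (norm_nonneg _) (by linarith) (by norm_num)]
    norm_num
  simp_rw [← Complex.ofReal_mul, e1, integral_complex_ofReal, ← Complex.ofReal_add] at h1
  exact Complex.ofReal_injective h1

/-- Otherwise `potential_le` would bound the potential by the kinetic energy, whereas
`mass_add_kinetic` makes it larger by the positive mass. Only positivity and the equation enter, not
the optimality of Q. -/
theorem one_lt_of_isGroundState (hs : 1 < s) {Q : L2} (hQ : IsGroundState s Q) :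
    (2 * Real.pi) ^ s < gnConst s * mass Q ^ s := by
  have hU := (memH_iff hs Q).1 hQ.memH
  have hm : 0 < mass Q := by
    have h0 : mass Q ≠ 0 := fun h => by
      have hi : Integrable fun x => ‖Q x‖ ^ 2 :=
        (memLp_two_iff_integrable_sq_norm (Lp.memLp Q).1).1 (Lp.memLp Q)
      have h1 := (integral_eq_zero_iff_of_nonneg (fun _ => by positivity) hi).1 h
      obtain ⟨x, hx, hx'⟩ := (h1.and hQ.pos).exists
      have h2 : Q x = 0 := by simpa using hx
      rw [h2] at hx'
      simp at hx'
    exact (integral_nonneg fun _ => by positivity).lt_of_ne' h0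
  by_contra! hle
  have := potential_le hs hU hle
  have := mass_add_kinetic hs hQ.memH hQ.eq
  linarith

end

end FracNLS

theorem theorem3 (s : ℝ) (hs₁ : 1 < s) (hs₂ : s < 2) :
    ∃ N₀ : ℝ, 0 < N₀ ∧
      (∀ Q : FracNLS.L2, FracNLS.IsGroundState s Q → N₀ < FracNLS.mass Q) ∧
      ∀ N : ℝ, 0 < N → N < N₀ → ∀ β : ℝ, 0 ≤ β →
        ∀ Q ∈ FracNLS.minimizers s β N, ∀ Q' ∈ FracNLS.minimizers s β N,
          ∃ φ y : ℝ, ∀ᵐ x : ℝ, Q' x = Complex.exp (Complex.I * (φ : ℂ)) * Q (x - y) := by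
  obtain ⟨ε₀, hε₀, huniq⟩ := FracNLS.exists_unique_minimizer hs₁ hs₂
  have hs0 : 0 < s := by linarith
  have hm0 := FracNLS.m0_pos hs₁
  have hgn := FracNLS.gnConst_pos s
  -- X is the threshold mass to the power s. The first bound keeps it below the ground state and
  -- excludes minimizers at β = 0; the second ensures ε ≤ ε₀ for every β > 0.
  obtain ⟨X, hX⟩ : ∃ X, X = min ((2 * Real.pi) ^ s / FracNLS.gnConst s)
    (FracNLS.m0 s ^ s * (s * (s - 1) * (s + 1) / 2) * ε₀ ^ (2 - s)) := ⟨_, rfl⟩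
  have hX0 : 0 < X := by
    have : 0 < s - 1 := by linarith
    rw [hX]; positivity
  have hXs : (X ^ s⁻¹) ^ s = X := Real.rpow_inv_rpow hX0.le hs0.ne'
  have hX1 : FracNLS.gnConst s * X ≤ (2 * Real.pi) ^ s := by
    rw [← le_div_iff₀' hgn, hX]; exact min_le_left _ _
  refine ⟨X ^ s⁻¹, by positivity, fun Q hQ => ?_, fun N hN hlt β hβ Q hQ Q' hQ' => ?_⟩
  · have h := FracNLS.one_lt_of_isGroundState hs₁ hQ
    refine (Real.rpow_lt_rpow_iff (by positivity)
      (MeasureTheory.integral_nonneg fun _ => by positivity) hs0).1 ?_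
    rw [hXs]
    exact lt_of_mul_lt_mul_left (hX1.trans_lt h) hgn.le
  · have hNX : N ^ s ≤ X := hXs ▸ Real.rpow_le_rpow hN.le hlt.le hs0.le
    rcases hβ.eq_or_lt with rfl | hβ
    · rw [FracNLS.minimizers_zero_eq_empty hs₁ hN
        ((mul_le_mul_of_nonneg_left hNX hgn.le).trans hX1)] at hQ
      exact hQ.elim
    · obtain ⟨k, hk, ε, hε, c, hc, hle, hkβ, hcε, hcN⟩ := FracNLS.exists_parameters hs₁ hs₂ hm0 hN
        hβ hε₀ (hNX.trans (hX ▸ min_le_right _ _))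
      have ha : 0 < k * ε := by positivity
      obtain ⟨φ, y, h⟩ := huniq ε hε hle _ _
        (FracNLS.isMin_resc hs₁ hs₂ hk hε hc hkβ hcε hcN hQ)
        (FracNLS.isMin_resc hs₁ hs₂ hk hε hc hkβ hcε hcN hQ')
      exact FracNLS.eq_translate_of_tw hs₁ ha ((FracNLS.memH_iff hs₁ Q).1 hQ.1)
        ((FracNLS.memH_iff hs₁ Q').1 hQ'.1) (FracNLS.resc_resc hc.ne' ha.ne' _ _)
        (FracNLS.resc_resc hc.ne' ha.ne' _ _) h
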